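/- A cactus graph is a finite connected simple graph in which every biconnected component (maximal subgraph that has at least one edge, is connected, and remains connected when any one of its vertices is deleted) is a single edge or a simple cycle. A circle-contact representation of a graph $G$ assigns to each vertex $v$ a circle in $\mathbb{R}^2$ with center $p_v$ and radius $r_v>0$ such that the open disks bounded by the circles are pairwise disjoint and, for all $u\neq v$, the vertices $u$ and $v$ are adjacent in $G$ if and only if their circles are tangent, i.e. $|p_u-p_v|=r_u+r_v$. Corollary. Every $n$-vertex cactus graph has a balanced circle-contact representation, that is, one in which the ratio of the largest to the smallest diameter is polynomial in $n$: there are absolute constants $c,d\in\mathbb{N}$ such that every $n$-vertex cactus graph has a circle-contact representation with $$\max_v 2r_v\le c\,n^{d}\,\min_v 2r_v .$$ Moreover, such a representation can be found in $O(n^2)$ time: there are a constant $K$ and a single real-RAM program which, for every $n$ and every cactus graph $G$ on the vertices $0,\dots,n-1$ given by $n$, its number of edges and a list of its edges (each once, in any order and orientation), halts after at most $K n^2$ steps having output the coordinates of the centers and the radii of a circle-contact representation of $G$ that satisfies the above bound. Here the real RAM performs the exact real operations $+,-,\times,\div,\sqrt{\phantom{x}}$ and comparisons and the operations $+,-,\times,\div$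 and comparisons on natural-number words, with array access, in unit time each; it converts words to reals but not reals to words, and every word that it stores is at most $K n^{K}$, i.e. has $O(\log n)$ bits. -/

import Mathlib

/-! ## Cactus graphs -/

/-- A biconnected subgraph: it has an edge, is connected, and stays connected when any one of
its vertices is deleted (so a single edge counts). -/
structure IsBiconnectedSubgraph {V : Type*} {G : SimpleGraph V} (H : G.Subgraph) : Prop where
  edge : H.edgeSet.Nonempty
  connected : H.Connected
  no_cut_vertex : ∀ v ∈ H.verts, (H.deleteVerts {v}).Connected

/-- A biconnected component (block): an inclusion-maximal biconnected subgraph. -/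
def IsBiconnectedComponent {V : Type*} {G : SimpleGraph V} (H : G.Subgraph) : Prop :=
  Maximal IsBiconnectedSubgraph H

/-- The subgraph consists of one edge and its two ends. -/
def IsEdgeSubgraph {V : Type*} {G : SimpleGraph V} (H : G.Subgraph) : Prop :=
  ∃ (u v : V) (h : G.Adj u v), H = G.subgraphOfAdj h

/-- The subgraph is a simple cycle (of length at least three). -/
def IsCycleSubgraph {V : Type*} {G : SimpleGraph V} (H : G.Subgraph) : Prop :=
  ∃ (v : V) (p : G.Walk v v), p.IsCycle ∧ H = p.toSubgraph

/-- A cactus: a connected graph in which every biconnected component is an edge or a cycle. -/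
structure IsCactus {V : Type*} (G : SimpleGraph V) : Prop where
  connected : G.Connected
  blocks : ∀ H : G.Subgraph, IsBiconnectedComponent H → IsEdgeSubgraph H ∨ IsCycleSubgraph H

/-! ## Circle-contact representations -/

/-- Circles with the given centers and radii, one for each vertex, whose open disks are pairwise
disjoint, two of them being tangent exactly when the two vertices are adjacent. -/
structure IsCircleContactRep {V : Type*} (G : SimpleGraph V)
    (center : V → EuclideanSpace ℝ (Fin 2)) (radius : V → ℝ) : Prop where
  radius_pos : ∀ v, 0 < radius v
  interior_disjoint : ∀ u v, u ≠ v →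
    Disjoint (Metric.ball (center u) (radius u)) (Metric.ball (center v) (radius v))
  adj_iff_tangent : ∀ u v, u ≠ v →
    (G.Adj u v ↔ dist (center u) (center v) = radius u + radius v)

/-- The ratio of the largest diameter to the smallest diameter is at most `q`. -/
def DiameterRatioLE {V : Type*} (radius : V → ℝ) (q : ℝ) : Prop :=
  ∀ u v, 2 * radius u ≤ q * (2 * radius v)

/-! ## The real RAM

A structured program over a memory made of arrays of natural numbers (words) and arrays of real
numbers. A program mentions only finitely many arrays by name; a scalar variable is an array used
at index `0` only. There is no operation from real numbers to natural numbers other than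
branching on a comparison. -/

namespace RealRAM

/-- The memory: the array number, then the index, then the content. -/
structure State where
  word : ℕ → ℕ → ℕ
  real : ℕ → ℕ → ℝ

/-- Word expressions. -/
inductive WExpr where
  | lit (k : ℕ)
  | get (a : ℕ) (i : WExpr)
  | add (e f : WExpr)
  | sub (e f : WExpr)
  | mul (e f : WExpr)
  | div (e f : WExpr)

/-- Subtraction is truncated at zero; division rounds down, with value `0` if the divisor is `0`. -/
def WExpr.eval (s : State) : WExpr → ℕ
  | lit k => k
  | get a i => s.word a (i.eval s)
  | add e f => e.eval s + f.eval s
  | sub e f => e.eval s - f.eval s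
  | mul e f => e.eval s * f.eval s
  | div e f => e.eval s / f.eval s

/-- Real expressions. The only constants are natural numbers. -/
inductive RExpr where
  | ofWord (e : WExpr)
  | get (a : ℕ) (i : WExpr)
  | add (e f : RExpr)
  | sub (e f : RExpr)
  | mul (e f : RExpr)
  | div (e f : RExpr)
  | sqrt (e : RExpr)

/-- Exact real arithmetic. Division by zero and the square root of a negative number return `0`. -/
noncomputable def RExpr.eval (s : State) : RExpr → ℝ
  | ofWord e => (e.eval s : ℝ)
  | get a i => s.real a (i.eval s)
  | add e f => e.eval s + f.eval s
  | sub e f => e.eval s - f.eval s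
  | mul e f => e.eval s * f.eval s
  | div e f => e.eval s / f.eval s
  | sqrt e => Real.sqrt (e.eval s)

/-- Tests. -/
inductive Test where
  | wordLT (e f : WExpr)
  | wordEq (e f : WExpr)
  | realLT (e f : RExpr)
  | realEq (e f : RExpr)
  | not (b : Test)
  | and (b c : Test)

/-- The meaning of a test in a state. -/
def Test.holds (s : State) : Test → Prop
  | wordLT e f => e.eval s < f.eval s
  | wordEq e f => e.eval s = f.eval s
  | realLT e f => e.eval s < f.eval s
  | realEq e f => e.eval s = f.eval s
  | not b => ¬ b.holds s
  | and b c => b.holds s ∧ c.holds s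

/-- Programs. `setWord a i e` stores `e` in word array `a` at index `i`, and `setReal` likewise. -/
inductive Program where
  | skip
  | setWord (a : ℕ) (i e : WExpr)
  | setReal (a : ℕ) (i : WExpr) (e : RExpr)
  | seq (p q : Program)
  | ite (b : Test) (p q : Program)
  | loop (b : Test) (p : Program)

/-- Write one word. -/
def State.putWord (s : State) (a i x : ℕ) : State :=
  { s with word := Function.update s.word a (Function.update (s.word a) i x) }

/-- Write one real number. -/
def State.putReal (s : State) (a i : ℕ) (x : ℝ) : State :=
  { s with real := Function.update s.real a (Function.update (s.real a) i x) }

/-- `Exec B p s t s'`: started in state `s`, the program `p` halts in state `s'` after `t` steps,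
and no word greater than `B` is ever stored. A step is one assignment, one `skip` or one
evaluation of the test of a branch or a loop; a fixed program performs only a bounded number of
arithmetic operations and memory accesses in each step. A program that tries to store a word
greater than `B` gets stuck. -/
inductive Exec (B : ℕ) : Program → State → ℕ → State → Prop where
  | skip (s : State) : Exec B .skip s 1 s
  | setWord (a : ℕ) (i e : WExpr) (s : State) (h : e.eval s ≤ B) :
      Exec B (.setWord a i e) s 1 (s.putWord a (i.eval s) (e.eval s))
  | setReal (a : ℕ) (i : WExpr) (e : RExpr) (s : State) :
      Exec B (.setReal a i e) s 1 (s.putReal a (i.eval s) (e.eval s))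
  | seq {p q : Program} {s₁ s₂ s₃ : State} {t t' : ℕ} (hp : Exec B p s₁ t s₂)
      (hq : Exec B q s₂ t' s₃) : Exec B (.seq p q) s₁ (t + t') s₃
  | ite_true {b : Test} {p q : Program} {s s' : State} {t : ℕ} (hb : b.holds s)
      (hp : Exec B p s t s') : Exec B (.ite b p q) s (t + 1) s'
  | ite_false {b : Test} {p q : Program} {s s' : State} {t : ℕ} (hb : ¬ b.holds s)
      (hq : Exec B q s t s') : Exec B (.ite b p q) s (t + 1) s'
  | loop_done {b : Test} {p : Program} {s : State} (hb : ¬ b.holds s) :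
      Exec B (.loop b p) s 1 s
  | loop_step {b : Test} {p : Program} {s₁ s₂ s₃ : State} {t t' : ℕ} (hb : b.holds s₁)
      (hp : Exec B p s₁ t s₂) (hl : Exec B (.loop b p) s₂ t' s₃) :
      Exec B (.loop b p) s₁ (t + t' + 1) s₃

/-- The list contains every edge of `G` exactly once, in an arbitrary order, each edge being given
by its two ends in an arbitrary order. -/
structure IsEdgeList {n : ℕ} (G : SimpleGraph (Fin n)) (E : List (Fin n × Fin n)) : Prop where
  nodup : (E.map fun e => s(e.1, e.2)).Nodup
  mem_iff : ∀ u v : Fin n, s(u, v) ∈ (E.map fun e => s(e.1, e.2)) ↔ G.Adj u v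

/-- The initial memory for a graph with vertices `0, …, n - 1` and edge list `E`: word array `0`
holds the number of vertices and the number of edges, word arrays `1` and `2` hold the first and
the second ends of the edges, and everything else is `0`. -/
def input (n : ℕ) (E : List (Fin n × Fin n)) : State where
  word a i :=
    if a = 0 then (if i = 0 then n else if i = 1 then E.length else 0)
    else if a = 1 then (E.map fun e => (e.1 : ℕ)).getD i 0
    else if a = 2 then (E.map fun e => (e.2 : ℕ)).getD i 0
    else 0
  real _ _ := 0

/-- The centers in the output: real arrays `0` and `1` hold the coordinates. -/
noncomputable def outCenter (n : ℕ) (s : State) (v : Fin n) : EuclideanSpace ℝ (Fin 2) :=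
  !₂[s.real 0 v, s.real 1 v]

/-- The radii in the output: real array `2`. -/
def outRadius (n : ℕ) (s : State) (v : Fin n) : ℝ :=
  s.real 2 v

end RealRAM

/-! ## Fundamental cycles of a depth-first search tree of a cactus -/

namespace SimpleGraph.Subgraph

variable {V : Type*} {G : SimpleGraph V}

/-! Combinatorics. In a cactus two cycles with two common vertices coincide
(`IsCactus.toSubgraph_eq`), because their union is biconnected and hence lies in one block. In a
depth-first search tree every tree edge is therefore covered by at most one back edge
(`Covers.unique`). This yields, for each non-root vertex `v`, the vertex `top v` of its block
nearest to the root (`IsDFSTree.blockTree`). The map `top` defines a second rooted tree, in which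
every edge of the graph joins a vertex to its parent or joins two siblings. The drawing is a
recursion over this second tree.

Sizes. Each vertex `p` with children picks a heaviest one, its heavy child; the other children are
light. The weights satisfy `W p = 1 + L p + W h`, where `h` is the heavy child and `L p` is the sum
of `200000 * W c` over the light children `c`. A constant factor is paid at light children only.
Since `y ^ 18 + 200000 * x ^ 18 ≤ (y + x) ^ 18` for `0 ≤ x ≤ y`, the 18th root of the weight is at
most one plus the sum of the 18th roots at the children, whence `W root ≤ n ^ 18` (`W_root_le`). All
radii lie between `1` and `100000 * W root`.

Geometry. The root and the light vertices have radius at least `100000 * W`. A heavy vertex `h` has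
only radius `1000 * (1 + L h + L (top h))`, just large compared with the light circles that it has
to meet. The heavy child is put straight ahead of its top, tangent to it or at distance one. Its
block is a cycle or an edge, and the light vertices of this block form at most two runs, one before
and one after the heavy child; they are drawn as straight chains in the two pockets on either side
of the axis (`pocket_bounds`). Every other block at `p` is drawn as a level chain on a wall of the
circle of `p`, with only its end circles touching `p`; the walls of different blocks use disjoint
intervals. Everything below a vertex stays in a box. The box of a light vertex is in its shadow as
seen from the top (`bullet`), and the box of a heavy vertex grows additively along heavy edges.
Nested boxes (`inBox_top`) and separation from the top and between siblings (`sep_top`,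
`sep_siblings`) give the representation.

Algorithm. The program builds the adjacency matrix, searches depth first for `2 * n` rounds,
tabulates ancestors, back edges and tops, and computes weights bottom up and circles top down. Each
vertex costs a bounded number of linear scans, so the time is quadratic. Every loop limit depends
only on the word array `0`, which is never written, so the time bound is an expression in the input;
correctness is expressed by `Tri`, and `Tri.pass` turns a loop that fills each cell once into
equations about the final memory. The existence statement for arbitrary vertex types follows by
running the program on a copy of the graph. -/

theorem deleteVerts_sup_connected {H K : G.Subgraph} {x : V}
    (hH : (H.deleteVerts {x}).Connected) (hK : (K.deleteVerts {x}).Connected)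
    (hn : ∃ y, y ≠ x ∧ y ∈ H.verts ∧ y ∈ K.verts) : ((H ⊔ K).deleteVerts {x}).Connected := by
  obtain ⟨y, hyx, hyH, hyK⟩ := hn
  have h := connected_sup hH.preconnected hK.preconnected ⟨y, by simp [hyH, hyx], by simp [hyK, hyx]⟩
  refine h.mono' ?_ ?_
  · intro v w hvw
    simp only [sup_adj, deleteVerts_adj] at hvw ⊢
    rcases hvw with ⟨h1, h2, h3, h4, h5⟩ | ⟨h1, h2, h3, h4, h5⟩
    · exact ⟨Or.inl h1, h2, Or.inl h3, h4, Or.inl h5⟩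
    · exact ⟨Or.inr h1, h2, Or.inr h3, h4, Or.inr h5⟩
  · simp [Set.union_sdiff_distrib]

theorem deleteVerts_of_notMem {H : G.Subgraph} {x : V} (hx : x ∉ H.verts) :
    H.deleteVerts {x} = H := by
  rw [← deleteVerts_inter_verts_left_eq, Set.inter_singleton_eq_empty.2 hx, deleteVerts_empty]

end SimpleGraph.Subgraph

/-! ### Cycles in a cactus -/

section Biconnected

variable {V : Type*} {G : SimpleGraph V}

theorem IsBiconnectedSubgraph.deleteVerts_connected {H : G.Subgraph}
    (hH : IsBiconnectedSubgraph H) (x : V) : (H.deleteVerts {x}).Connected := by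
  by_cases hx : x ∈ H.verts
  · exact hH.no_cut_vertex x hx
  · rw [SimpleGraph.Subgraph.deleteVerts_of_notMem hx]
    exact hH.connected

/-- Deleting one vertex leaves at least one of the two common vertices to hold the two connected
remainders together. -/
theorem IsBiconnectedSubgraph.sup {H K : G.Subgraph} (hH : IsBiconnectedSubgraph H)
    (hK : IsBiconnectedSubgraph K) {x y : V} (hxy : x ≠ y) (hx : x ∈ H.verts) (hx' : x ∈ K.verts)
    (hy : y ∈ H.verts) (hy' : y ∈ K.verts) : IsBiconnectedSubgraph (H ⊔ K) where
  edge := hH.edge.mono (by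
    rw [SimpleGraph.Subgraph.edgeSet_sup]; exact Set.subset_union_left)
  connected := SimpleGraph.Subgraph.connected_sup hH.connected.preconnected
    hK.connected.preconnected ⟨x, hx, hx'⟩
  no_cut_vertex v _ := by
    refine SimpleGraph.Subgraph.deleteVerts_sup_connected (hH.deleteVerts_connected v)
      (hK.deleteVerts_connected v) ?_
    by_cases hv : x = v
    · exact ⟨y, fun h => hxy (hv.trans h.symm), hy, hy'⟩
    · exact ⟨x, hv, hx, hx'⟩

/-- Rotate the cycle to start at the deleted vertex; without its first edge and its last vertex it
is a walk through all the remaining vertices. -/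
theorem SimpleGraph.Walk.IsCycle.isBiconnectedSubgraph {u : V} {p : G.Walk u u} (hp : p.IsCycle) :
    IsBiconnectedSubgraph p.toSubgraph where
  edge := ⟨s(u, p.snd), p.toSubgraph_adj_snd hp.not_nil⟩
  connected := p.toSubgraph_connected
  no_cut_vertex v hv := by
    classical
    have hv' : v ∈ p.support := by simpa using hv
    rw [← p.toSubgraph_rotate hv']
    have hq := hp.rotate hv'
    generalize p.rotate v hv' = q at hq
    cases q with
    | nil => exact absurd rfl hq.ne_nil
    | cons h q =>
      rw [SimpleGraph.Walk.cons_isCycle_iff] at hq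
      have hqn : ¬ q.Nil := by
        intro hn
        exact G.ne_of_adj h hn.eq.symm
      have hmem : ∀ w, w ∈ q.dropLast.support ↔ w ∈ q.support ∧ w ≠ v := by
        intro w
        have h2 := q.support_dropLast_concat hqn
        have h3 : q.support.Nodup := hq.1.support_nodup
        rw [← h2] at h3 ⊢
        simp only [List.nodup_append, List.mem_append, List.mem_singleton] at h3 ⊢
        constructor
        · intro hw
          exact ⟨Or.inl hw, h3.2.2 w hw v rfl⟩
        · rintro ⟨hw | hw, hne⟩
          · exact hw
          · exact absurd hw hne
      refine (SimpleGraph.Walk.toSubgraph_connected q.dropLast).mono' ?_ ?_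
      · intro a b hab
        have ha := (hmem a).1 (SimpleGraph.Walk.mem_support_of_adj_toSubgraph hab)
        have hb := (hmem b).1 (SimpleGraph.Walk.mem_support_of_adj_toSubgraph hab.symm)
        rw [SimpleGraph.Walk.adj_toSubgraph_iff_mem_edges, SimpleGraph.Walk.edges_dropLast] at hab
        rw [SimpleGraph.Subgraph.deleteVerts_adj]
        refine ⟨?_, ha.2, ?_, hb.2, ?_⟩
        · simp [ha.1]
        · simp [hb.1]
        · rw [SimpleGraph.Walk.adj_toSubgraph_iff_mem_edges]
          simp [List.mem_of_mem_dropLast hab]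
      · ext w
        simp only [SimpleGraph.Walk.mem_verts_toSubgraph, hmem, SimpleGraph.Subgraph.deleteVerts_verts,
          Set.mem_sdiff, SimpleGraph.Walk.support_cons, List.mem_cons, Set.mem_singleton_iff]
        tauto

/-- At a vertex of the smaller cycle both cycles have exactly two neighbors, so the neighborhoods
agree, and connectedness of the larger cycle spreads this to all its vertices. -/
theorem SimpleGraph.Walk.IsCycle.toSubgraph_eq_of_le {u v : V} {p : G.Walk u u} {c : G.Walk v v}
    (hp : p.IsCycle) (hc : c.IsCycle) (hle : p.toSubgraph ≤ c.toSubgraph) :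
    p.toSubgraph = c.toSubgraph := by
  have key : ∀ x ∈ p.support, ∀ y, c.toSubgraph.Adj x y → p.toSubgraph.Adj x y := by
    intro x hx y hxy
    have hx' : x ∈ c.support := by
      have := hle.1 (show x ∈ p.toSubgraph.verts by simpa using hx)
      simpa using this
    have h1 := hp.ncard_neighborSet_toSubgraph_eq_two hx
    have h2 := hc.ncard_neighborSet_toSubgraph_eq_two hx'
    have hfin : (c.toSubgraph.neighborSet x).Finite := c.finite_neighborSet_toSubgraph
    have h3 : p.toSubgraph.neighborSet x = c.toSubgraph.neighborSet x :=
      Set.eq_of_subset_of_ncard_le (fun z hz => hle.2 hz) (by rw [h1, h2]) hfin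
    have : y ∈ p.toSubgraph.neighborSet x := by rw [h3]; exact hxy
    exact this
  have hverts : ∀ x ∈ c.toSubgraph.verts, x ∈ p.support := by
    have hu : u ∈ c.toSubgraph.verts := hle.1 p.start_mem_verts_toSubgraph
    intro x hx
    obtain ⟨w⟩ := c.toSubgraph_connected.preconnected ⟨u, hu⟩ ⟨x, hx⟩
    have : ∀ (a b : c.toSubgraph.verts), c.toSubgraph.coe.Walk a b → a.1 ∈ p.support →
        b.1 ∈ p.support := by
      intro a b w
      induction w with
      | nil => exact id
      | cons h _ ih =>
        intro ha
        exact ih (SimpleGraph.Walk.mem_support_of_adj_toSubgraph (key _ ha _ h).symm)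
    exact this _ _ w p.start_mem_support
  refine le_antisymm hle ⟨fun x hx => by simpa using hverts x hx, fun x y hxy => ?_⟩
  exact key x (hverts x (c.toSubgraph.edge_vert hxy)) y hxy

/-- The union of the two cycles is biconnected and extends to a block. The block cannot be an edge,
so it is a cycle, and each of the two cycles fills it. -/
theorem IsCactus.toSubgraph_eq [Finite V] (hG : IsCactus G) {u v : V} {p : G.Walk u u}
    {q : G.Walk v v} (hp : p.IsCycle) (hq : q.IsCycle) {x y : V} (hxy : x ≠ y)
    (hx : x ∈ p.support) (hx' : x ∈ q.support) (hy : y ∈ p.support) (hy' : y ∈ q.support) :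
    p.toSubgraph = q.toSubgraph := by
  have hb : IsBiconnectedSubgraph (p.toSubgraph ⊔ q.toSubgraph) :=
    hp.isBiconnectedSubgraph.sup hq.isBiconnectedSubgraph hxy (by simpa) (by simpa) (by simpa)
      (by simpa)
  have : Finite G.Subgraph := by
    have : Function.Injective (fun H : G.Subgraph => (H.verts, H.Adj)) := by
      intro H K h
      simp only [Prod.mk.injEq] at h
      exact SimpleGraph.Subgraph.ext h.1 h.2
    exact Finite.of_injective _ this
  obtain ⟨H, hle, hH⟩ := (Set.toFinite {H : G.Subgraph | IsBiconnectedSubgraph H}).exists_le_maximal hb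
  have hpH : p.toSubgraph ≤ H := le_sup_left.trans hle
  have hqH : q.toSubgraph ≤ H := le_sup_right.trans hle
  rcases hG.blocks H hH with ⟨a, b, hab, rfl⟩ | ⟨a, c, hc, rfl⟩
  -- A vertex of a cycle has two neighbors in it, but only one within a single edge.
  · exfalso
    have h2 := hp.ncard_neighborSet_toSubgraph_eq_two p.start_mem_support
    have hsub : p.toSubgraph.neighborSet u ⊆ {a, b} \ {u} := by
      intro z hz
      have h3 := hpH.2 hz
      have h4 := (G.subgraphOfAdj hab).edge_vert h3.symm
      simp only [SimpleGraph.subgraphOfAdj_verts] at h4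
      exact ⟨h4, fun h => (p.toSubgraph.adj_sub hz).ne h.symm⟩
    have hu : u ∈ ({a, b} : Set V) := by
      have := hpH.1 p.start_mem_verts_toSubgraph
      simpa using this
    have h5 := Set.ncard_le_ncard hsub ((Set.toFinite _))
    rw [Set.ncard_sdiff_singleton_of_mem hu, Set.ncard_pair hab.ne, h2] at h5
    omega
  · rw [hp.toSubgraph_eq_of_le hc hpH, hq.toSubgraph_eq_of_le hc hqH]

end Biconnected

/-- `u` is an ancestor of `v`, or equal to it, in the tree with the given root and parents. -/
def Anc {V : Type*} (root : V) (par : V → V) : V → V → Prop :=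
  Relation.ReflTransGen fun a b => b ≠ root ∧ par b = a

/-- A spanning tree of `G` with an enumeration along which every edge of `G` connects an ancestor
with a descendant. -/
structure IsDFSTree {V : Type*} (G : SimpleGraph V) (root : V) (par : V → V) (idx : V → ℕ) :
    Prop where
  idx_injective : Function.Injective idx
  adj_par : ∀ v, v ≠ root → G.Adj v (par v)
  idx_par : ∀ v, v ≠ root → idx (par v) < idx v
  anc_of_adj : ∀ u v, G.Adj u v → idx u < idx v → Anc root par u v

/-! ### Ancestors and fundamental cycles -/

namespace IsDFSTree

variable {V : Type*} {G : SimpleGraph V} {root : V} {par : V → V} {idx : V → ℕ}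

theorem anc_cases {a b : V} (h : Anc root par a b) :
    a = b ∨ (b ≠ root ∧ Anc root par a (par b)) := by
  rcases Relation.ReflTransGen.cases_tail h with h | ⟨c, hc, hb, rfl⟩
  · exact Or.inl h.symm
  · exact Or.inr ⟨hb, hc⟩

theorem anc_par {a b : V} (hb : b ≠ root) (h : Anc root par a (par b)) : Anc root par a b :=
  Relation.ReflTransGen.tail h ⟨hb, rfl⟩

theorem anc_total {x y z : V} (hx : Anc root par x z) (hy : Anc root par y z) :
    Anc root par x y ∨ Anc root par y x := by
  induction hx with
  | refl => exact Or.inr hy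
  | tail hb hc ih =>
    rcases anc_cases hy with rfl | ⟨_, h⟩
    · exact Or.inl (hb.tail hc)
    · rw [hc.2] at h
      exact ih h

variable (hT : IsDFSTree G root par idx)
include hT

theorem idx_le {a b : V} (h : Anc root par a b) : idx a ≤ idx b := by
  induction h with
  | refl => exact le_rfl
  | tail _ h ih => exact ih.trans (by have := hT.idx_par _ h.1; rw [h.2] at this; exact this.le)

theorem idx_lt {a b : V} (h : Anc root par a b) (hne : a ≠ b) : idx a < idx b :=
  lt_of_le_of_ne (hT.idx_le h) fun h' => hne (hT.idx_injective h')

/-- The walk along parents is a path because the numbers decrease. The bound on the numbers drives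
the induction; the last two clauses record that the path meets everything between its ends and uses
tree edges only. -/
theorem exists_path {a z : V} (h : Anc root par a z) :
    ∃ p : G.Walk z a, p.IsPath ∧ (∀ x ∈ p.support, idx x ≤ idx z) ∧
      (∀ x, Anc root par a x → Anc root par x z → x ∈ p.support) ∧
      ∀ e ∈ p.edges, ∃ x, x ≠ root ∧ e = s(x, par x) := by
  induction h with
  | refl =>
    refine ⟨.nil, .nil, by simp, ?_, by simp⟩
    intro x h1 h2
    have := hT.idx_injective (le_antisymm (hT.idx_le h1) (hT.idx_le h2))
    simp [this]
  | @tail b c hab hbc ih =>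
    obtain ⟨p, hp, hsup, hmem, hed⟩ := ih
    obtain ⟨hc, rfl⟩ := hbc
    refine ⟨.cons (hT.adj_par c hc) p, ?_, ?_, ?_, ?_⟩
    · refine hp.cons fun h => ?_
      exact absurd (hsup _ h) (not_le.2 (hT.idx_par c hc))
    · intro x hx
      rw [SimpleGraph.Walk.support_cons, List.mem_cons] at hx
      rcases hx with rfl | hx
      · exact le_rfl
      · exact (hsup x hx).trans (hT.idx_par c hc).le
    · intro x h1 h2
      rw [SimpleGraph.Walk.support_cons, List.mem_cons]
      rcases anc_cases h2 with h2 | ⟨_, h2⟩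
      · exact Or.inl h2
      · exact Or.inr (hmem x h1 h2)
    · intro e he
      rw [SimpleGraph.Walk.edges_cons, List.mem_cons] at he
      rcases he with rfl | he
      · exact ⟨c, hc, rfl⟩
      · exact hed e he

/-- The cycle closed by an edge that is not in the tree. -/
theorem exists_cycle {a z : V} (h : Anc root par a z) (hadj : G.Adj a z) (hz : par z ≠ a) :
    ∃ p : G.Walk a a, p.IsCycle ∧
      (∀ x, Anc root par a x → Anc root par x z → x ∈ p.support) ∧
      p.toSubgraph.Adj a z ∧
      ∀ e ∈ p.edges, e = s(a, z) ∨ ∃ x, x ≠ root ∧ e = s(x, par x) := by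
  obtain ⟨p, hp, _, hmem, hed⟩ := hT.exists_path h
  refine ⟨.cons hadj p, ?_, ?_, ?_, ?_⟩
  · rw [SimpleGraph.Walk.cons_isCycle_iff]
    refine ⟨hp, fun he => ?_⟩
    obtain ⟨x, hx, hex⟩ := hed _ he
    rw [Sym2.eq_iff] at hex
    rcases hex with ⟨rfl, h2⟩ | ⟨h1, rfl⟩
    · have := hT.idx_par _ hx
      rw [← h2] at this
      exact absurd (hT.idx_le h) (not_le.2 this)
    · exact hz h1.symm
  · intro x h1 h2
    rw [SimpleGraph.Walk.support_cons]
    exact List.mem_cons_of_mem _ (hmem x h1 h2)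
  · rw [SimpleGraph.Walk.adj_toSubgraph_iff_mem_edges]
    simp
  · intro e he
    rw [SimpleGraph.Walk.edges_cons, List.mem_cons] at he
    rcases he with rfl | he
    · exact Or.inl rfl
    · exact Or.inr (hed e he)

end IsDFSTree

/-- The edge between `z` and its proper ancestor `a`, which is not in the tree, closes a cycle
through the tree edge above `v`. -/
structure Covers {V : Type*} (G : SimpleGraph V) (root : V) (par : V → V) (z a v : V) : Prop where
  adj : G.Adj a z
  par_ne : par z ≠ a
  ne_root : v ≠ root
  anc_left : Anc root par a (par v)
  anc_right : Anc root par v z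

/-- Both fundamental cycles pass through `v` and `par v`, so they coincide, and a fundamental cycle
contains only one edge outside the tree. -/
theorem Covers.unique {V : Type*} [Finite V] {G : SimpleGraph V} {root : V} {par : V → V}
    {idx : V → ℕ} (hG : IsCactus G) (hT : IsDFSTree G root par idx) {z a z' a' v : V}
    (h : Covers G root par z a v) (h' : Covers G root par z' a' v) : z = z' ∧ a = a' := by
  have hpv : Anc root par (par v) v := IsDFSTree.anc_par h.ne_root .refl
  have haz : Anc root par a z := (h.anc_left.trans hpv).trans h.anc_right
  have haz' : Anc root par a' z' := (h'.anc_left.trans hpv).trans h'.anc_right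
  obtain ⟨p, hp, hps, hpa, -⟩ := hT.exists_cycle haz h.adj h.par_ne
  obtain ⟨q, hq, hqs, -, hqe⟩ := hT.exists_cycle haz' h'.adj h'.par_ne
  have hne : v ≠ par v := fun h1 => by
    have := hT.idx_par v h.ne_root
    rw [← h1] at this
    exact lt_irrefl _ this
  have heq := hG.toSubgraph_eq hp hq hne
    (hps _ (h.anc_left.trans hpv) h.anc_right) (hqs _ (h'.anc_left.trans hpv) h'.anc_right)
    (hps _ h.anc_left (hpv.trans h.anc_right)) (hqs _ h'.anc_left (hpv.trans h'.anc_right))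
  rw [heq, SimpleGraph.Walk.adj_toSubgraph_iff_mem_edges] at hpa
  have hlt := hT.idx_lt haz h.adj.ne
  -- The closing edge of the first cycle lies on the second. It is not a tree edge, so it is the
  -- closing edge there; the numbers fix its orientation.
  rcases hqe _ hpa with he | ⟨x, hx, he⟩
  · rw [Sym2.eq_iff] at he
    rcases he with ⟨rfl, rfl⟩ | ⟨rfl, rfl⟩
    · exact ⟨rfl, rfl⟩
    · exact absurd (hT.idx_le haz') (not_le.2 hlt)
  · rw [Sym2.eq_iff] at he
    rcases he with ⟨rfl, rfl⟩ | ⟨h1, rfl⟩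
    · exact absurd (hT.idx_par _ hx) (not_lt.2 hlt.le)
    · exact absurd h1.symm h.par_ne

/-- The block structure of a rooted cactus: `par` is the parent in a search tree, and `top v` is
the vertex nearest to the root of the block that contains the edge between `v` and `par v`. -/
structure BlockTree {V : Type*} (G : SimpleGraph V) (root : V) (par top : V → V) (idx : V → ℕ) :
    Prop where
  idx_injective : Function.Injective idx
  idx_par : ∀ v, v ≠ root → idx (par v) < idx v
  top_cases : ∀ v, v ≠ root → top v = par v ∨ (par v ≠ root ∧ top v = top (par v))
  next_unique : ∀ v w, v ≠ root → w ≠ root → par v = par w → top v ≠ par v → top w ≠ par w → v = w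
  adj_par : ∀ v, v ≠ root → G.Adj v (par v)
  adj_top : ∀ v, v ≠ root → (∀ w, w ≠ root → par w = v → top w = v) → G.Adj v (top v)
  adj_cases : ∀ u v, G.Adj u v → idx v < idx u → u ≠ root ∧
    (v = par u ∨ (v = top u ∧ ∀ w, w ≠ root → par w = u → top w = u))

/-- The tree edges covered by one back edge form a vertical path, and together with the back edge
they make a block; uncovered tree edges are blocks by themselves. Uniqueness of the cover makes
`top` well determined. -/
theorem IsDFSTree.blockTree {V : Type*} [Finite V] {G : SimpleGraph V} {root : V} {par top : V → V}
    {idx : V → ℕ} (hG : IsCactus G) (hT : IsDFSTree G root par idx)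
    (hroot : ∀ v, v ≠ root → Anc root par root v)
    (htop : ∀ v, v ≠ root → (∃ z, Covers G root par z (top v) v) ∨
      (top v = par v ∧ ∀ z a, ¬ Covers G root par z a v)) :
    BlockTree G root par top idx := by
  have hup : ∀ {z a v}, Covers G root par z a v → a = par v ∨
      (par v ≠ root ∧ Covers G root par z a (par v)) := by
    intro z a v h
    rcases IsDFSTree.anc_cases h.anc_left with h1 | ⟨h1, h2⟩
    · exact Or.inl h1
    · exact Or.inr ⟨h1, h.adj, h.par_ne, h1, h2,
        (IsDFSTree.anc_par h.ne_root Relation.ReflTransGen.refl).trans h.anc_right⟩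
  have htop_eq : ∀ {z a v}, Covers G root par z a v → top v = a := by
    intro z a v h
    rcases htop v h.ne_root with ⟨z', h'⟩ | ⟨_, h'⟩
    · exact (h'.unique hG hT h).2
    · exact absurd h (h' z a)
  have hcov : ∀ v, v ≠ root → top v ≠ par v → ∃ z, Covers G root par z (top v) v := by
    intro v hv h
    rcases htop v hv with h' | ⟨h', _⟩
    · exact h'
    · exact absurd h' h
  have hself : ∀ v, v ≠ root → par v ≠ v := fun v hv h => by
    have := hT.idx_par v hv
    rw [h] at this
    exact lt_irrefl _ this
  have hback : ∀ u v, G.Adj u v → idx v < idx u → v ≠ par u → u ≠ root ∧ Covers G root par u v u := by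
    intro u v huv hlt hne
    have hA := hT.anc_of_adj v u huv.symm hlt
    rcases IsDFSTree.anc_cases hA with h | ⟨h1, h2⟩
    · exact absurd h huv.ne'
    · exact ⟨h1, huv.symm, fun h => hne h.symm, h1, h2, .refl⟩
  refine ⟨hT.idx_injective, hT.idx_par, ?_, ?_, hT.adj_par, ?_, ?_⟩
  · intro v hv
    by_cases h : top v = par v
    · exact Or.inl h
    · obtain ⟨z, hz⟩ := hcov v hv h
      rcases hup hz with h1 | ⟨h1, h2⟩
      · exact Or.inl h1
      · exact Or.inr ⟨h1, (htop_eq h2).symm⟩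
  -- Both covering edges also cover the tree edge above the common parent, so they are the same
  -- edge. Its lower end is then below both siblings, which must be equal.
  · intro v w hv hw hvw hv' hw'
    obtain ⟨z, hz⟩ := hcov v hv hv'
    obtain ⟨z', hz'⟩ := hcov w hw hw'
    rcases hup hz with h1 | ⟨h1, h2⟩
    · exact absurd h1 hv'
    rcases hup hz' with h1' | ⟨h1', h2'⟩
    · exact absurd h1' hw'
    rw [← hvw] at h2'
    obtain ⟨rfl, -⟩ := h2.unique hG hT h2'
    by_contra hne
    rcases IsDFSTree.anc_total hz.anc_right hz'.anc_right with h | h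
    · rcases IsDFSTree.anc_cases h with h | ⟨_, h⟩
      · exact hne h
      · rw [← hvw] at h
        exact absurd (hT.idx_le h) (not_le.2 (hT.idx_par v hv))
    · rcases IsDFSTree.anc_cases h with h | ⟨_, h⟩
      · exact hne h.symm
      · rw [hvw] at h
        exact absurd (hT.idx_le h) (not_le.2 (hT.idx_par w hw))
  · intro v hv hlast
    by_cases h : top v = par v
    · rw [h]; exact hT.adj_par v hv
    · obtain ⟨z, hz⟩ := hcov v hv h
      -- Otherwise the child of `v` towards `z` is covered by the same back edge and has the same
      -- top, which `hlast` says is `v`; but the top of `v` is numbered below `v`.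
      have : z = v := by
        by_contra hne
        obtain h1 | ⟨c, ⟨hc, hcp⟩, hcz⟩ := Relation.ReflTransGen.cases_head hz.anc_right
        · exact hne h1.symm
        · have hcc : Covers G root par z (top v) c := by
            refine ⟨hz.adj, hz.par_ne, hc, ?_, hcz⟩
            rw [hcp]
            exact IsDFSTree.anc_par hv hz.anc_left
          have h3 := htop_eq hcc
          rw [hlast c hc hcp] at h3
          have h4 := hT.idx_le hz.anc_left
          rw [← h3] at h4
          exact absurd (hT.idx_par v hv) (not_lt.2 h4)
      rw [← this] at hz ⊢
      exact hz.adj.symm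
  · intro u v huv hlt
    by_cases hv : v = par u
    · refine ⟨?_, Or.inl hv⟩
      rintro rfl
      exact absurd (hT.idx_le (hroot v huv.ne')) (not_le.2 hlt)
    · obtain ⟨hu, hc⟩ := hback u v huv hlt hv
      refine ⟨hu, Or.inr ⟨(htop_eq hc).symm, ?_⟩⟩
      intro w hw hwu
      by_contra hne
      rw [← hwu] at hne
      obtain ⟨z, hz⟩ := hcov w hw hne
      rcases hup hz with h1 | ⟨h1, h2⟩
      · exact hne h1
      · rw [hwu] at h2
        obtain ⟨rfl, -⟩ := h2.unique hG hT hc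
        have := hT.idx_le hz.anc_right
        rw [← hwu] at this
        exact absurd (hT.idx_par w hw) (not_lt.2 this)


/-! ## Segments of a cactus -/

/-- The combinatorial and geometric data of the drawing. `hv v` is the heavy child of `v`, `blk v`
the first vertex of the block above `v`, `sg v` the first vertex of the maximal run of light
vertices of that block that contains `v`; `W` is the weight of a vertex, `L` the total size of its
light children, `S` the size of a run, `M` the size of its inner vertices, `pre v` the total size of
the runs of light siblings that start before `v`. The circle at `v` has center `(cx v, cy v)` and radius
`r v`, and the part of the drawing below `v` lies in direction `(dx v, dy v)`. -/
structure Layout (V : Type*) where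
  root : V
  par : V → V
  top : V → V
  blk : V → V
  sg : V → V
  hv : V → Option V
  idx : V → ℕ
  W : V → ℝ
  L : V → ℝ
  S : V → ℝ
  M : V → ℝ
  pre : V → ℝ
  cx : V → ℝ
  cy : V → ℝ
  r : V → ℝ
  dx : V → ℝ
  dy : V → ℝ

namespace Layout

variable {V : Type*} (D : Layout V)

/-- Heavy vertices. -/
def Heavy (c : V) : Prop := c ≠ D.root ∧ D.hv (D.top c) = some c

/-- Light vertices; the root is neither heavy nor light. -/
def Light (c : V) : Prop := c ≠ D.root ∧ D.hv (D.top c) ≠ some c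

/-- The vertex starts a run of light vertices. -/
def First (c : V) : Prop := D.par c = D.top c ∨ D.Heavy (D.par c)

/-- The vertex ends a run of light vertices. -/
def Last (c : V) : Prop := ∀ w, w ≠ D.root → D.par w = c → D.top w = c ∨ D.Heavy w

/-- The vertex is the last one of the block above it. -/
def BlockLast (c : V) : Prop := ∀ w, w ≠ D.root → D.par w = c → D.top w = c

/-- The run that starts at `u` lies in a block without the heavy child. -/
def Wall (u : V) : Prop := D.par u = D.top u ∧ ∀ h, D.hv (D.top u) = some h → D.blk h ≠ u

/-- The run that starts at `u` ends just before the heavy child. -/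
def Before (u : V) : Prop := D.par u = D.top u ∧ ∃ h, D.hv (D.top u) = some h ∧ D.blk h = u

/-- The run that starts at `u` starts just after the heavy child. -/
def After (u : V) : Prop := D.par u ≠ D.top u

/-- The size of a light vertex. -/
def b (c : V) : ℝ := 100000 * D.W c

/-- Inner vertices of runs. -/
def Mid (c : V) : Prop := D.Light c ∧ ¬ D.First c ∧ ¬ D.Last c

open Classical in
/-- The combinatorial part of the data is consistent. -/
structure Combinatorial [Fintype V] (G : SimpleGraph V) : Prop where
  blockTree : BlockTree G D.root D.par D.top D.idx
  hv_some : ∀ p h, D.hv p = some h →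
    h ≠ D.root ∧ D.top h = p ∧ ∀ c, c ≠ D.root → D.top c = p → D.W c ≤ D.W h
  hv_none : ∀ p, D.hv p = none → ∀ c, c ≠ D.root → D.top c ≠ p
  W_eq : ∀ p, D.W p = 1 + D.L p + (D.hv p).elim 0 D.W
  L_eq : ∀ p, D.L p = ∑ c with D.Light c ∧ D.top c = p, 2 * D.b c
  blk_first : ∀ c, c ≠ D.root → D.par c = D.top c → D.blk c = c
  blk_next : ∀ c, c ≠ D.root → D.par c ≠ D.top c → D.blk c = D.blk (D.par c)
  sg_first : ∀ c, D.Light c → D.First c → D.sg c = c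
  sg_next : ∀ c, D.Light c → ¬ D.First c → D.sg c = D.sg (D.par c)
  S_eq : ∀ u, D.Light u → D.First u → D.S u = ∑ c with D.Light c ∧ D.sg c = u, 2 * D.b c
  M_eq : ∀ u, D.Light u → D.First u → D.M u = ∑ c with D.Mid c ∧ D.sg c = u, 2 * D.b c
  pre_eq : ∀ u, D.Light u → D.First u → D.pre u =
    ∑ c with (D.Light c ∧ D.top c = D.top u) ∧ D.idx (D.sg c) < D.idx u, 2 * D.b c

namespace Combinatorial

variable {D} [Fintype V] {G : SimpleGraph V} (hD : D.Combinatorial G)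
include hD

theorem idx_par {c : V} (hc : c ≠ D.root) : D.idx (D.par c) < D.idx c := hD.blockTree.idx_par c hc

theorem idx_injective : Function.Injective D.idx := hD.blockTree.idx_injective

theorem idx_top_le {c : V} (hc : c ≠ D.root) : D.idx (D.top c) ≤ D.idx (D.par c) := by
  induction hn : D.idx c using Nat.strong_induction_on generalizing c with
  | _ n ih =>
    rcases hD.blockTree.top_cases c hc with h | ⟨h1, h2⟩
    · rw [h]
    · rw [h2]
      exact (ih _ (hn ▸ hD.idx_par hc) h1 rfl).trans (hD.idx_par h1).le

theorem idx_top {c : V} (hc : c ≠ D.root) : D.idx (D.top c) < D.idx c :=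
  (hD.idx_top_le hc).trans_lt (hD.idx_par hc)

omit [Fintype V] hD in
theorem light_or_heavy {c : V} (hc : c ≠ D.root) : D.Light c ∨ D.Heavy c := by
  by_cases h : D.hv (D.top c) = some c
  · exact Or.inr ⟨hc, h⟩
  · exact Or.inl ⟨hc, h⟩

theorem par_of_not_first {c : V} (hc : D.Light c) (hf : ¬ D.First c) :
    D.Light (D.par c) ∧ D.top c = D.top (D.par c) ∧ D.top c ≠ D.par c := by
  rw [First, not_or] at hf
  rcases hD.blockTree.top_cases c hc.1 with h | ⟨h1, h2⟩
  · exact absurd h.symm hf.1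
  · refine ⟨?_, h2, fun h => hf.1 h.symm⟩
    exact (light_or_heavy h1).resolve_right hf.2

/-- Following parents inside the block down to the start of the run changes neither lightness nor
the top. -/
theorem sg_props {c : V} (hc : D.Light c) :
    D.Light (D.sg c) ∧ D.First (D.sg c) ∧ D.top (D.sg c) = D.top c ∧ D.idx (D.sg c) ≤ D.idx c ∧
      D.sg (D.sg c) = D.sg c := by
  induction hn : D.idx c using Nat.strong_induction_on generalizing c with
  | _ n ih =>
    by_cases hf : D.First c
    · have := hD.sg_first c hc hf
      rw [this]
      exact ⟨hc, hf, rfl, hn.le, this⟩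
    · obtain ⟨h1, h2, _⟩ := hD.par_of_not_first hc hf
      have h3 := hD.idx_par hc.1
      obtain ⟨k1, k2, k3, k4, k5⟩ := ih _ (hn ▸ h3) h1 rfl
      rw [hD.sg_next c hc hf]
      exact ⟨k1, k2, k3.trans h2.symm, k4.trans (hn ▸ h3.le), k5⟩

theorem eq_sg_of_first {c : V} (hc : D.Light c) (hf : D.First c) : c = D.sg c :=
  (hD.sg_first c hc hf).symm

/-- The successor of a vertex in its run. -/
theorem exists_next {c c' : V} (hc : D.Light c) (hc' : D.Light c') (hs : D.sg c = D.sg c')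
    (hlt : D.idx c < D.idx c') :
    ∃ x, D.Light x ∧ ¬ D.First x ∧ D.par x = c ∧ D.idx x ≤ D.idx c' ∧ D.sg x = D.sg c := by
  induction hn : D.idx c' using Nat.strong_induction_on generalizing c c' with
  | _ n ih =>
    have hf : ¬ D.First c' := by
      intro hf
      have h1 := hD.eq_sg_of_first hc' hf
      have h2 := (hD.sg_props hc).2.2.2.1
      rw [hs, ← h1] at h2
      exact absurd hlt (not_lt.2 h2)
    obtain ⟨h1, h2, h2'⟩ := hD.par_of_not_first hc' hf
    have h3 := hD.sg_next c' hc' hf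
    rcases lt_trichotomy (D.idx c) (D.idx (D.par c')) with h | h | h
    · obtain ⟨x, x1, x2, x3, x4, x5⟩ := ih _ (hn ▸ hD.idx_par hc'.1) hc h1 (hs.trans h3) h rfl
      exact ⟨x, x1, x2, x3, x4.trans (hn ▸ (hD.idx_par hc'.1).le), x5⟩
    · exact ⟨c', hc', hf, (hD.idx_injective h).symm, hn.le, hs.symm⟩
    -- Here the run leads from the parent of `c'` to `c` through a successor of that parent.
    -- Successors are unique, so it is `c'`, which is numbered too high.
    · exfalso
      obtain ⟨x, x1, x2, x3, x4, x5⟩ := ih _ (hn ▸ hlt) h1 hc (h3.symm.trans hs.symm) h rfl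
      obtain ⟨_, _, k3⟩ := hD.par_of_not_first x1 x2
      have := hD.blockTree.next_unique x c' x1.1 hc'.1 x3 k3 h2'
      rw [this] at x4
      omega

theorem next_unique {x y : V} (hx : D.Light x) (hy : D.Light y) (hxf : ¬ D.First x)
    (hyf : ¬ D.First y) (h : D.par x = D.par y) : x = y :=
  hD.blockTree.next_unique x y hx.1 hy.1 h (hD.par_of_not_first hx hxf).2.2
    (hD.par_of_not_first hy hyf).2.2

/-- A later member of the run would produce a light successor of `c` in its block. -/
theorem le_of_last {c c' : V} (hc : D.Light c) (hc' : D.Light c') (hs : D.sg c = D.sg c')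
    (hl : D.Last c) : D.idx c' ≤ D.idx c := by
  by_contra hlt
  obtain ⟨x, x1, x2, x3, -, -⟩ := hD.exists_next hc hc' hs (not_le.1 hlt)
  rcases hl x x1.1 x3 with h | h
  · exact (hD.par_of_not_first x1 x2).2.2 (h.trans x3.symm)
  · exact x1.2 h.2

theorem last_unique {c c' : V} (hc : D.Light c) (hc' : D.Light c') (hs : D.sg c = D.sg c')
    (hl : D.Last c) (hl' : D.Last c') : c = c' :=
  hD.idx_injective (le_antisymm (hD.le_of_last hc' hc hs.symm hl') (hD.le_of_last hc hc' hs hl))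

theorem not_last_of_next {x : V} (hx : D.Light x) (hxf : ¬ D.First x) : ¬ D.Last (D.par x) := by
  intro hl
  have h := hD.par_of_not_first hx hxf
  have h1 := hD.le_of_last h.1 hx (hD.sg_next x hx hxf).symm hl
  exact absurd (hD.idx_par hx.1) (not_lt.2 h1)

/-- Between a vertex and its successor there is nothing. -/
theorem lt_iff_of_next {x y : V} (hx : D.Light x) (hxf : ¬ D.First x) (hy : D.Light y)
    (hs : D.sg y = D.sg x) : D.idx y < D.idx x ↔ D.idx y ≤ D.idx (D.par x) := by
  constructor
  · intro h
    by_contra h1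
    obtain ⟨k1, k2, k3⟩ := hD.par_of_not_first hx hxf
    obtain ⟨z, z1, z2, z3, z4, z5⟩ := hD.exists_next k1 hy
      ((hD.sg_next x hx hxf).symm.trans hs.symm) (not_le.1 h1)
    have := hD.next_unique z1 hx z2 hxf z3
    subst this
    omega
  · intro h
    exact h.trans_lt (hD.idx_par hx.1)

omit [Fintype V] hD in
theorem wall_or (u : V) :
    D.Wall u ∨ D.Before u ∨ D.After u := by
  by_cases h : D.par u = D.top u
  · by_cases h' : ∃ h, D.hv (D.top u) = some h ∧ D.blk h = u
    · exact Or.inr (Or.inl ⟨h, h'⟩)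
    · push Not at h'
      exact Or.inl ⟨h, h'⟩
  · exact Or.inr (Or.inr h)

theorem heavy_of_hv {p h : V} (hp : D.hv p = some h) : D.Heavy h := by
  obtain ⟨h1, h2, -⟩ := hD.hv_some p h hp
  exact ⟨h1, by rw [h2, hp]⟩

theorem after_par {u : V} (hu : D.Light u) (hf : D.First u) (ha : D.After u) :
    D.Heavy (D.par u) ∧ D.top (D.par u) = D.top u := by
  have h1 := hf.resolve_left ha
  rcases hD.blockTree.top_cases u hu.1 with h | ⟨_, h⟩
  · exact absurd h.symm ha
  · exact ⟨h1, h.symm⟩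

/-- A run that does not start its block starts right after the heavy child, so all its members have
numbers above that of the heavy child. -/
theorem sg_eq_blk {c h : V} (hh : D.hv (D.top c) = some h) (hc : D.Light c)
    (hlt : D.idx c < D.idx h) : D.sg c = D.blk c ∧ D.par (D.sg c) = D.top c := by
  induction hn : D.idx c using Nat.strong_induction_on generalizing c with
  | _ n ih =>
    by_cases hf : D.First c
    · rw [hD.sg_first c hc hf]
      rcases hf with h1 | h1
      · exact ⟨(hD.blk_first c hc.1 h1).symm, h1⟩
      · rcases hD.blockTree.top_cases c hc.1 with h2 | ⟨_, h2⟩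
        · exact ⟨(hD.blk_first c hc.1 h2.symm).symm, h2.symm⟩
        · have h3 := h1.2
          rw [← h2, hh] at h3
          have := hD.idx_par hc.1
          rw [← Option.some.inj h3] at this
          omega
    · obtain ⟨k1, k2, k3⟩ := hD.par_of_not_first hc hf
      have h4 := hD.idx_par hc.1
      have := ih _ (hn ▸ h4) (by rw [← k2, hh]) k1 (h4.trans hlt) rfl
      rw [hD.sg_next c hc hf, hD.blk_next c hc.1 (fun h => k3 h.symm), k2]
      exact this

/-- The predecessor of the heavy child in its block. -/
theorem par_heavy {p h : V} (hh : D.hv p = some h) (hne : D.par h ≠ p) :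
    D.Light (D.par h) ∧ D.top (D.par h) = p ∧ D.sg (D.par h) = D.blk h ∧ D.Last (D.par h) ∧
      D.Before (D.sg (D.par h)) := by
  obtain ⟨h1, rfl, h3⟩ := hD.hv_some p h hh
  rcases hD.blockTree.top_cases h h1 with h4 | ⟨h4, h5⟩
  · exact absurd h4.symm hne
  have hlt := hD.idx_par h1
  have hl : D.Light (D.par h) := by
    refine ⟨h4, fun h6 => ?_⟩
    rw [← h5, hh] at h6
    rw [← Option.some.inj h6] at hlt
    exact lt_irrefl _ hlt
  have h6 := hD.sg_eq_blk (by rw [← h5, hh]) hl hlt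
  rw [← hD.blk_next h h1 hne] at h6
  refine ⟨hl, h5.symm, h6.1, ?_, ?_, h, ?_, h6.1.symm⟩
  · intro w hw hwp
    by_contra hcon
    rw [not_or] at hcon
    have := hD.blockTree.next_unique w h hw h1 hwp (fun h => hcon.1 (h.trans hwp))
      (fun h => hne h.symm)
    subst this
    exact hcon.2 ⟨h1, hh⟩
  · rw [h6.2, (hD.sg_props hl).2.2.1]
  · rw [(hD.sg_props hl).2.2.1, ← h5, hh]

theorem before_last_iff {c h : V} (hc : D.Light c) (hb : D.Before (D.sg c))
    (hh : D.hv (D.top c) = some h) : D.Last c ↔ D.par h = c := by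
  have hp := hD.sg_props hc
  obtain ⟨hb1, h', hb2, hb3⟩ := hb
  rw [hp.2.2.1, hh] at hb2
  obtain rfl := Option.some.inj hb2
  have hh' := hD.hv_some _ _ hh
  have hne : D.par h ≠ D.top c := by
    intro h1
    have := hD.blk_first h hh'.1 (h1.trans hh'.2.1.symm)
    rw [hb3] at this
    exact hp.1.2 (by rw [hp.2.2.1, hh, this])
  obtain ⟨k1, k2, k3, k4, k5⟩ := hD.par_heavy hh hne
  constructor
  · intro hl
    exact hD.last_unique k1 hc (k3.trans hb3) k4 hl
  · rintro rfl
    exact k4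

theorem top_ne_self {c : V} (hc : c ≠ D.root) : D.top c ≠ c := fun h => by
  have := hD.idx_top hc
  rw [h] at this
  exact lt_irrefl _ this

theorem adj_top_iff {c : V} (hc : c ≠ D.root) :
    G.Adj c (D.top c) ↔ D.par c = D.top c ∨ D.BlockLast c := by
  constructor
  · intro h
    obtain ⟨_, h1 | h1⟩ := hD.blockTree.adj_cases _ _ h (hD.idx_top hc)
    · exact Or.inl h1.symm
    · exact Or.inr h1.2
  · rintro (h | h)
    · rw [← h]
      exact hD.blockTree.adj_par c hc
    · exact hD.blockTree.adj_top c hc h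

theorem adj_sibling_iff {c c' : V} (hc : c ≠ D.root) (hc' : c' ≠ D.root)
    (ht : D.top c = D.top c') : G.Adj c c' ↔ D.par c = c' ∨ D.par c' = c := by
  constructor
  · intro h
    rcases lt_trichotomy (D.idx c) (D.idx c') with hlt | heq | hlt
    · obtain ⟨_, h1 | h1⟩ := hD.blockTree.adj_cases _ _ h.symm hlt
      · exact Or.inr h1.symm
      · exact absurd (ht.trans h1.1.symm) (hD.top_ne_self hc)
    · exact absurd (hD.idx_injective heq) h.ne
    · obtain ⟨_, h1 | h1⟩ := hD.blockTree.adj_cases _ _ h hlt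
      · exact Or.inl h1.symm
      · exact absurd (ht.symm.trans h1.1.symm) (hD.top_ne_self hc')
  · rintro (h | h)
    · rw [← h]
      exact hD.blockTree.adj_par c hc
    · rw [← h]
      exact (hD.blockTree.adj_par c' hc').symm

/-- Without the heavy child the whole block below its top is one run, so the ends of the run are the
neighbors of the top. -/
theorem wall_adj_iff {c : V} (hc : D.Light c) (hw : D.Wall (D.sg c)) :
    G.Adj c (D.top c) ↔ D.First c ∨ D.Last c := by
  have hp := hD.sg_props hc
  rw [hD.adj_top_iff hc.1]
  have h1 : D.First c → D.par c = D.top c := fun h => by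
    have h2 := hD.eq_sg_of_first hc h
    rw [← h2] at hw
    exact hw.1
  have h2 : D.Last c → D.BlockLast c := by
    intro hl w hwr hwc
    rcases hl w hwr hwc with h | h
    · exact h
    · by_contra hne
      rcases hD.blockTree.top_cases w hwr with h3 | ⟨_, h3⟩
      · exact hne (h3.trans hwc)
      · rw [hwc] at h3
        have hww : D.hv (D.top c) = some w := by rw [← h3, h.2]
        have h4 := hD.par_heavy hww (by
          rw [hwc]; exact (hD.top_ne_self hc.1).symm)
        refine hw.2 w (by rw [hp.2.2.1, hww]) ?_
        rw [← h4.2.2.1, hwc]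
  constructor
  · rintro (h | h)
    · exact Or.inl (Or.inl h)
    · exact Or.inr fun w hw hwc => Or.inl (h w hw hwc)
  · rintro (h | h)
    · exact Or.inl (h1 h)
    · exact Or.inr (h2 h)

/-- The run opens its block, but its last vertex is followed by the heavy child and does not close
the block. -/
theorem before_adj_iff {c : V} (hc : D.Light c) (hb : D.Before (D.sg c)) :
    G.Adj c (D.top c) ↔ D.First c := by
  have hp := hD.sg_props hc
  have hb' := hb
  obtain ⟨hb1, h, hb2, hb3⟩ := hb
  rw [hp.2.2.1] at hb2
  rw [hD.adj_top_iff hc.1]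
  constructor
  · rintro (h1 | h1)
    · exact Or.inl h1
    · have h2 : D.Last c := fun w hw hwc => Or.inl (h1 w hw hwc)
      rw [hD.before_last_iff hc hb' hb2] at h2
      have hh := hD.hv_some _ _ hb2
      have := h1 h hh.1 h2
      rw [hh.2.1] at this
      exact absurd this (hD.top_ne_self hc.1)
  · intro hf
    rw [← hD.eq_sg_of_first hc hf] at hb1
    exact Or.inl hb1

theorem after_lt {c h : V} (hc : D.Light c) (ha : D.After (D.sg c))
    (hh : D.hv (D.top c) = some h) : D.par (D.sg c) = h ∧ D.idx h < D.idx c := by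
  have hp := hD.sg_props hc
  obtain ⟨h1, h2⟩ := hD.after_par hp.1 hp.2.1 ha
  have h3 := h1.2
  rw [h2, hp.2.2.1, hh] at h3
  have h4 := (Option.some.inj h3).symm
  refine ⟨h4, ?_⟩
  rw [← h4]
  exact (hD.idx_par hp.1.1).trans_le hp.2.2.2.1

/-- No second heavy child can interrupt the run, so it ends with the block; its first vertex hangs
on the heavy child and not on the top. -/
theorem after_adj_iff {c : V} (hc : D.Light c) (ha : D.After (D.sg c)) :
    G.Adj c (D.top c) ↔ D.Last c := by
  have hp := hD.sg_props hc
  rw [hD.adj_top_iff hc.1]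
  constructor
  · rintro (h1 | h1)
    · rw [← hD.eq_sg_of_first hc (Or.inl h1)] at ha
      exact absurd h1 ha
    · exact fun w hw hwc => Or.inl (h1 w hw hwc)
  · intro hl
    refine Or.inr fun w hwr hwc => ?_
    rcases hl w hwr hwc with h | h
    · exact h
    · rcases hD.blockTree.top_cases w hwr with h3 | ⟨_, h3⟩
      · exact h3.trans hwc
      · exfalso
        rw [hwc] at h3
        have h5 := (hD.after_lt hc ha (by rw [← h3, h.2])).2
        have h4 := hD.idx_par hwr
        rw [hwc] at h4
        omega

theorem adj_heavy_wall {c h : V} (hc : D.Light c) (hw : D.Wall (D.sg c))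
    (hh : D.hv (D.top c) = some h) : ¬ G.Adj c h := by
  have hp := hD.sg_props hc
  have hh' := hD.hv_some _ _ hh
  rw [hD.adj_sibling_iff hc.1 hh'.1 hh'.2.1.symm]
  rintro (h1 | h1)
  · have hf : D.First c := Or.inr (h1 ▸ hD.heavy_of_hv hh)
    rw [← hD.eq_sg_of_first hc hf] at hw
    have := hw.1
    rw [h1, ← hh'.2.1] at this
    exact hD.top_ne_self hh'.1 this.symm
  · have h4 := hD.par_heavy hh (by rw [h1]; exact (hD.top_ne_self hc.1).symm)
    refine hw.2 h (by rw [hp.2.2.1, hh]) ?_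
    rw [← h4.2.2.1, h1]

theorem adj_heavy_before {c h : V} (hc : D.Light c) (hw : D.Before (D.sg c))
    (hh : D.hv (D.top c) = some h) : G.Adj c h ↔ D.Last c := by
  have hh' := hD.hv_some _ _ hh
  rw [hD.adj_sibling_iff hc.1 hh'.1 hh'.2.1.symm, hD.before_last_iff hc hw hh, or_iff_right]
  intro h1
  have hf : D.First c := Or.inr (h1 ▸ hD.heavy_of_hv hh)
  rw [← hD.eq_sg_of_first hc hf] at hw
  have := hw.1
  rw [h1, ← hh'.2.1] at this
  exact hD.top_ne_self hh'.1 this.symm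

theorem adj_heavy_after {c h : V} (hc : D.Light c) (hw : D.After (D.sg c))
    (hh : D.hv (D.top c) = some h) : G.Adj c h ↔ D.First c := by
  have hh' := hD.hv_some _ _ hh
  have hlt := hD.after_lt hc hw hh
  rw [hD.adj_sibling_iff hc.1 hh'.1 hh'.2.1.symm, or_iff_left]
  · constructor
    · intro h1
      exact Or.inr (h1 ▸ hD.heavy_of_hv hh)
    · intro hf
      rw [← hD.eq_sg_of_first hc hf] at hlt
      exact hlt.1
  · intro h1
    have := hD.idx_par hh'.1
    rw [h1] at this
    omega

/-- There is only one heavy child, and its block determines the run. With the companion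
`after_unique` each pocket receives at most one run. -/
theorem before_unique {c c' : V} (hc : D.Light c) (hc' : D.Light c') (ht : D.top c = D.top c')
    (hb : D.Before (D.sg c)) (hb' : D.Before (D.sg c')) : D.sg c = D.sg c' := by
  obtain ⟨_, h, h1, h2⟩ := hb
  obtain ⟨_, h', h1', h2'⟩ := hb'
  rw [(hD.sg_props hc).2.2.1] at h1
  rw [(hD.sg_props hc').2.2.1, ← ht, h1] at h1'
  rw [← h2, ← h2', Option.some.inj h1']

theorem after_unique {c c' : V} (hc : D.Light c) (hc' : D.Light c') (ht : D.top c = D.top c')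
    (hb : D.After (D.sg c)) (hb' : D.After (D.sg c')) : D.sg c = D.sg c' := by
  have hp := hD.sg_props hc
  have hp' := hD.sg_props hc'
  have h := hD.after_par hp.1 hp.2.1 hb
  have h' := hD.after_par hp'.1 hp'.2.1 hb'
  have h1 := h.1.2
  have h2 := h'.1.2
  rw [h.2, hp.2.2.1] at h1
  rw [h'.2, hp'.2.2.1, ← ht, h1] at h2
  exact hD.blockTree.next_unique _ _ hp.1.1 hp'.1.1 (Option.some.inj h2)
    (fun h => hb h.symm) (fun h => hb' h.symm)

theorem exists_heavy {c : V} (hc : c ≠ D.root) : ∃ h, D.hv (D.top c) = some h := by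
  cases h : D.hv (D.top c) with
  | none => exact absurd rfl (hD.hv_none _ h c hc)
  | some y => exact ⟨y, rfl⟩

end Combinatorial

end Layout


/-! ## Elementary inequalities of the drawing -/

/-- A chain of circles between two tangent or almost tangent circles: the coordinate `y` of its first
circle along the axis through the two centers and its distance `X` from this axis. -/
theorem pocket_bounds {R R' t E g E' y X : ℝ} (ht : 1000 ≤ t) (hR : 1000 * t ≤ R)
    (hR' : 1000 * t ≤ R') (hE : 0 ≤ E) (hE3 : E ≤ 3 * t) (hg : 0 ≤ g) (hg1 : g ≤ 1)
    (hE' : E' = R + R' + g - E) (hy : y = (E' ^ 2 + (R + t) ^ 2 - (R' + t) ^ 2) / (2 * E'))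
    (hX : X = √((R + t) ^ 2 - y ^ 2)) :
    X ^ 2 + y ^ 2 = (R + t) ^ 2 ∧ X ^ 2 + (R + R' + g - (y + E)) ^ 2 = (R' + t) ^ 2 ∧
      R - 4 * t ≤ y ∧ y + E ≤ R + 5 * t ∧ t < X ∧ X ≤ 11 / 100 * R ∧ 0 < R + R' + g - (y + E) := by
  have hE'0 : 0 < E' := by linarith
  -- The excess of the two sides `R + t` and `R' + t` of the triangle over its base. All estimates
  -- come from `t ≤ e ≤ 5 * t`.
  set e := 2 * t + E - g with he
  have he1 : t ≤ e := by linarith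
  have he5 : e ≤ 5 * t := by linarith
  have hsum : E' = (R + t) + (R' + t) - e := by rw [hE', he]; ring
  have hyE : 2 * E' * y = E' ^ 2 + (R + t) ^ 2 - (R' + t) ^ 2 := by
    rw [hy]; field_simp
  -- the gaps to the tangent positions
  have hd1 : 2 * E' * ((R + t) - y) = e * (2 * (R' + t) - e) := by
    have : 2 * E' * ((R + t) - y) = 2 * E' * (R + t) - 2 * E' * y := by ring
    rw [this, hyE, hsum]; ring
  have hd2 : 2 * E' * ((R' + t) - (E' - y)) = e * (2 * (R + t) - e) := by
    have : 2 * E' * ((R' + t) - (E' - y)) = 2 * E' * (R' + t) - 2 * E' ^ 2 + 2 * E' * y := by ring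
    rw [this, hyE, hsum]; ring
  have hep : 0 < e := by linarith
  have h1 : (R + t) - y ≤ e := by
    refine le_of_mul_le_mul_left ?_ (show 0 < 2 * E' by linarith)
    rw [hd1, mul_comm (2 * E')]
    exact mul_le_mul_of_nonneg_left (by linarith) hep.le
  have h2 : (R' + t) - (E' - y) ≤ e := by
    refine le_of_mul_le_mul_left ?_ (show 0 < 2 * E' by linarith)
    rw [hd2, mul_comm (2 * E')]
    exact mul_le_mul_of_nonneg_left (by linarith) hep.le
  have h3 : 0 < (R + t) - y := by
    have : 0 < 2 * E' * ((R + t) - y) := by rw [hd1]; exact mul_pos hep (by linarith)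
    exact (mul_pos_iff_of_pos_left (by linarith)).1 this
  have hy0 : 0 < y := by linarith
  have hXsq : X ^ 2 = (R + t) ^ 2 - y ^ 2 := by
    rw [hX, Real.sq_sqrt]
    exact sub_nonneg.2 (pow_le_pow_left₀ hy0.le (by linarith) 2)
  have hX0 : 0 ≤ X := hX ▸ Real.sqrt_nonneg _
  have hXf : X ^ 2 = ((R + t) - y) * ((R + t) + y) := by rw [hXsq]; ring
  refine ⟨by rw [hXsq]; ring, ?_, by linarith, ?_, ?_, ?_, ?_⟩
  · have : R + R' + g - (y + E) = E' - y := by rw [hE']; ring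
    rw [this, hXsq]
    linear_combination (-1 : ℝ) * hyE
  · have : y + E = R + R' + g - (E' - y) := by rw [hE']; ring
    rw [this]; linarith
  · -- lower bound of the distance from the axis
    have h4 : t * (R' + t) ≤ 2 * E' * ((R + t) - y) := by
      rw [hd1]
      have : R' + t ≤ 2 * (R' + t) - e := by linarith
      exact mul_le_mul he1 this (by linarith) (by linarith)
    have h5 : t * (R' + t) * (R + t) ≤ 2 * E' * X ^ 2 := by
      rw [hXf, ← mul_assoc]
      exact mul_le_mul h4 (by linarith) (by linarith)
        (mul_nonneg (by linarith) h3.le)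
    -- Both factors are at least `1000 * t`, so their product is at least `500 * t` times their sum,
    -- and the sum is at least `E'`.
    have h6 : 1000 * t * E' ≤ 2 * ((R' + t) * (R + t)) := by
      have k1 : 1000 * t * E' ≤ 1000 * t * ((R' + t) + (R + t)) :=
        mul_le_mul_of_nonneg_left (by linarith) (by linarith)
      have k2 := mul_le_mul_of_nonneg_right (show 1000 * t ≤ R + t by linarith)
        (show 0 ≤ R' + t by linarith)
      have k3 := mul_le_mul_of_nonneg_right (show 1000 * t ≤ R' + t by linarith)
        (show 0 ≤ R + t by linarith)
      linarith
    by_contra hcon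
    have h7 : X ^ 2 ≤ t ^ 2 := pow_le_pow_left₀ hX0 (not_lt.1 hcon) 2
    have h8 : 2 * E' * X ^ 2 ≤ 2 * E' * t ^ 2 := mul_le_mul_of_nonneg_left h7 (by linarith)
    have h9 := mul_le_mul_of_nonneg_left h6 (show 0 ≤ t by linarith)
    have h10 : 0 < t * t * E' := mul_pos (mul_pos (by linarith) (by linarith)) hE'0
    linarith
  · have h4 : X ^ 2 ≤ 5 * t * (2 * (R + t)) := by
      rw [hXf]
      exact mul_le_mul (by linarith) (by linarith) (by linarith) (by linarith)
    have k1 := mul_le_mul_of_nonneg_right hR (show 0 ≤ R by linarith)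
    have k2 := mul_le_mul_of_nonneg_right (show 1000 * t ≤ R by linarith)
      (show 0 ≤ t by linarith)
    have h5 : X ^ 2 ≤ (11 / 100 * R) ^ 2 := by
      rw [mul_pow, sq R]
      linarith [mul_nonneg (show 0 ≤ R by linarith) (show 0 ≤ R by linarith)]
    exact abs_le_of_sq_le_sq' h5 (by linarith) |>.2
  · have : R + R' + g - (y + E) = E' - y := by rw [hE']; ring
    rw [this]; linarith

/-- The first circle of a level chain below a circle of radius `R`. -/
theorem wall_first_bounds {R S a r H : ℝ} (hS : 1000 ≤ S) (hR : 1000 * S ≤ R) (ha : R / 4 ≤ a)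
    (ha' : a ≤ 3 / 10 * R) (hr : r = 2 * S * R / (R + a)) (hH : H = √(R ^ 2 - a ^ 2 + 4 * S * R)) :
    (a - r) ^ 2 + H ^ 2 = (R + r) ^ 2 ∧ S ≤ r ∧ r ≤ 2 * S := by
  have hR0 : 0 < R := by linarith
  have h1 : r * (R + a) = 2 * S * R := by
    rw [hr]; exact div_mul_cancel₀ _ (by linarith)
  have hH2 : H ^ 2 = R ^ 2 - a ^ 2 + 4 * S * R := by
    rw [hH, Real.sq_sqrt]; nlinarith
  refine ⟨?_, ?_, ?_⟩
  · rw [hH2]; linear_combination (-2) * h1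
  · by_contra h
    nlinarith [mul_lt_mul_of_pos_right (not_le.1 h) (show 0 < R + a by linarith)]
  · by_contra h
    nlinarith [mul_lt_mul_of_pos_right (not_le.1 h) (show 0 < R + a by linarith)]

/-- The height of a level chain. -/
theorem wall_height_bounds {R S a H : ℝ} (hS : 1000 ≤ S) (hR : 1000 * S ≤ R) (ha : R / 4 ≤ a)
    (ha' : a ≤ 3 / 10 * R) (hH : H = √(R ^ 2 - a ^ 2 + 4 * S * R)) :
    a ^ 2 + H ^ 2 = R ^ 2 + 4 * S * R ∧ 9 / 10 * R ≤ H ∧ H ≤ R := by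
  have hR0 : 0 < R := by linarith
  have hH2 : H ^ 2 = R ^ 2 - a ^ 2 + 4 * S * R := by
    rw [hH, Real.sq_sqrt]; nlinarith
  have hH0 : 0 ≤ H := hH ▸ Real.sqrt_nonneg _
  refine ⟨by rw [hH2]; ring, ?_, ?_⟩
  · exact abs_le_of_sq_le_sq' (by nlinarith) hH0 |>.2
  · exact abs_le_of_sq_le_sq' (by nlinarith) (by linarith) |>.2

/-- The only circle of a level chain. -/
theorem wall_single_bounds {R S a r H : ℝ} (hS : 1000 ≤ S) (hR : 1000 * S ≤ R)
    (hr : r = √(R ^ 2 + 4 * S * R) - R) (hH : a ^ 2 + H ^ 2 = R ^ 2 + 4 * S * R) :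
    a ^ 2 + H ^ 2 = (R + r) ^ 2 ∧ S ≤ r ∧ r ≤ 2 * S := by
  have hR0 : 0 < R := by linarith
  have h0 : 0 ≤ R ^ 2 + 4 * S * R := by nlinarith
  have h1 : (R + r) ^ 2 = R ^ 2 + 4 * S * R := by
    rw [hr, add_sub_cancel, Real.sq_sqrt h0]
  have h2 : 0 ≤ R + r := by rw [hr, add_sub_cancel]; exact Real.sqrt_nonneg _
  refine ⟨by rw [h1, hH], ?_, ?_⟩
  · have := abs_le_of_sq_le_sq' (show (R + S) ^ 2 ≤ (R + r) ^ 2 by rw [h1]; nlinarith) h2 |>.2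
    linarith
  · have := abs_le_of_sq_le_sq' (show (R + r) ^ 2 ≤ (R + 2 * S) ^ 2 by rw [h1]; nlinarith)
      (by linarith) |>.2
    linarith

/-- The last circle of a level chain of at least two circles. -/
theorem wall_last_bounds {R S a a' r H : ℝ} (hS : 1000 ≤ S) (hR : 1000 * S ≤ R) (ha : R / 4 ≤ a)
    (ha' : a ≤ 3 / 10 * R) (hH : a ^ 2 + H ^ 2 = R ^ 2 + 4 * S * R) (h1 : a ≤ a') (h2 : a' ≤ a + S)
    (hr : r = (a' ^ 2 + H ^ 2 - R ^ 2) / (2 * (R - a'))) :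
    (a' + r) ^ 2 + H ^ 2 = (R + r) ^ 2 ∧ S ≤ r ∧ r ≤ 17 / 5 * S := by
  have hR0 : 0 < R := by linarith
  have ha'R : 0 < R - a' := by linarith
  -- The tangency condition is linear in `r`, since the two squares of `r` cancel.
  have h3 : r * (2 * (R - a')) = a' ^ 2 + H ^ 2 - R ^ 2 := by rw [hr]; field_simp
  refine ⟨by linear_combination (-1 : ℝ) * h3, ?_, ?_⟩
  · by_contra h
    nlinarith [mul_lt_mul_of_pos_right (not_le.1 h) (show 0 < 2 * (R - a') by linarith)]
  · by_contra h
    have h4 := mul_lt_mul_of_pos_right (not_le.1 h) (show 0 < 2 * (R - a') by linarith)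
    have h5 : a' ^ 2 - a ^ 2 ≤ S * (7 / 10 * R) := by
      have : a' ^ 2 - a ^ 2 = (a' - a) * (a' + a) := by ring
      rw [this]
      exact mul_le_mul (by linarith) (by linarith) (by linarith) (by linarith)
    nlinarith

/-- A circle that is disjoint from a disk and whose center is not in front of the center of the
disk is disjoint from everything in front of the disk. -/
theorem bullet {x y r R x' y' r' : ℝ} (hR : 0 < R) (hd : (R + r) ^ 2 ≤ x ^ 2 + y ^ 2) (hy : 0 ≤ y)
    (hx' : |x' - x| + r' < r) (hy' : y ≤ y') (hr' : 0 < r') : (R + r') ^ 2 < x' ^ 2 + y' ^ 2 := by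
  have h0 := abs_nonneg (x' - x)
  have h1 : y ^ 2 ≤ y' ^ 2 := by nlinarith
  -- Pulling the small circle back to the height `y` only brings it closer.
  suffices (R + r') ^ 2 < x' ^ 2 + y ^ 2 by linarith
  set δ := x' - x with hδ
  have hx : x' = x + δ := by rw [hδ]; ring
  rw [hx]
  by_contra hcon
  have hcon := not_lt.1 hcon
  set D := √(x ^ 2 + y ^ 2) with hD
  have hD0 : 0 ≤ D := Real.sqrt_nonneg _
  have hD2 : D ^ 2 = x ^ 2 + y ^ 2 := Real.sq_sqrt (by positivity)
  have hDR : R + r ≤ D := by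
    apply abs_le_of_sq_le_sq' _ hD0 |>.2
    rw [hD2]; exact hd
  have hxD : |x| ≤ D := by
    apply abs_le_of_sq_le_sq _ hD0
    rw [hD2]; nlinarith [sq_nonneg y]
  have h2 : -(D * |δ|) ≤ x * δ := by
    have := neg_abs_le (x * δ)
    rw [abs_mul] at this
    nlinarith
  -- The reverse triangle inequality for a horizontal shift by `δ`; the slack `|δ| + r' < r` then
  -- finishes the argument.
  have h3 : (D - |δ|) ^ 2 ≤ (x + δ) ^ 2 + y ^ 2 := by
    have : |δ| ^ 2 = δ ^ 2 := sq_abs δ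
    nlinarith
  have h4 : R + r' < D - |δ| := by linarith
  nlinarith


/-! ### Coordinates, prescribed circles and chains -/

namespace Layout

variable {V : Type*} (D : Layout V)

/-- Coordinate of `w` relative to `p` along the direction of `p`. -/
def along (p w : V) : ℝ := (D.cx w - D.cx p) * D.dx p + (D.cy w - D.cy p) * D.dy p

/-- Coordinate of `w` relative to `p` across the direction of `p`. -/
def across (p w : V) : ℝ := (D.cy w - D.cy p) * D.dx p - (D.cx w - D.cx p) * D.dy p

/-- Coordinate of `w` relative to `top c` along the run of `c`. -/
def lam (c w : V) : ℝ :=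
  (D.cx w - D.cx (D.top c)) * D.dy c - (D.cy w - D.cy (D.top c)) * D.dx c

/-- Coordinate of `w` relative to `top c` in the direction of `c`. -/
def eta (c w : V) : ℝ :=
  (D.cx w - D.cx (D.top c)) * D.dx c + (D.cy w - D.cy (D.top c)) * D.dy c

/-- Squared distance of two centers. -/
def dsq (v w : V) : ℝ := (D.cx v - D.cx w) ^ 2 + (D.cy v - D.cy w) ^ 2

/-- Left end of the inner part of a run on the wall. -/
noncomputable def wallStart (u : V) : ℝ := D.r (D.top u) / 4 + 12 * D.pre u + 4 * D.S u

/-- Height of a run on the wall. -/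
noncomputable def wallHeight (u : V) : ℝ :=
  √(D.r (D.top u) ^ 2 - D.wallStart u ^ 2 + 4 * D.S u * D.r (D.top u))

/-- Radius of a heavy vertex. -/
def heavyRadius (h : V) : ℝ := 1000 * (1 + D.L h + D.L (D.top h))

open Classical in
/-- Gap between a vertex and its heavy child. -/
noncomputable def gap (h : V) : ℝ := if D.par h = D.top h ∨ D.BlockLast h then 0 else 1

open Classical in
/-- Distance between the centers of the first and the last circle of a run in a pocket. -/
noncomputable def pocketLength (u : V) : ℝ := if D.Last u then 0 else D.M u + 2 * D.S u

/-- Distance between the centers of a vertex and its heavy child `h`. -/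
noncomputable def heavyDist (h : V) : ℝ := D.r (D.top h) + D.heavyRadius h + D.gap h

/-- Base of the triangle that determines the position of a run in a pocket. -/
noncomputable def pocketBase (u h : V) : ℝ := D.heavyDist h - D.pocketLength u

/-- Depth of the run in a pocket. -/
noncomputable def pocketDepth (u h : V) : ℝ :=
  (D.pocketBase u h ^ 2 + (D.r (D.top u) + D.S u) ^ 2 - (D.heavyRadius h + D.S u) ^ 2) /
    (2 * D.pocketBase u h)

/-- Distance of the run in a pocket from the axis. -/
noncomputable def pocketSide (u h : V) : ℝ :=
  √((D.r (D.top u) + D.S u) ^ 2 - D.pocketDepth u h ^ 2)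

open Classical in
/-- Wall direction of a vertex. -/
noncomputable def fx (p : V) : ℝ := if D.Heavy p then - D.dy p else D.dx p

open Classical in
/-- Wall direction of a vertex. -/
noncomputable def fy (p : V) : ℝ := if D.Heavy p then D.dx p else D.dy p

open Classical in
/-- The circles are placed as prescribed. -/
structure Geometric : Prop where
  root_dx : D.dx D.root = 0
  root_dy : D.dy D.root = -1
  root_r : D.r D.root = D.b D.root
  heavy_r : ∀ h, D.Heavy h → D.r h = D.heavyRadius h
  heavy_dx : ∀ h, D.Heavy h → D.dx h = D.dx (D.top h)
  heavy_dy : ∀ h, D.Heavy h → D.dy h = D.dy (D.top h)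
  heavy_cx : ∀ h, D.Heavy h → D.cx h = D.cx (D.top h) + D.heavyDist h * D.dx (D.top h)
  heavy_cy : ∀ h, D.Heavy h → D.cy h = D.cy (D.top h) + D.heavyDist h * D.dy (D.top h)
  next_dx : ∀ c, D.Light c → ¬ D.First c → D.dx c = D.dx (D.par c)
  next_dy : ∀ c, D.Light c → ¬ D.First c → D.dy c = D.dy (D.par c)
  next_cx : ∀ c, D.Light c → ¬ D.First c →
    D.cx c = D.cx (D.par c) + (D.r (D.par c) + D.r c) * D.dy c
  next_cy : ∀ c, D.Light c → ¬ D.First c →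
    D.cy c = D.cy (D.par c) - (D.r (D.par c) + D.r c) * D.dx c
  mid_r : ∀ c, D.Mid c → D.r c = D.b c
  last_wall_r : ∀ c, D.Light c → ¬ D.First c → D.Last c → D.Wall (D.sg c) →
    D.r c = ((D.lam c (D.par c) + D.r (D.par c)) ^ 2 + D.eta c (D.par c) ^ 2 -
      D.r (D.top c) ^ 2) / (2 * (D.r (D.top c) - (D.lam c (D.par c) + D.r (D.par c))))
  last_pocket_r : ∀ c, D.Light c → ¬ D.First c → D.Last c → ¬ D.Wall (D.sg c) →
    D.r c = D.S (D.sg c)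
  wall_dx : ∀ u, D.Light u → D.First u → D.Wall u → D.dx u = D.fx (D.top u)
  wall_dy : ∀ u, D.Light u → D.First u → D.Wall u → D.dy u = D.fy (D.top u)
  wall_r : ∀ u, D.Light u → D.First u → D.Wall u → D.r u =
    if D.Last u then √(D.r (D.top u) ^ 2 + 4 * D.S u * D.r (D.top u)) - D.r (D.top u)
    else 2 * D.S u * D.r (D.top u) / (D.r (D.top u) + D.wallStart u)
  wall_cx : ∀ u, D.Light u → D.First u → D.Wall u → D.cx u = D.cx (D.top u) +
    ((if D.Last u then D.wallStart u else D.wallStart u - D.r u) * D.dy u + D.wallHeight u * D.dx u)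
  wall_cy : ∀ u, D.Light u → D.First u → D.Wall u → D.cy u = D.cy (D.top u) +
    (D.wallHeight u * D.dy u - (if D.Last u then D.wallStart u else D.wallStart u - D.r u) * D.dx u)
  pocket_r : ∀ u, D.Light u → D.First u → ¬ D.Wall u → D.r u = D.S u
  before_dx : ∀ u, D.Light u → D.First u → D.Before u → D.dx u = - D.dy (D.top u)
  before_dy : ∀ u, D.Light u → D.First u → D.Before u → D.dy u = D.dx (D.top u)
  before_cx : ∀ u h, D.Light u → D.First u → D.Before u → D.hv (D.top u) = some h →
    D.cx u = D.cx (D.top u) + (D.pocketDepth u h * D.dy u + D.pocketSide u h * D.dx u)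
  before_cy : ∀ u h, D.Light u → D.First u → D.Before u → D.hv (D.top u) = some h →
    D.cy u = D.cy (D.top u) + (D.pocketSide u h * D.dy u - D.pocketDepth u h * D.dx u)
  after_dx : ∀ u, D.Light u → D.First u → D.After u → D.dx u = D.dy (D.top u)
  after_dy : ∀ u, D.Light u → D.First u → D.After u → D.dy u = - D.dx (D.top u)
  after_cx : ∀ u h, D.Light u → D.First u → D.After u → D.hv (D.top u) = some h →
    D.cx u = D.cx (D.top u) + (-(D.pocketDepth u h + D.pocketLength u) * D.dy u +
      D.pocketSide u h * D.dx u)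
  after_cy : ∀ u h, D.Light u → D.First u → D.After u → D.hv (D.top u) = some h →
    D.cy u = D.cy (D.top u) + (D.pocketSide u h * D.dy u +
      (D.pocketDepth u h + D.pocketLength u) * D.dx u)

section Chain

variable {D} [Fintype V] {G : SimpleGraph V} (hD : D.Combinatorial G)

open Classical in
/-- Total size of the inner vertices of the run of `c` enumerated before `c`. -/
noncomputable def midSum (D : Layout V) (c : V) : ℝ :=
  ∑ x with (D.Mid x ∧ D.sg x = D.sg c) ∧ D.idx x < D.idx c, 2 * D.b x

include hD

/-- The defining equations express weights by those of children, which have larger numbers, so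
positivity is proved from the leaves upwards. -/
theorem Combinatorial.one_le_W (v : V) : 1 ≤ D.W v ∧ D.L v + 1 ≤ D.W v ∧ 0 ≤ D.L v ∧
    ∀ h, D.hv v = some h → D.W v = 1 + D.L v + D.W h := by
  classical
  have hfin : ∀ v, D.idx v ≤ Finset.univ.sup D.idx := fun v => Finset.le_sup (Finset.mem_univ v)
  -- Downward induction on the number, measured from the largest one.
  induction hn : Finset.univ.sup D.idx - D.idx v using Nat.strong_induction_on generalizing v with
  | _ n ih =>
    have hch : ∀ c, c ≠ D.root → D.top c = v → 1 ≤ D.W c := by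
      intro c hc hcv
      have h1 := hD.idx_top hc
      rw [hcv] at h1
      have h2 := hfin c
      exact (ih _ (by omega) c rfl).1
    have hL : 0 ≤ D.L v := by
      rw [hD.L_eq]
      refine Finset.sum_nonneg fun c hc => ?_
      rw [Finset.mem_filter] at hc
      have := hch c hc.2.1.1 hc.2.2
      rw [b]; linarith
    have hW := hD.W_eq v
    cases h : D.hv v with
    | none =>
      rw [h] at hW
      simp only [Option.elim_none] at hW
      exact ⟨by linarith, by linarith, hL, by simp⟩
    | some h' =>
      rw [h] at hW
      simp only [Option.elim_some] at hW
      have h1 := hD.hv_some v h' h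
      have h2 := hch h' h1.1 h1.2.1
      refine ⟨by linarith, by linarith, hL, ?_⟩
      intro h'' hh
      rw [← Option.some.inj hh, hW]

theorem Combinatorial.b_pos (v : V) : 100000 ≤ D.b v := by
  have := (hD.one_le_W v).1
  rw [b]; linarith

/-- All these are comparisons of sums over sets of light siblings. The one that matters most is `S u
+ pre u ≤ L (top u)`: a run and its predecessors fit into the room that the top provides. -/
theorem Combinatorial.sum_le_S {u : V} (hu : D.Light u) (hf : D.First u) :
    0 ≤ D.M u ∧ D.M u ≤ D.S u ∧ (∀ c, D.Light c → D.sg c = u → 2 * D.b c ≤ D.S u) ∧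
      200000 ≤ D.S u ∧ D.S u + D.pre u ≤ D.L (D.top u) ∧ 0 ≤ D.pre u := by
  classical
  have hb : ∀ c, 0 ≤ 2 * D.b c := fun c => by have := hD.b_pos c; linarith
  have h3 : ∀ c, D.Light c → D.sg c = u → 2 * D.b c ≤ D.S u := by
    intro c hc hcu
    rw [hD.S_eq u hu hf]
    exact Finset.single_le_sum (f := fun c => 2 * D.b c) (fun i _ => hb i) (by simp [hc, hcu])
  refine ⟨?_, ?_, h3, ?_, ?_, ?_⟩
  · rw [hD.M_eq u hu hf]
    exact Finset.sum_nonneg fun i _ => hb i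
  · rw [hD.M_eq u hu hf, hD.S_eq u hu hf]
    refine Finset.sum_le_sum_of_subset_of_nonneg ?_ fun i _ _ => hb i
    intro x hx
    simp only [Finset.mem_filter, Finset.mem_univ, true_and] at hx ⊢
    exact ⟨hx.1.1, hx.2⟩
  · have := h3 u hu (hD.sg_first u hu hf)
    have := hD.b_pos u
    linarith
  · rw [hD.S_eq u hu hf, hD.pre_eq u hu hf, hD.L_eq, ← Finset.sum_union]
    · refine Finset.sum_le_sum_of_subset_of_nonneg ?_ fun i _ _ => hb i
      intro x hx
      simp only [Finset.mem_union, Finset.mem_filter, Finset.mem_univ, true_and] at hx ⊢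
      rcases hx with ⟨h1, h2⟩ | h1
      · refine ⟨h1, ?_⟩
        rw [← (hD.sg_props h1).2.2.1, h2]
      · exact h1.1
    · rw [Finset.disjoint_left]
      intro x hx hx'
      simp only [Finset.mem_filter, Finset.mem_univ, true_and] at hx hx'
      rw [hx.2] at hx'
      exact lt_irrefl _ hx'.2
  · rw [hD.pre_eq u hu hf]
    exact Finset.sum_nonneg fun i _ => hb i

/-- Runs of the same vertex are placed one after the other. -/
theorem Combinatorial.pre_add_S_le {u u' : V} (hu : D.Light u) (hf : D.First u) (hu' : D.Light u')
    (hf' : D.First u') (ht : D.top u = D.top u') (hlt : D.idx u < D.idx u') :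
    D.pre u + D.S u ≤ D.pre u' := by
  classical
  have hb : ∀ c, 0 ≤ 2 * D.b c := fun c => by have := hD.b_pos c; linarith
  rw [hD.S_eq u hu hf, hD.pre_eq u hu hf, hD.pre_eq u' hu' hf', ← Finset.sum_union]
  · refine Finset.sum_le_sum_of_subset_of_nonneg ?_ fun i _ _ => hb i
    intro x hx
    simp only [Finset.mem_union, Finset.mem_filter, Finset.mem_univ, true_and] at hx ⊢
    rcases hx with ⟨⟨h1, h2⟩, h3⟩ | ⟨h1, h2⟩
    · exact ⟨⟨h1, h2.trans ht⟩, h3.trans hlt⟩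
    · refine ⟨⟨h1, ?_⟩, h2 ▸ hlt⟩
      rw [← ht, ← (hD.sg_props h1).2.2.1, h2]
  · rw [Finset.disjoint_left]
    intro x hx hx'
    simp only [Finset.mem_filter, Finset.mem_univ, true_and] at hx hx'
    rw [hx'.2] at hx
    exact lt_irrefl _ hx.2

theorem Combinatorial.midSum_bounds {c : V} (hc : D.Light c) :
    0 ≤ D.midSum c ∧ D.midSum c ≤ D.M (D.sg c) ∧ (D.Last c → D.midSum c = D.M (D.sg c)) := by
  classical
  have hb : ∀ c, 0 ≤ 2 * D.b c := fun c => by have := hD.b_pos c; linarith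
  have hp := hD.sg_props hc
  rw [hD.M_eq _ hp.1 hp.2.1, midSum]
  refine ⟨Finset.sum_nonneg fun i _ => hb i, ?_, ?_⟩
  · refine Finset.sum_le_sum_of_subset_of_nonneg ?_ fun i _ _ => hb i
    intro x hx
    simp only [Finset.mem_filter, Finset.mem_univ, true_and] at hx ⊢
    exact hx.1
  · intro hl
    congr 1
    ext x
    simp only [Finset.mem_filter, Finset.mem_univ, true_and, and_iff_left_iff_imp]
    rintro ⟨h1, h2⟩
    refine lt_of_le_of_ne (hD.le_of_last hc h1.1 h2.symm hl) fun h => ?_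
    rw [hD.idx_injective h] at h1
    exact h1.2.2 hl

/-- Consecutive circles touch and inner circles have radius `b`, so the near end of `c` is the far
end of the first circle plus the diameters in between. -/
theorem Combinatorial.chain_eq {u : V} {ξ : V → ℝ}
    (hξ : ∀ c, D.Light c → ¬ D.First c → D.sg c = u → ξ c = ξ (D.par c) + D.r (D.par c) + D.r c)
    (hmid : ∀ c, D.Mid c → D.r c = D.b c) {c : V} (hc : D.Light c) (hf : ¬ D.First c)
    (hcu : D.sg c = u) : ξ c - D.r c = ξ u + D.r u + D.midSum c := by
  classical
  induction hn : D.idx c using Nat.strong_induction_on generalizing c with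
  | _ n ih =>
    obtain ⟨k1, k2, k3⟩ := hD.par_of_not_first hc hf
    have hs := hD.sg_next c hc hf
    rw [hξ c hc hf hcu]
    by_cases hpf : D.First (D.par c)
    · have hpu : D.par c = u := by rw [hD.eq_sg_of_first k1 hpf, ← hs, hcu]
      have : D.midSum c = 0 := by
        rw [midSum, Finset.sum_eq_zero]
        intro x hx
        exfalso
        simp only [Finset.mem_filter, Finset.mem_univ, true_and] at hx
        obtain ⟨⟨h1, h2⟩, h3⟩ := hx
        rw [hD.lt_iff_of_next hc hf h1.1 h2, hpu] at h3
        have h4 := (hD.sg_props h1.1).2.2.2.1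
        rw [h2, hcu] at h4
        have := hD.idx_injective (le_antisymm h3 h4)
        rw [this, ← hpu] at h1
        exact h1.2.1 hpf
      rw [this, hpu]; ring
    · have hm : D.Mid (D.par c) := ⟨k1, hpf, hD.not_last_of_next hc hf⟩
      have h1 := ih _ (hn ▸ hD.idx_par hc.1) k1 hpf (hs ▸ hcu) rfl
      -- Nothing in the run is numbered strictly between `par c` and `c`, so exactly one summand is
      -- new.
      have h2 : D.midSum c = D.midSum (D.par c) + 2 * D.b (D.par c) := by
        rw [midSum, midSum]
        have : (Finset.univ.filter fun x => (D.Mid x ∧ D.sg x = D.sg c) ∧ D.idx x < D.idx c) =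
            insert (D.par c) (Finset.univ.filter fun x =>
              (D.Mid x ∧ D.sg x = D.sg (D.par c)) ∧ D.idx x < D.idx (D.par c)) := by
          ext x
          simp only [Finset.mem_filter, Finset.mem_univ, true_and, Finset.mem_insert]
          constructor
          · rintro ⟨⟨h1, h2⟩, h3⟩
            rw [hD.lt_iff_of_next hc hf h1.1 h2] at h3
            rcases h3.lt_or_eq with h4 | h4
            · exact Or.inr ⟨⟨h1, h2.trans hs⟩, h4⟩
            · exact Or.inl (hD.idx_injective h4)
          · rintro (rfl | ⟨⟨h1, h2⟩, h3⟩)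
            · exact ⟨⟨hm, hs.symm⟩, hD.idx_par hc.1⟩
            · exact ⟨⟨h1, h2.trans hs.symm⟩, h3.trans (hD.idx_par hc.1)⟩
        rw [this, Finset.sum_insert (by simp), add_comm]
      rw [h2]
      rw [← hmid _ hm] at *
      linarith

/-- Circles that are not consecutive have one of positive radius between them, which gives the
strict inequality. -/
theorem Combinatorial.chain_lt {u : V} {ξ : V → ℝ}
    (hξ : ∀ c, D.Light c → ¬ D.First c → D.sg c = u → ξ c = ξ (D.par c) + D.r (D.par c) + D.r c)
    (hr : ∀ c, D.Light c → D.sg c = u → 0 < D.r c) {c c' : V} (hc : D.Light c) (hc' : D.Light c')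
    (hcu : D.sg c = u) (hcu' : D.sg c' = u) (hlt : D.idx c < D.idx c') :
    ξ c + D.r c ≤ ξ c' - D.r c' ∧ (D.par c' ≠ c → ξ c + D.r c < ξ c' - D.r c') := by
  induction hn : D.idx c' - D.idx c using Nat.strong_induction_on generalizing c with
  | _ n ih =>
    obtain ⟨x, x1, x2, x3, x4, x5⟩ := hD.exists_next hc hc' (hcu.trans hcu'.symm) hlt
    have h1 := hξ x x1 x2 (x5.trans hcu)
    have h2 := hD.idx_par x1.1
    rw [x3] at h1 h2
    rcases x4.lt_or_eq with h3 | h3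
    · have h4 := (ih _ (by omega) x1 (x5.trans hcu) h3 rfl).1
      have h5 := hr x x1 (x5.trans hcu)
      exact ⟨by linarith, fun _ => by linarith⟩
    · obtain rfl := hD.idx_injective h3
      exact ⟨by linarith, fun h => absurd x3 h⟩

end Chain

end Layout


/-! ### Contacts of a run with its top and with the heavy child -/

namespace Layout

variable {V : Type*} {D : Layout V} [Fintype V] {G : SimpleGraph V}

namespace Combinatorial

variable (hD : D.Combinatorial G) (hg : D.Geometric)
include hD

theorem not_last_sg {c : V} (hc : D.Light c) (hf : ¬ D.First c) : ¬ D.Last (D.sg c) := by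
  have hp := hD.sg_props hc
  intro hl
  have h1 := hD.le_of_last hp.1 hc hp.2.2.2.2 hl
  have h2 := hD.idx_injective (le_antisymm h1 hp.2.2.2.1)
  rw [h2] at hf
  exact hf hp.2.1

/-- Adjacent siblings are consecutive in one block, and a run is interrupted only by the heavy
child. -/
theorem sg_eq_of_adj {c c' : V} (hc : D.Light c) (hc' : D.Light c') (ht : D.top c = D.top c')
    (h : G.Adj c c') : D.sg c = D.sg c' := by
  have key : ∀ c c', D.Light c → D.Light c' → D.top c = D.top c' → D.par c = c' →
      D.sg c = D.sg c' := by
    intro c c' hc hc' ht h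
    by_cases hf : D.First c
    · rcases hf with h1 | h1
      · exact absurd (ht.symm.trans (h1.symm.trans h)) (hD.top_ne_self hc'.1)
      · rw [h] at h1
        exact absurd h1.2 hc'.2
    · rw [hD.sg_next c hc hf, h]
  rcases (hD.adj_sibling_iff hc.1 hc'.1 ht).1 h with h1 | h1
  · exact key c c' hc hc' ht h1
  · exact (key c' c hc' hc ht.symm h1).symm

include hg

theorem dir_sg {c : V} (hc : D.Light c) : D.dx c = D.dx (D.sg c) ∧ D.dy c = D.dy (D.sg c) := by
  induction hn : D.idx c using Nat.strong_induction_on generalizing c with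
  | _ n ih =>
    by_cases hf : D.First c
    · rw [hD.sg_first c hc hf]; exact ⟨rfl, rfl⟩
    · obtain ⟨h1, -, -⟩ := hD.par_of_not_first hc hf
      rw [hD.sg_next c hc hf, hg.next_dx c hc hf, hg.next_dy c hc hf]
      exact ih _ (hn ▸ hD.idx_par hc.1) h1 rfl

/-- Every direction is that of the top, possibly after a quarter turn. -/
theorem dir_unit (v : V) : D.dx v ^ 2 + D.dy v ^ 2 = 1 := by
  induction hn : D.idx v using Nat.strong_induction_on generalizing v with
  | _ n ih =>
    by_cases hv : v = D.root
    · rw [hv, hg.root_dx, hg.root_dy]; norm_num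
    · have ht := ih _ (hn ▸ hD.idx_top hv) (D.top v) rfl
      rcases light_or_heavy hv with h | h
      · have hp := hD.sg_props h
        rw [(hD.dir_sg hg h).1, (hD.dir_sg hg h).2]
        rw [← hp.2.2.1] at ht
        rcases wall_or (D := D) (D.sg v) with hw | hw | hw
        · rw [hg.wall_dx _ hp.1 hp.2.1 hw, hg.wall_dy _ hp.1 hp.2.1 hw, fx, fy]
          split_ifs <;> linear_combination ht
        · rw [hg.before_dx _ hp.1 hp.2.1 hw, hg.before_dy _ hp.1 hp.2.1 hw]
          linear_combination ht
        · rw [hg.after_dx _ hp.1 hp.2.1 hw, hg.after_dy _ hp.1 hp.2.1 hw]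
          linear_combination ht
      · rw [hg.heavy_dx v h, hg.heavy_dy v h, ht]

theorem lam_next {c : V} (hc : D.Light c) (hf : ¬ D.First c) :
    D.lam c c = D.lam (D.par c) (D.par c) + D.r (D.par c) + D.r c ∧
      D.eta c c = D.eta (D.par c) (D.par c) ∧ D.lam c (D.par c) = D.lam (D.par c) (D.par c) ∧
      D.eta c (D.par c) = D.eta (D.par c) (D.par c) := by
  obtain ⟨-, ht, -⟩ := hD.par_of_not_first hc hf
  have hu := hD.dir_unit hg c
  have h1 := hg.next_cx c hc hf
  have h2 := hg.next_cy c hc hf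
  simp only [lam, eta, ← ht, ← hg.next_dx c hc hf, ← hg.next_dy c hc hf, and_true]
  rw [h1, h2]
  constructor
  · linear_combination (D.r (D.par c) + D.r c) * hu
  · ring

theorem eta_sg {c : V} (hc : D.Light c) : D.eta c c = D.eta (D.sg c) (D.sg c) := by
  induction hn : D.idx c using Nat.strong_induction_on generalizing c with
  | _ n ih =>
    by_cases hf : D.First c
    · rw [hD.sg_first c hc hf]
    · obtain ⟨h1, -, -⟩ := hD.par_of_not_first hc hf
      rw [hD.sg_next c hc hf, (hD.lam_next hg hc hf).2.1]
      exact ih _ (hn ▸ hD.idx_par hc.1) h1 rfl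

theorem lam_chain {c : V} (hc : D.Light c) (hf : ¬ D.First c) :
    D.lam c c - D.r c = D.lam (D.sg c) (D.sg c) + D.r (D.sg c) + D.midSum c :=
  hD.chain_eq (ξ := fun c => D.lam c c) (fun _ hx hxf _ => (hD.lam_next hg hx hxf).1) hg.mid_r hc hf
    rfl

open Classical in
-- All centers of the run are at the height `H` with `a ^ 2 + H ^ 2 = R ^ 2 + 4 * S * R`, where `a`
-- is `wallStart`. The end circles get the radii that solve the tangency equation, of order `S`; the
-- inner circles are too small to reach the top. The run stays in an interval of length `12 * S`.
theorem wall_facts {c : V} (hc : D.Light c) (hw : D.Wall (D.sg c))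
    (hR : 1000 * (1 + D.L (D.top c)) ≤ D.r (D.top c)) :
    9 / 10 * D.r (D.top c) ≤ D.eta c c ∧ D.eta c c ≤ D.r (D.top c) ∧
      D.r (D.top c) / 4 + 12 * D.pre (D.sg c) ≤ D.lam c c - D.r c ∧
      D.lam c c + D.r c < D.r (D.top c) / 4 + 12 * D.pre (D.sg c) + 12 * D.S (D.sg c) ∧
      D.b c ≤ D.r c ∧ D.r c ≤ 4 * D.S (D.sg c) ∧
      (D.r (D.top c) + D.r c) ^ 2 ≤ D.lam c c ^ 2 + D.eta c c ^ 2 ∧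
      (G.Adj c (D.top c) ↔ D.lam c c ^ 2 + D.eta c c ^ 2 = (D.r (D.top c) + D.r c) ^ 2) := by
  rw [hD.wall_adj_iff hc hw]
  obtain ⟨hu, huf, hut, -, -⟩ := hD.sg_props hc
  have hunit := hD.dir_unit hg (D.sg c)
  have hS := hD.sum_le_S hu huf
  have hbS := hS.2.2.1 c hc rfl
  have hbc := hD.b_pos c
  have heta := hD.eta_sg hg hc
  rw [hut] at hS
  set u := D.sg c with hu_def
  set R := D.r (D.top c) with hRdef
  obtain ⟨hM0, hMS, -, hS0, hSL, hpre⟩ := hS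
  have hSR : 1000 * D.S u ≤ R := by linarith
  have hws : D.wallStart u = R / 4 + 12 * D.pre u + 4 * D.S u := by rw [wallStart, hut]
  have hwh := wall_height_bounds (R := R) (S := D.S u) (a := D.wallStart u) (H := D.wallHeight u)
    (by linarith) hSR (by linarith) (by linarith) (by rw [wallHeight, hut])
  have hcx := hg.wall_cx u hu huf hw
  have hcy := hg.wall_cy u hu huf hw
  have hr := hg.wall_r u hu huf hw
  have he : D.eta u u = D.wallHeight u := by
    rw [eta, hcx, hcy]; linear_combination D.wallHeight u * hunit
  have hl : D.lam u u = if D.Last u then D.wallStart u else D.wallStart u - D.r u := by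
    rw [lam, hcx, hcy]
    linear_combination (if D.Last u then D.wallStart u else D.wallStart u - D.r u) * hunit
  rw [heta, he]
  refine ⟨hwh.2.1, hwh.2.2, ?_⟩
  by_cases hf : D.First c
  · have hcu : c = u := hD.eq_sg_of_first hc hf
    rw [← hcu] at hr hl hws hwh hS0 hSR hMS hM0 hSL hpre hbS ⊢
    rw [← hRdef] at hr
    by_cases hlast : D.Last c
    · rw [if_pos hlast] at hr hl
      obtain ⟨h1, h2, h3⟩ := wall_single_bounds (R := R) (S := D.S c) (by linarith) hSR hr hwh.1
      rw [hl]
      exact ⟨by linarith, by linarith, by linarith, by linarith, h1.ge, by simp [hf, h1]⟩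
    · rw [if_neg hlast] at hr hl
      obtain ⟨h1, h2, h3⟩ := wall_first_bounds (R := R) (S := D.S c) (a := D.wallStart c)
        (H := D.wallHeight c) (by linarith) hSR (by linarith) (by linarith) hr
        (by rw [wallHeight])
      rw [hl]
      exact ⟨by linarith, by linarith, by linarith, by linarith, h1.ge, by simp [hf, h1]⟩
  · have hch := hD.lam_chain hg hc hf
    have hmid := hD.midSum_bounds hc
    rw [← hu_def] at hch hmid
    rw [if_neg (hD.not_last_sg hc hf)] at hl
    rw [hl] at hch
    by_cases hlast : D.Last c
    · have hr' := hg.last_wall_r c hc hf hlast hw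
      obtain ⟨k1, k2, k3, k4⟩ := hD.lam_next hg hc hf
      -- The far end of the predecessor is the near end of `c`; it serves as `a'` in
      -- `wall_last_bounds`.
      have h5 : D.lam c (D.par c) + D.r (D.par c) = D.lam c c - D.r c := by
        rw [k3, k1]; ring
      rw [h5, k4, ← k2, heta, he, ← hRdef, hch] at hr'
      obtain ⟨h1, h2, h3⟩ := wall_last_bounds (R := R) (S := D.S u) (a := D.wallStart u)
        (a' := D.wallStart u - D.r u + D.r u + D.midSum c) (H := D.wallHeight u) (by linarith) hSR
        (by linarith) (by linarith) hwh.1 (by linarith) (by linarith) hr'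
      rw [← hch, sub_add_cancel] at h1
      exact ⟨by linarith, by linarith, by linarith, by linarith, h1.ge, by simp [hlast, h1]⟩
    · have hr' := hg.mid_r c ⟨hc, hf, hlast⟩
      have h1 : D.wallStart u ≤ D.lam c c := by linarith
      have h0 : 0 < D.wallStart u := by linarith
      -- An inner circle has radius at most `S` and lies beyond `a`, and `R ^ 2 + 4 * S * R` exceeds
      -- `(R + S) ^ 2`.
      have h2 : (R + D.r c) ^ 2 < D.lam c c ^ 2 + D.wallHeight u ^ 2 := by
        have h3 : D.wallStart u ^ 2 ≤ D.lam c c ^ 2 := pow_le_pow_left₀ h0.le h1 2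
        have h4 : (R + D.r c) ^ 2 ≤ (R + D.S u) ^ 2 :=
          pow_le_pow_left₀ (by linarith) (by linarith) 2
        have h5 : D.S u * D.S u ≤ D.S u * R := mul_le_mul_of_nonneg_left (by linarith) (by linarith)
        have h6 : 0 < D.S u * R := mul_pos (by linarith) (by linarith)
        nlinarith
      exact ⟨by linarith, by linarith, by linarith, by linarith, h2.le, by simp [hf, hlast, h2.ne']⟩

/-- The description of a pocket run along its own direction, the same on both sides: the centers
advance by `pocketLength` from the first to the last circle, and both ends have radius `S`. -/
theorem pocket_run {c : V} (hc : D.Light c) (hw : ¬ D.Wall (D.sg c)) :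
    0 ≤ D.pocketLength (D.sg c) ∧ D.pocketLength (D.sg c) ≤ 3 * D.S (D.sg c) ∧
    (D.First c → D.lam c c = D.lam (D.sg c) (D.sg c)) ∧
    (¬ D.First c → D.lam (D.sg c) (D.sg c) < D.lam c c) ∧
    (D.Last c → D.lam c c = D.lam (D.sg c) (D.sg c) + D.pocketLength (D.sg c)) ∧
    (¬ D.Last c → D.lam c c < D.lam (D.sg c) (D.sg c) + D.pocketLength (D.sg c)) ∧
    (D.First c ∨ D.Last c → D.r c = D.S (D.sg c)) ∧ D.b c ≤ D.r c ∧ D.r c ≤ D.S (D.sg c) := by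
  obtain ⟨hu, huf, hut, -, -⟩ := hD.sg_props hc
  have hS := hD.sum_le_S hu huf
  have hbS := hS.2.2.1 c hc rfl
  have hbc := hD.b_pos c
  obtain ⟨hM0, hMS, -, hS0, hSL, hpre⟩ := hS
  have hr := hg.pocket_r _ hu huf hw
  rw [pocketLength]
  by_cases hf : D.First c
  · have hcu := hD.eq_sg_of_first hc hf
    rw [← hcu] at hr hbS hS0 hM0 hMS ⊢
    by_cases hl : D.Last c
    · simp only [hf, hl, if_true, hr, not_true, true_or]
      refine ⟨le_rfl, by linarith, by simp, by simp, by simp, by simp, by simp, by linarith, le_rfl⟩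
    · simp only [hf, hl, if_false, hr]
      refine ⟨by linarith, by linarith, by simp, by simp, by simp, fun _ => by linarith, by simp,
        by linarith, le_rfl⟩
  · have hnl := hD.not_last_sg hc hf
    have hch := hD.lam_chain hg hc hf
    have hmid := hD.midSum_bounds hc
    rw [if_neg hnl]
    by_cases hl : D.Last c
    · have hr' := hg.last_pocket_r c hc hf hl hw
      have := hmid.2.2 hl
      refine ⟨by linarith, by linarith, fun h => absurd h hf, fun _ => by linarith,
        fun _ => by linarith, fun h => absurd hl h, fun _ => hr', by linarith, hr'.le⟩
    · have hr' := hg.mid_r c ⟨hc, hf, hl⟩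
      refine ⟨by linarith, by linarith, fun h => absurd h hf, fun _ => by linarith,
        fun h => absurd h hl, fun _ => by linarith, ?_, by linarith, by linarith⟩
      rintro (h | h)
      exacts [absurd h hf, absurd h hl]

/-- The run is parallel to the axis. Its end near the top touches the top, its far end touches the
heavy child, and other circles are no larger and farther from the respective center. The sign `σ`
makes `σ * lam` the distance along the axis on either side, since the run after the heavy child is
traversed backwards. -/
theorem pocket_facts {c h : V} (hc : D.Light c) (hw : ¬ D.Wall (D.sg c))
    (hh : D.hv (D.top c) = some h) (hR : 1000 * (1 + D.L (D.top c)) ≤ D.r (D.top c)) {σ : ℝ}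
    (hσ : D.Before (D.sg c) ∧ σ = 1 ∨ D.After (D.sg c) ∧ σ = -1) :
    D.S (D.sg c) < D.eta c c ∧ D.eta c c ≤ 11 / 100 * D.r (D.top c) ∧
      D.r (D.top c) - 4 * D.S (D.sg c) ≤ σ * D.lam c c ∧
      σ * D.lam c c ≤ D.r (D.top c) + 5 * D.S (D.sg c) ∧ D.b c ≤ D.r c ∧ D.r c ≤ D.S (D.sg c) ∧
      (D.r (D.top c) + D.r c) ^ 2 ≤ (σ * D.lam c c) ^ 2 + D.eta c c ^ 2 ∧
      (G.Adj c (D.top c) ↔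
        (σ * D.lam c c) ^ 2 + D.eta c c ^ 2 = (D.r (D.top c) + D.r c) ^ 2) ∧
      (D.heavyRadius h + D.r c) ^ 2 ≤ (D.heavyDist h - σ * D.lam c c) ^ 2 + D.eta c c ^ 2 ∧
      (G.Adj c h ↔
        (D.heavyDist h - σ * D.lam c c) ^ 2 + D.eta c c ^ 2 = (D.heavyRadius h + D.r c) ^ 2) := by
  obtain ⟨hu, huf, hut, -, -⟩ := hD.sg_props hc
  have hunit := hD.dir_unit hg (D.sg c)
  obtain ⟨hM0, hMS, -, hS0, hSL, hpre⟩ := hD.sum_le_S hu huf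
  have heta := hD.eta_sg hg hc
  obtain ⟨hE0, hE3, hrf, hrf', hrl, hrl', hrS, hrb, hrS'⟩ := hD.pocket_run hg hc hw
  obtain ⟨hh1, hh2, hh3⟩ := hD.hv_some _ _ hh
  have hLh := (hD.one_le_W h).2.2.1
  have hbc := hD.b_pos c
  rw [hut] at hSL
  set u := D.sg c with hu_def
  set p := D.top c with hp_def
  have hR' : 1000 * D.S u ≤ D.heavyRadius h := by rw [heavyRadius, hh2]; linarith
  have hhd : D.heavyDist h = D.r p + D.heavyRadius h + D.gap h := by rw [heavyDist, hh2]
  have hg0 : 0 ≤ D.gap h := by rw [gap]; split_ifs <;> norm_num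
  have hg1 : D.gap h ≤ 1 := by rw [gap]; split_ifs <;> norm_num
  obtain ⟨e1, e2, e3, e4, e5, e6, e7⟩ := pocket_bounds (R := D.r p) (R' := D.heavyRadius h)
    (t := D.S u) (E := D.pocketLength u) (g := D.gap h) (E' := D.pocketBase u h)
    (y := D.pocketDepth u h) (X := D.pocketSide u h) (by linarith) (by linarith) hR' hE0 hE3 hg0 hg1
    (by rw [pocketBase, hhd]) (by rw [pocketDepth, hut]) (by rw [pocketSide, hut])
  rw [← hhd] at e2 e7
  have hle : D.lam u u ≤ D.lam c c := by
    by_cases h : D.First c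
    · exact (hrf h).ge
    · exact (hrf' h).le
  have hle' : D.lam c c ≤ D.lam u u + D.pocketLength u := by
    by_cases h : D.Last c
    · exact (hrl h).le
    · exact (hrl' h).le
  have hX0 : 0 < D.pocketSide u h := by linarith
  -- the two ends of the run
  have hmain : ∃ N F : Prop, (G.Adj c p ↔ N) ∧ (G.Adj c h ↔ F) ∧ D.eta c c = D.pocketSide u h ∧
      D.pocketDepth u h ≤ σ * D.lam c c ∧ σ * D.lam c c ≤ D.pocketDepth u h + D.pocketLength u ∧
      (N → D.r c = D.S u ∧ σ * D.lam c c = D.pocketDepth u h) ∧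
      (¬ N → D.pocketDepth u h < σ * D.lam c c) ∧
      (F → D.r c = D.S u ∧ σ * D.lam c c = D.pocketDepth u h + D.pocketLength u) ∧
      (¬ F → σ * D.lam c c < D.pocketDepth u h + D.pocketLength u) := by
    rcases hσ with ⟨hb, rfl⟩ | ⟨ha, rfl⟩
    · have hcx := hg.before_cx u h hu huf hb (by rw [hut, hh])
      have hcy := hg.before_cy u h hu huf hb (by rw [hut, hh])
      have he : D.eta u u = D.pocketSide u h := by
        rw [eta, hcx, hcy]; linear_combination D.pocketSide u h * hunit
      have hl : D.lam u u = D.pocketDepth u h := by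
        rw [lam, hcx, hcy]; linear_combination D.pocketDepth u h * hunit
      refine ⟨D.First c, D.Last c, hD.before_adj_iff hc hb, hD.adj_heavy_before hc hb hh,
        heta.trans he, by linarith, by linarith, fun h => ⟨hrS (Or.inl h), by linarith [hrf h]⟩,
        fun h => by linarith [hrf' h], fun h => ⟨hrS (Or.inr h), by linarith [hrl h]⟩,
        fun h => by linarith [hrl' h]⟩
    · have hcx := hg.after_cx u h hu huf ha (by rw [hut, hh])
      have hcy := hg.after_cy u h hu huf ha (by rw [hut, hh])
      have he : D.eta u u = D.pocketSide u h := by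
        rw [eta, hcx, hcy]; linear_combination D.pocketSide u h * hunit
      have hl : D.lam u u = -(D.pocketDepth u h + D.pocketLength u) := by
        rw [lam, hcx, hcy]
        linear_combination (-(D.pocketDepth u h + D.pocketLength u)) * hunit
      refine ⟨D.Last c, D.First c, hD.after_adj_iff hc ha, hD.adj_heavy_after hc ha hh,
        heta.trans he, by linarith, by linarith, fun h => ⟨hrS (Or.inr h), by linarith [hrl h]⟩,
        fun h => by linarith [hrl' h], fun h => ⟨hrS (Or.inl h), by linarith [hrf h]⟩,
        fun h => by linarith [hrf' h]⟩
  obtain ⟨N, F, hN, hF, m0, m1, m2, m3, m4, m5, m6⟩ := hmain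
  rw [hN, hF, m0]
  generalize σ * D.lam c c = α at *
  refine ⟨e5, e6, by linarith, by linarith, hrb, hrS', ?_, ?_, ?_, ?_⟩
  · have k1 : (D.r p + D.r c) ^ 2 ≤ (D.r p + D.S u) ^ 2 :=
      pow_le_pow_left₀ (by linarith) (by linarith) 2
    have k2 : D.pocketDepth u h ^ 2 ≤ α ^ 2 := pow_le_pow_left₀ (by linarith) m1 2
    linarith
  · constructor
    · intro h
      rw [(m3 h).1, (m3 h).2, ← e1]; ring
    · intro h
      by_contra hn
      have k1 : (D.r p + D.r c) ^ 2 ≤ (D.r p + D.S u) ^ 2 :=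
        pow_le_pow_left₀ (by linarith) (by linarith) 2
      have k2 : D.pocketDepth u _ ^ 2 < α ^ 2 :=
        pow_lt_pow_left₀ (m4 hn) (by linarith) two_ne_zero
      linarith
  · have k1 : (D.heavyRadius h + D.r c) ^ 2 ≤ (D.heavyRadius h + D.S u) ^ 2 :=
      pow_le_pow_left₀ (by linarith) (by linarith) 2
    have k2 : (D.heavyDist h - (D.pocketDepth u h + D.pocketLength u)) ^ 2 ≤
        (D.heavyDist h - α) ^ 2 := pow_le_pow_left₀ (by linarith) (by linarith) 2
    linarith
  · constructor
    · intro h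
      rw [(m5 h).1, (m5 h).2, ← e2]; ring
    · intro h
      by_contra hn
      have k1 : (D.heavyRadius _ + D.r c) ^ 2 ≤ (D.heavyRadius _ + D.S u) ^ 2 :=
        pow_le_pow_left₀ (by linarith) (by linarith) 2
      have k2 := pow_lt_pow_left₀ (n := 2) (sub_lt_sub_left (m6 hn) (D.heavyDist _)) (by linarith)
        two_ne_zero
      linarith

/-- Every circle is large compared with the light vertices next to it. -/
theorem radius_facts (v : V) :
    1000 * (1 + D.L v) ≤ D.r v ∧ (¬ D.Heavy v → D.b v ≤ D.r v) := by
  induction hn : D.idx v using Nat.strong_induction_on generalizing v with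
  | _ n ih =>
    have hL := (hD.one_le_W v).2
    have hbL : 1000 * (1 + D.L v) ≤ D.b v := by rw [b]; linarith
    by_cases hv : v = D.root
    · have : D.r v = D.b v := by rw [hv, hg.root_r]
      exact ⟨by linarith, fun _ => this.ge⟩
    · have ht := (ih _ (hn ▸ hD.idx_top hv) (D.top v) rfl).1
      rcases light_or_heavy hv with h | h
      · have : D.b v ≤ D.r v := by
          by_cases hw : D.Wall (D.sg v)
          · exact (hD.wall_facts hg h hw ht).2.2.2.2.1
          · exact (hD.pocket_run hg h hw).2.2.2.2.2.2.2.1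
        exact ⟨by linarith, fun _ => this⟩
      · have h1 := hg.heavy_r v h
        have h2 := (hD.one_le_W (D.top v)).2.2.1
        rw [heavyRadius] at h1
        exact ⟨by linarith, fun h' => absurd h h'⟩

end Combinatorial

end Layout


/-! ### Boxes and separation -/

namespace Layout

variable {V : Type*} (D : Layout V)

/-- Half the width of the box that contains everything below a heavy vertex. -/
def boxSize (c : V) : ℝ := 1000 * (2 * D.W c + D.L (D.top c))

/-- The circle of `w` lies in the box that is reserved for what is below `c`. -/
def InBox (c w : V) : Prop :=
  (D.Heavy c ∧ |D.across c w| + D.r w < 2 * D.boxSize c ∧ -(D.r c / 2) < D.along c w - D.r w ∧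
    D.along c w + D.r w < 3 * D.boxSize c - D.r c) ∨
  (¬ D.Heavy c ∧ |D.across c w| + D.r w < D.r c ∧ D.r w < D.along c w ∧
    D.along c w + D.r w < 3 * D.r c)

variable {D} [Fintype V] {G : SimpleGraph V}

namespace Combinatorial

variable (hD : D.Combinatorial G) (hg : D.Geometric)
include hD hg

theorem radius_pos (v : V) : 0 < D.r v := by
  have h1 := (hD.radius_facts hg v).1
  have h2 := (hD.one_le_W v).2.2.1
  linarith

theorem dsq_lam_eta (c v w : V) :
    D.dsq v w = (D.lam c v - D.lam c w) ^ 2 + (D.eta c v - D.eta c w) ^ 2 := by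
  have h := hD.dir_unit hg c
  rw [dsq, lam, lam, eta, eta]
  linear_combination (-(D.cx v - D.cx w) ^ 2 - (D.cy v - D.cy w) ^ 2) * h

theorem dsq_along_across (p v w : V) :
    D.dsq v w = (D.along p v - D.along p w) ^ 2 + (D.across p v - D.across p w) ^ 2 := by
  have h := hD.dir_unit hg p
  rw [dsq, along, along, across, across]
  linear_combination (-(D.cx v - D.cx w) ^ 2 - (D.cy v - D.cy w) ^ 2) * h

omit [Fintype V] hD hg in
theorem dsq_comm (v w : V) : D.dsq v w = D.dsq w v := by rw [dsq, dsq]; ring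

omit [Fintype V] hD hg in
theorem lam_top (c : V) : D.lam c (D.top c) = 0 ∧ D.eta c (D.top c) = 0 := by
  simp [lam, eta]

omit [Fintype V] hD hg in
theorem along_self (p : V) : D.along p p = 0 ∧ D.across p p = 0 := by
  simp [along, across]

/-- The run coordinates in terms of the coordinates of the parent. -/
theorem frame_wall {c : V} (hc : D.Light c) (hw : D.Wall (D.sg c)) (w : V) :
    (D.Heavy (D.top c) → D.lam c w = D.along (D.top c) w ∧ D.eta c w = D.across (D.top c) w) ∧
    (¬ D.Heavy (D.top c) → D.lam c w = -D.across (D.top c) w ∧ D.eta c w = D.along (D.top c) w) := by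
  obtain ⟨hu, huf, hut, -, -⟩ := hD.sg_props hc
  obtain ⟨h1, h2⟩ := hD.dir_sg hg hc
  rw [hg.wall_dx _ hu huf hw, fx, hut] at h1
  rw [hg.wall_dy _ hu huf hw, fy, hut] at h2
  constructor <;> intro h
  · rw [if_pos h] at h1 h2
    rw [lam, eta, along, across, h1, h2]; constructor <;> ring
  · rw [if_neg h] at h1 h2
    rw [lam, eta, along, across, h1, h2]; constructor <;> ring

/-- The two pockets have opposite normals, so their run coordinates are those of the top up to one
common sign. -/
theorem frame_pocket {c : V} (hc : D.Light c) {σ : ℝ}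
    (hσ : D.Before (D.sg c) ∧ σ = 1 ∨ D.After (D.sg c) ∧ σ = -1) (w : V) :
    D.lam c w = σ * D.along (D.top c) w ∧ D.eta c w = σ * D.across (D.top c) w := by
  obtain ⟨hu, huf, hut, -, -⟩ := hD.sg_props hc
  obtain ⟨h1, h2⟩ := hD.dir_sg hg hc
  rcases hσ with ⟨hw, rfl⟩ | ⟨hw, rfl⟩
  · rw [hg.before_dx _ hu huf hw, hut] at h1
    rw [hg.before_dy _ hu huf hw, hut] at h2
    rw [lam, eta, along, across, h1, h2]; constructor <;> ring
  · rw [hg.after_dx _ hu huf hw, hut] at h1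
    rw [hg.after_dy _ hu huf hw, hut] at h2
    rw [lam, eta, along, across, h1, h2]; constructor <;> ring

/-- The position of a light vertex and of everything in its box. -/
theorem light_region {c w : V} (hc : D.Light c) (hw : w = c ∨ D.InBox c w) :
    |D.lam c w - D.lam c c| + D.r w ≤ D.r c ∧ (w ≠ c → |D.lam c w - D.lam c c| + D.r w < D.r c) ∧
      D.eta c c - D.r c ≤ D.eta c w - D.r w ∧ D.eta c w + D.r w ≤ D.eta c c + 3 * D.r c ∧
      (w ≠ c → D.eta c c + D.r w < D.eta c w) := by
  have hr := hD.radius_pos hg c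
  rcases hw with rfl | hw
  · simp only [sub_self, abs_zero, zero_add, le_refl, ne_eq, not_true_eq_false, false_imp_iff,
      true_and, and_true]
    linarith
  · have hnh : ¬ D.Heavy c := fun h => hc.2 h.2
    obtain ⟨-, h1, h2, h3⟩ := hw.resolve_left fun h => hnh h.1
    have e1 : D.across c w = -(D.lam c w - D.lam c c) := by rw [across, lam, lam]; ring
    have e2 : D.along c w = D.eta c w - D.eta c c := by rw [along, eta, eta]; ring
    rw [e1, abs_neg] at h1
    rw [e2] at h2 h3
    exact ⟨h1.le, fun _ => h1, by linarith, by linarith, fun _ => by linarith⟩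

/-- The position of a heavy vertex and of everything in its box. -/
theorem heavy_region {h w : V} (hh : D.Heavy h) (hw : w = h ∨ D.InBox h w) :
    |D.across (D.top h) w| + D.r w ≤ 2 * D.boxSize h ∧
      D.along (D.top h) h = D.heavyDist h ∧ D.across (D.top h) h = 0 ∧
      D.r (D.top h) ≤ D.along (D.top h) w - D.r w ∧
      (w ≠ h → D.r (D.top h) + D.r h / 2 < D.along (D.top h) w - D.r w) ∧
      D.along (D.top h) w + D.r w < D.r (D.top h) + 1 + 3 * D.boxSize h := by
  have hu := hD.dir_unit hg (D.top h)
  have h1 := hg.heavy_cx h hh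
  have h2 := hg.heavy_cy h hh
  have h3 := hg.heavy_dx h hh
  have h4 := hg.heavy_dy h hh
  have h5 := hg.heavy_r h hh
  have hW := hD.one_le_W h
  have hWp := hD.one_le_W (D.top h)
  have hr := hD.radius_pos hg h
  have e1 : D.along (D.top h) h = D.heavyDist h := by
    rw [along, h1, h2]; linear_combination D.heavyDist h * hu
  have e2 : D.across (D.top h) h = 0 := by
    rw [across, h1, h2]; ring
  have hg0 : 0 ≤ D.gap h := by rw [gap]; split_ifs <;> norm_num
  have hg1 : D.gap h ≤ 1 := by rw [gap]; split_ifs <;> norm_num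
  have hb : D.r h ≤ D.boxSize h := by
    rw [h5, heavyRadius, boxSize]; linarith
  have hd : D.heavyDist h = D.r (D.top h) + D.r h + D.gap h := by rw [heavyDist, h5]
  rcases hw with rfl | hw
  · refine ⟨by rw [e2, abs_zero]; linarith, e1, e2, by rw [e1]; linarith,
      fun h => absurd rfl h, by rw [e1]; linarith⟩
  · obtain ⟨-, k1, k2, k3⟩ := hw.resolve_right fun h => h.1 hh
    have e3 : D.across h w = D.across (D.top h) w - D.across (D.top h) h := by
      rw [across, across, across, h3, h4]; ring
    have e4 : D.along h w = D.along (D.top h) w - D.along (D.top h) h := by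
      rw [along, along, along, h3, h4]; ring
    rw [e3, e2, sub_zero] at k1
    rw [e4, e1] at k2 k3
    exact ⟨k1.le, e1, e2, by linarith, fun _ => by linarith, by linarith⟩

/-- Disks with disjoint projections to a line are disjoint. The next two lemmas do the same for
other axes. -/
theorem sep_along {p v w : V} (h : D.along p v + D.r v < D.along p w - D.r w) :
    (D.r v + D.r w) ^ 2 < D.dsq v w := by
  rw [hD.dsq_along_across hg p]
  have h1 := hD.radius_pos hg v
  have h2 := hD.radius_pos hg w
  have : (D.r v + D.r w) ^ 2 < (D.along p w - D.along p v) ^ 2 :=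
    pow_lt_pow_left₀ (by linarith) (by linarith) two_ne_zero
  nlinarith [sq_nonneg (D.across p v - D.across p w)]

theorem sep_across {p v w : V} (h : D.across p v + D.r v < D.across p w - D.r w) :
    (D.r v + D.r w) ^ 2 < D.dsq v w := by
  rw [hD.dsq_along_across hg p]
  have h1 := hD.radius_pos hg v
  have h2 := hD.radius_pos hg w
  have : (D.r v + D.r w) ^ 2 < (D.across p w - D.across p v) ^ 2 :=
    pow_lt_pow_left₀ (by linarith) (by linarith) two_ne_zero
  nlinarith [sq_nonneg (D.along p v - D.along p w)]

theorem sep_lam {p v w : V} (h : D.lam p v + D.r v < D.lam p w - D.r w) :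
    (D.r v + D.r w) ^ 2 < D.dsq v w := by
  rw [hD.dsq_lam_eta hg p]
  have h1 := hD.radius_pos hg v
  have h2 := hD.radius_pos hg w
  have : (D.r v + D.r w) ^ 2 < (D.lam p w - D.lam p v) ^ 2 :=
    pow_lt_pow_left₀ (by linarith) (by linarith) two_ne_zero
  nlinarith [sq_nonneg (D.eta p v - D.eta p w)]

omit [Fintype V] hg hD in
theorem pocket_sign {u : V} (h : ¬ D.Wall u) :
    ∃ σ : ℝ, D.Before u ∧ σ = 1 ∨ D.After u ∧ σ = -1 := by
  rcases wall_or (D := D) u with h1 | h1 | h1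
  · exact absurd h1 h
  · exact ⟨1, Or.inl ⟨h1, rfl⟩⟩
  · exact ⟨-1, Or.inr ⟨h1, rfl⟩⟩

/-- Bounds in the coordinates of the parent for a wall vertex and its box. -/
theorem wall_region {c w : V} (hc : D.Light c) (hwl : D.Wall (D.sg c))
    (hw : w = c ∨ D.InBox c w) :
    D.r (D.top c) / 4 + 12 * D.pre (D.sg c) ≤ D.lam c w - D.r w ∧
      D.lam c w + D.r w < D.r (D.top c) / 4 + 12 * D.pre (D.sg c) + 12 * D.S (D.sg c) ∧
      D.lam c w + D.r w < 27 / 100 * D.r (D.top c) ∧ 0 < D.eta c w - D.r w ∧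
      D.eta c w + D.r w ≤ 11 / 10 * D.r (D.top c) := by
  have hR := (hD.radius_facts hg (D.top c)).1
  obtain ⟨hu, huf, hut, -, -⟩ := hD.sg_props hc
  obtain ⟨-, -, -, hS0, hSL, hpre⟩ := hD.sum_le_S hu huf
  rw [hut] at hSL
  obtain ⟨f1, f2, f3, f4, f5, f6, -, -⟩ := hD.wall_facts hg hc hwl hR
  obtain ⟨g1, g2, g3, g4, g5⟩ := hD.light_region hg hc hw
  have := abs_le.1 (show |D.lam c w - D.lam c c| ≤ D.r c - D.r w by linarith)
  exact ⟨by linarith, by linarith, by linarith, by linarith, by linarith⟩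

/-- Bounds in the coordinates of the parent for a pocket vertex and its box. -/
theorem pocket_region {c w : V} (hc : D.Light c) (hwl : ¬ D.Wall (D.sg c))
    (hw : w = c ∨ D.InBox c w) {σ : ℝ}
    (hσ : D.Before (D.sg c) ∧ σ = 1 ∨ D.After (D.sg c) ∧ σ = -1) :
    D.r (D.top c) - 5 * D.S (D.sg c) ≤ D.along (D.top c) w - D.r w ∧
      D.along (D.top c) w + D.r w ≤ D.r (D.top c) + 6 * D.S (D.sg c) ∧
      0 < σ * D.across (D.top c) w - D.r w ∧
      σ * D.across (D.top c) w + D.r w ≤ 12 / 100 * D.r (D.top c) ∧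
      1000 * D.S (D.sg c) ≤ D.r (D.top c) := by
  have hR := (hD.radius_facts hg (D.top c)).1
  obtain ⟨hu, huf, hut, -, -⟩ := hD.sg_props hc
  obtain ⟨-, -, -, hS0, hSL, hpre⟩ := hD.sum_le_S hu huf
  rw [hut] at hSL
  obtain ⟨h, hh⟩ := hD.exists_heavy hc.1
  obtain ⟨f1, f2, f3, f4, f5, f6, -, -⟩ := hD.pocket_facts hg hc hwl hh hR hσ
  obtain ⟨g1, g2, g3, g4, g5⟩ := hD.light_region hg hc hw
  have h1 := abs_le.1 (show |D.lam c w - D.lam c c| ≤ D.r c - D.r w by linarith)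
  obtain ⟨k1, k2⟩ := hD.frame_pocket hg hc hσ w
  have k3 := (hD.frame_pocket hg hc hσ c).1
  rw [k1, k3] at h1
  rw [k3] at f3 f4
  rw [← k2]
  rcases hσ with ⟨-, rfl⟩ | ⟨-, rfl⟩
  · exact ⟨by linarith, by linarith, by linarith, by linarith, by linarith⟩
  · exact ⟨by linarith, by linarith, by linarith, by linarith, by linarith⟩

/-- Boxes are nested. -/
theorem inBox_top {c w : V} (hc : c ≠ D.root) (hw : w = c ∨ D.InBox c w) : D.InBox (D.top c) w := by
  have hR := hD.radius_facts hg (D.top c)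
  have hW := hD.one_le_W (D.top c)
  have hrw := hD.radius_pos hg w
  have hB : D.Heavy (D.top c) → D.r (D.top c) ≤ D.boxSize (D.top c) := fun h => by
    have := (hD.one_le_W (D.top (D.top c))).2.2.1
    rw [hg.heavy_r _ h, heavyRadius, boxSize]; linarith
  rcases light_or_heavy hc with hl | hh
  · by_cases hwl : D.Wall (D.sg c)
    · obtain ⟨f1, f2, f3, f4, f5⟩ := hD.wall_region hg hl hwl hw
      have hpre := (hD.sum_le_S (hD.sg_props hl).1 (hD.sg_props hl).2.1).2.2.2.2.2
      obtain ⟨k1, k2⟩ := hD.frame_wall hg hl hwl w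
      by_cases hp : D.Heavy (D.top c)
      · left
        have hB := hB hp
        obtain ⟨k3, k4⟩ := k1 hp
        rw [k3] at f1 f2 f3
        rw [k4] at f4 f5
        refine ⟨hp, ?_, by linarith, by linarith⟩
        rw [abs_of_pos (by linarith)]; linarith
      · right
        obtain ⟨k3, k4⟩ := k2 hp
        rw [k3] at f1 f2 f3
        rw [k4] at f4 f5
        refine ⟨hp, ?_, by linarith, by linarith⟩
        rw [abs_of_neg (by linarith)]; linarith
    · obtain ⟨σ, hσ⟩ := pocket_sign hwl
      obtain ⟨f1, f2, f3, f4, f5⟩ := hD.pocket_region hg hl hwl hw hσ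
      have h1 : |D.across (D.top c) w| + D.r w ≤ 12 / 100 * D.r (D.top c) := by
        rcases hσ with ⟨-, rfl⟩ | ⟨-, rfl⟩
        · rw [abs_of_pos (by linarith)]; linarith
        · rw [abs_of_neg (by linarith)]; linarith
      by_cases hp : D.Heavy (D.top c)
      · have hB := hB hp
        exact Or.inl ⟨hp, by linarith, by linarith, by linarith⟩
      · exact Or.inr ⟨hp, by linarith, by linarith, by linarith⟩
  · obtain ⟨f1, -, -, f2, f3, f4⟩ := hD.heavy_region hg hh hw
    have hWc := hD.one_le_W c
    -- `W p = 1 + L p + W c` enters without a factor on `W c`: the box of the heavy child, enlarged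
    -- by what `L p` accounts for, still fits into the box of `p`.
    have hW2 := hW.2.2.2 c hh.2
    rw [boxSize] at f1 f4
    by_cases hp : D.Heavy (D.top c)
    · have hB := hB hp
      have hrp := hg.heavy_r _ hp
      have := (hD.one_le_W (D.top (D.top c))).2.2.1
      rw [heavyRadius] at hrp
      rw [boxSize] at hB
      refine Or.inl ⟨hp, ?_, by linarith, ?_⟩ <;> rw [boxSize] <;> linarith
    · have h1 := hR.2 hp
      rw [b] at h1
      exact Or.inr ⟨hp, by linarith, by linarith, by linarith⟩

/-- A vertex and what is in the box of one of its children. -/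
theorem sep_top {c w : V} (hc : c ≠ D.root) (hw : w = c ∨ D.InBox c w) :
    (D.r w + D.r (D.top c)) ^ 2 ≤ D.dsq w (D.top c) ∧
      (w ≠ c → (D.r w + D.r (D.top c)) ^ 2 < D.dsq w (D.top c)) ∧
      (w = c → (G.Adj w (D.top c) ↔ D.dsq w (D.top c) = (D.r w + D.r (D.top c)) ^ 2)) := by
  have hR := (hD.radius_facts hg (D.top c)).1
  have hr0 := hD.radius_pos hg (D.top c)
  have hrw := hD.radius_pos hg w
  have hcomm := add_comm (D.r w) (D.r (D.top c))
  rcases light_or_heavy hc with hl | hh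
  -- The circle of `c` itself avoids the top, and its center is not below that of the top. By
  -- `bullet` this protects everything in the shadow of `c`.
  · have key : (D.r (D.top c) + D.r c) ^ 2 ≤ D.lam c c ^ 2 + D.eta c c ^ 2 ∧ 0 ≤ D.eta c c ∧
        (G.Adj c (D.top c) ↔ D.lam c c ^ 2 + D.eta c c ^ 2 = (D.r (D.top c) + D.r c) ^ 2) := by
      by_cases hwl : D.Wall (D.sg c)
      · obtain ⟨f1, f2, f3, f4, f5, f6, f7, f8⟩ := hD.wall_facts hg hl hwl hR
        exact ⟨f7, by linarith, f8⟩
      · obtain ⟨σ, hσ⟩ := pocket_sign hwl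
        obtain ⟨h, hh⟩ := hD.exists_heavy hl.1
        obtain ⟨f1, f2, f3, f4, f5, f6, f7, f8, -⟩ := hD.pocket_facts hg hl hwl hh hR hσ
        have : (σ * D.lam c c) ^ 2 = D.lam c c ^ 2 := by
          rcases hσ with ⟨-, rfl⟩ | ⟨-, rfl⟩ <;> ring
        rw [this] at f7 f8
        have := hD.radius_pos hg c
        exact ⟨f7, by linarith, f8⟩
    have hd := hD.dsq_lam_eta hg c w (D.top c)
    rw [(lam_top c).1, (lam_top c).2, sub_zero, sub_zero] at hd
    rw [hd, hcomm]
    by_cases hwc : w = c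
    · subst hwc
      exact ⟨key.1, fun h => absurd rfl h, fun _ => key.2.2⟩
    · obtain ⟨g1, g2, g3, g4, g5⟩ := hD.light_region hg hl hw
      have := bullet (x' := D.lam c w) (y' := D.eta c w) hr0 key.1 key.2.1 (g2 hwc)
        (by linarith [g5 hwc]) hrw
      exact ⟨this.le, fun _ => this, fun h => absurd h hwc⟩
  · obtain ⟨f1, f2, f3, f4, f5, f6⟩ := hD.heavy_region hg hh hw
    have hrc := hD.radius_pos hg c
    by_cases hwc : w = c
    · subst hwc
      have hd := hD.dsq_along_across hg (D.top w) w (D.top w)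
      rw [(along_self _).1, (along_self _).2, f2, f3, heavyDist, ← hg.heavy_r w hh] at hd
      rw [hD.adj_top_iff hc, hd, hcomm, sub_zero, sub_zero, gap]
      split_ifs with hadj
      · simp [hadj]
      · have : (D.r (D.top w) + D.r w) ^ 2 < (D.r (D.top w) + D.r w + 1) ^ 2 :=
          pow_lt_pow_left₀ (by linarith) (by linarith) two_ne_zero
        simp only [hadj, false_iff, ne_eq, not_true_eq_false, false_imp_iff, true_and, forall_const]
        constructor <;> nlinarith
    · have h1 : (D.r (D.top c) + D.r w) ^ 2 < D.dsq (D.top c) w := by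
        apply hD.sep_along hg (p := D.top c)
        rw [(along_self _).1]
        linarith [f5 hwc]
      rw [hcomm, dsq_comm]
      exact ⟨h1.le, fun _ => h1, fun h => absurd h hwc⟩

/-- Two circles in the boxes of different children `c`, `c'` behave as they should. -/
def SepOK (D : Layout V) (G : SimpleGraph V) (c c' w w' : V) : Prop :=
  (D.r w + D.r w') ^ 2 ≤ D.dsq w w' ∧ (w ≠ c ∨ w' ≠ c' → (D.r w + D.r w') ^ 2 < D.dsq w w') ∧
    (w = c → w' = c' → (G.Adj w w' ↔ D.dsq w w' = (D.r w + D.r w') ^ 2))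

omit [Fintype V] hD hg in
theorem SepOK.of_lt {c c' w w' : V} (h : (D.r w + D.r w') ^ 2 < D.dsq w w') (ha : ¬ G.Adj c c') :
    SepOK D G c c' w w' :=
  ⟨h.le, fun _ => h, fun h1 h2 => by
    subst h1 h2
    exact ⟨fun h => absurd h ha, fun h' => absurd h'.symm h.ne⟩⟩

omit [Fintype V] hD hg in
theorem SepOK.symm {c c' w w' : V} (h : SepOK D G c c' w w') : SepOK D G c' c w' w := by
  rw [SepOK, dsq_comm, add_comm, G.adj_comm]
  exact ⟨h.1, fun h1 => h.2.1 h1.symm, fun h1 h2 => h.2.2 h2 h1⟩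

/-- The boxes stand on disjoint intervals of the chain. Equality needs both circles to belong to the
chain and to be consecutive; what lies below is strictly narrower. -/
theorem sep_same_run {c c' w w' : V} (hc : D.Light c) (hc' : D.Light c') (hs : D.sg c = D.sg c')
    (hlt : D.idx c < D.idx c') (hw : w = c ∨ D.InBox c w) (hw' : w' = c' ∨ D.InBox c' w') :
    SepOK D G c c' w w' := by
  have ht : D.top c = D.top c' := by
    rw [← (hD.sg_props hc).2.2.1, hs, (hD.sg_props hc').2.2.1]
  have hd1 : D.dx c = D.dx c' := by rw [(hD.dir_sg hg hc).1, hs, ← (hD.dir_sg hg hc').1]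
  have hd2 : D.dy c = D.dy c' := by rw [(hD.dir_sg hg hc).2, hs, ← (hD.dir_sg hg hc').2]
  have hlam : ∀ v, D.lam c' v = D.lam c v := fun v => by rw [lam, lam, hd1, hd2, ht]
  have heta : ∀ v, D.eta c' v = D.eta c v := fun v => by rw [eta, eta, hd1, hd2, ht]
  obtain ⟨g1, g2, g3, g4, g5⟩ := hD.light_region hg hc hw
  obtain ⟨g1', g2', g3', g4', g5'⟩ := hD.light_region hg hc' hw'
  obtain ⟨k1, k2⟩ := hD.chain_lt (u := D.sg c) (ξ := fun c => D.lam c c)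
    (fun x hx hxf _ => (hD.lam_next hg hx hxf).1) (fun x _ _ => hD.radius_pos hg x) hc hc' rfl
    hs.symm hlt
  simp only [hlam] at g1' g2' k1 k2
  have hr := hD.radius_pos hg w
  have hr' := hD.radius_pos hg w'
  by_cases hne : w ≠ c ∨ w' ≠ c'
  · have : D.lam c w + D.r w < D.lam c w' - D.r w' := by
      have a1 := le_abs_self (D.lam c w - D.lam c c)
      have a2 := neg_abs_le (D.lam c w' - D.lam c c')
      rcases hne with hne | hne
      · linarith [g2 hne]
      · linarith [g2' hne]
    have := hD.sep_lam hg this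
    refine ⟨this.le, fun _ => this, fun h1 h2 => ?_⟩
    rcases hne with hne | hne
    exacts [absurd h1 hne, absurd h2 hne]
  · push Not at hne
    obtain ⟨rfl, rfl⟩ := hne
    have hee : D.eta w w = D.eta w w' := by
      rw [← heta w', hD.eta_sg hg hc, hs, ← hD.eta_sg hg hc']
    have hd := hD.dsq_lam_eta hg w w w'
    rw [hee, sub_self] at hd
    rw [SepOK, hd, hD.adj_sibling_iff hc.1 hc'.1 ht]
    have hnot : D.par w ≠ w' := fun h => by
      have := hD.idx_par hc.1
      rw [h] at this
      omega
    have k3 : (D.r w + D.r w') ^ 2 ≤ (D.lam w w' - D.lam w w) ^ 2 :=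
      pow_le_pow_left₀ (by linarith) (by linarith) 2
    have e : (D.lam w w - D.lam w w') ^ 2 + 0 ^ 2 = (D.lam w w' - D.lam w w) ^ 2 := by ring
    rw [e]
    refine ⟨k3, by simp, fun _ _ => ?_⟩
    rw [or_iff_right hnot]
    constructor
    · intro h
      have hnf : ¬ D.First w' := by
        intro hf
        rcases hf with h1 | h1
        · rw [h, ← ht] at h1
          exact hD.top_ne_self hc.1 h1.symm
        · rw [h] at h1
          exact hc.2 h1.2
      have := (hD.lam_next hg hc' hnf).1
      rw [h, hlam] at this
      rw [this]; ring
    · intro h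
      by_contra hne
      have : (D.r w + D.r w') ^ 2 < (D.lam w w' - D.lam w w) ^ 2 :=
        pow_lt_pow_left₀ (by linarith [k2 hne]) (by linarith) two_ne_zero
      linarith

/-- A run occupies `12 * S` on the wall and starts after `12 * pre`, and `pre` counts the whole of
the earlier runs. -/
theorem sep_wall_wall {c c' w w' : V} (hc : D.Light c) (hc' : D.Light c')
    (ht : D.top c = D.top c') (hwl : D.Wall (D.sg c)) (hwl' : D.Wall (D.sg c'))
    (hlt : D.idx (D.sg c) < D.idx (D.sg c')) (hw : w = c ∨ D.InBox c w)
    (hw' : w' = c' ∨ D.InBox c' w') : (D.r w + D.r w') ^ 2 < D.dsq w w' := by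
  obtain ⟨f1, f2, -, -, -⟩ := hD.wall_region hg hc hwl hw
  obtain ⟨f1', f2', -, -, -⟩ := hD.wall_region hg hc' hwl' hw'
  obtain ⟨hu, huf, hut, -, -⟩ := hD.sg_props hc
  obtain ⟨hu', huf', hut', -, -⟩ := hD.sg_props hc'
  have hps := hD.pre_add_S_le hu huf hu' huf' (hut.trans (ht.trans hut'.symm)) hlt
  rw [← ht] at f1' f2'
  have : D.lam c' w' = D.lam c w' := by
    by_cases hp : D.Heavy (D.top c)
    · rw [((hD.frame_wall hg hc hwl w').1 hp).1,
        ((hD.frame_wall hg hc' hwl' w').1 (ht ▸ hp)).1, ht]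
    · rw [((hD.frame_wall hg hc hwl w').2 hp).1,
        ((hD.frame_wall hg hc' hwl' w').2 (ht ▸ hp)).1, ht]
  rw [this] at f1'
  exact hD.sep_lam hg (p := c) (by linarith)

/-- If the top is heavy, its wall faces sideways and ends at depth `27 / 100 * R`, well before the
pockets near depth `R`. Otherwise the wall lies at distance at least `R / 4` from the axis and the
pockets within `12 / 100 * R`. -/
theorem sep_wall_pocket {c c' w w' : V} (hc : D.Light c) (hc' : D.Light c')
    (ht : D.top c = D.top c') (hwl : D.Wall (D.sg c)) (hwl' : ¬ D.Wall (D.sg c'))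
    (hw : w = c ∨ D.InBox c w) (hw' : w' = c' ∨ D.InBox c' w') :
    (D.r w + D.r w') ^ 2 < D.dsq w w' := by
  obtain ⟨f1, -, f3, f4, f5⟩ := hD.wall_region hg hc hwl hw
  have hpre := (hD.sum_le_S (hD.sg_props hc).1 (hD.sg_props hc).2.1).2.2.2.2.2
  obtain ⟨σ, hσ⟩ := pocket_sign hwl'
  obtain ⟨g1, g2, g3, g4, g5⟩ := hD.pocket_region hg hc' hwl' hw' hσ
  rw [← ht] at g1 g2 g3 g4 g5
  have hr := hD.radius_pos hg w'
  have hR := hD.radius_pos hg (D.top c)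
  by_cases hp : D.Heavy (D.top c)
  · rw [((hD.frame_wall hg hc hwl w).1 hp).1] at f1 f3
    exact hD.sep_along hg (p := D.top c) (by linarith)
  · rw [((hD.frame_wall hg hc hwl w).2 hp).1] at f1 f3
    refine hD.sep_across hg (p := D.top c) ?_
    rcases hσ with ⟨-, rfl⟩ | ⟨-, rfl⟩ <;> linarith

/-- For a heavy top the depths differ. For another top the radius is at least `100000 * W`, so a
quarter of it exceeds half the width of the box of `h`. -/
theorem sep_wall_heavy {c h w w' : V} (hc : D.Light c) (hh : D.Heavy h)
    (ht : D.top c = D.top h) (hwl : D.Wall (D.sg c))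
    (hw : w = c ∨ D.InBox c w) (hw' : w' = h ∨ D.InBox h w') :
    (D.r w + D.r w') ^ 2 < D.dsq w w' := by
  obtain ⟨f1, -, f3, f4, f5⟩ := hD.wall_region hg hc hwl hw
  have hpre := (hD.sum_le_S (hD.sg_props hc).1 (hD.sg_props hc).2.1).2.2.2.2.2
  obtain ⟨g1, -, -, g2, g3, g4⟩ := hD.heavy_region hg hh hw'
  rw [← ht] at g1 g2 g3 g4
  have hR := hD.radius_pos hg (D.top c)
  by_cases hp : D.Heavy (D.top c)
  · rw [((hD.frame_wall hg hc hwl w).1 hp).1] at f1 f3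
    exact hD.sep_along hg (p := D.top c) (by linarith)
  · rw [((hD.frame_wall hg hc hwl w).2 hp).1] at f1 f3
    refine hD.sep_across hg (p := D.top c) ?_
    have h1 := (hD.radius_facts hg (D.top c)).2 hp
    have h2 := hD.one_le_W (D.top c)
    have h3 := h2.2.2.2 h (ht ▸ hh.2)
    have h4 := (hD.one_le_W h).1
    have h5 := neg_abs_le (D.across (D.top c) w')
    rw [boxSize, ← ht] at g1
    rw [b] at h1
    linarith

/-- Against the circle of `h` the shadow argument `bullet` applies, centered at `h`. What is below
`h` begins more than half a radius of `h` beyond the top, while the pocket reaches only `6 * S`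
beyond it. -/
theorem sep_pocket_heavy {c h w w' : V} (hc : D.Light c) (hh : D.Heavy h)
    (ht : D.top c = D.top h) (hwl : ¬ D.Wall (D.sg c))
    (hw : w = c ∨ D.InBox c w) (hw' : w' = h ∨ D.InBox h w') : SepOK D G c h w w' := by
  have hR := (hD.radius_facts hg (D.top c)).1
  obtain ⟨σ, hσ⟩ := pocket_sign hwl
  have hhv : D.hv (D.top c) = some h := ht ▸ hh.2
  obtain ⟨f1, f2, f3, f4, f5, f6, f7, f8, f9, f10⟩ := hD.pocket_facts hg hc hwl hhv hR hσ
  obtain ⟨g1, g2, g3, g4, g5⟩ := hD.pocket_region hg hc hwl hw hσ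
  obtain ⟨-, e1, e2, -, k1, -⟩ := hD.heavy_region hg hh hw'
  obtain ⟨hu, huf, hut, -, -⟩ := hD.sg_props hc
  obtain ⟨-, -, -, hS0, hSL, hpre⟩ := hD.sum_le_S hu huf
  have hrh := hg.heavy_r h hh
  have hr := hD.radius_pos hg h
  have hrw := hD.radius_pos hg w
  have hrc := hD.radius_pos hg c
  rw [← hrh] at f9 f10
  rw [← ht] at k1 e1 e2
  by_cases hwh : w' = h
  · subst hwh
    have l1 : D.lam c w' = σ * D.heavyDist w' := by rw [(hD.frame_pocket hg hc hσ w').1, e1]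
    have l2 : D.eta c w' = 0 := by rw [(hD.frame_pocket hg hc hσ w').2, e2, mul_zero]
    have hd := hD.dsq_lam_eta hg c w w'
    rw [l1, l2, sub_zero] at hd
    have e3 : (D.heavyDist w' - σ * D.lam c c) ^ 2 = (D.lam c c - σ * D.heavyDist w') ^ 2 := by
      rcases hσ with ⟨-, rfl⟩ | ⟨-, rfl⟩ <;> ring
    rw [e3] at f9 f10
    rw [SepOK, hd, add_comm (D.r w)]
    by_cases hwc : w = c
    · subst hwc
      exact ⟨f9, by simp, fun _ _ => f10⟩
    · obtain ⟨m1, m2, m3, m4, m5⟩ := hD.light_region hg hc hw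
      have := bullet (x' := D.lam c w - σ * D.heavyDist w') (y' := D.eta c w) hr f9 (by linarith)
        (by rw [sub_sub_sub_cancel_right]; exact m2 hwc) (by linarith [m5 hwc]) hrw
      exact ⟨this.le, fun _ => this, fun h => absurd h hwc⟩
  · have : (D.r w + D.r w') ^ 2 < D.dsq w w' := by
      refine hD.sep_along hg (p := D.top c) ?_
      have h0 := (hD.one_le_W h).2.2.1
      rw [heavyRadius, ← ht] at hrh
      rw [hut] at hSL
      linarith [k1 hwh]
    exact ⟨this.le, fun _ => this, fun _ h => absurd h hwh⟩

/-- The two pockets lie on opposite sides of the axis. -/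
theorem sep_pocket_pocket {c c' w w' : V} (hc : D.Light c) (hc' : D.Light c')
    (ht : D.top c = D.top c') (hb : D.Before (D.sg c)) (ha : D.After (D.sg c'))
    (hwl : ¬ D.Wall (D.sg c)) (hwl' : ¬ D.Wall (D.sg c'))
    (hw : w = c ∨ D.InBox c w) (hw' : w' = c' ∨ D.InBox c' w') :
    (D.r w + D.r w') ^ 2 < D.dsq w w' := by
  obtain ⟨-, -, g3, -, -⟩ := hD.pocket_region hg hc hwl hw (Or.inl ⟨hb, rfl⟩)
  obtain ⟨-, -, k3, -, -⟩ := hD.pocket_region hg hc' hwl' hw' (Or.inr ⟨ha, rfl⟩)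
  rw [← ht] at k3
  rw [dsq_comm, add_comm]
  exact hD.sep_across hg (p := D.top c) (by linarith)

/-- Circles in the boxes of siblings. -/
theorem sep_siblings {c c' w w' : V} (hc : c ≠ D.root) (hc' : c' ≠ D.root) (hne : c ≠ c')
    (ht : D.top c = D.top c') (hw : w = c ∨ D.InBox c w) (hw' : w' = c' ∨ D.InBox c' w') :
    SepOK D G c c' w w' := by
  have light_heavy : ∀ {c c' w w' : V}, D.Light c → D.Heavy c' → D.top c = D.top c' →
      (w = c ∨ D.InBox c w) → (w' = c' ∨ D.InBox c' w') → SepOK D G c c' w w' := by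
    intro c c' w w' hc hh ht hw hw'
    by_cases hwl : D.Wall (D.sg c)
    · exact SepOK.of_lt (hD.sep_wall_heavy hg hc hh ht hwl hw hw')
        (hD.adj_heavy_wall hc hwl (ht ▸ hh.2))
    · exact hD.sep_pocket_heavy hg hc hh ht hwl hw hw'
  rcases light_or_heavy hc with hl | hh <;> rcases light_or_heavy hc' with hl' | hh'
  · by_cases hs : D.sg c = D.sg c'
    · rcases lt_trichotomy (D.idx c) (D.idx c') with h | h | h
      · exact hD.sep_same_run hg hl hl' hs h hw hw'
      · exact absurd (hD.idx_injective h) hne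
      · exact (hD.sep_same_run hg hl' hl hs.symm h hw' hw).symm
    · have hna : ¬ G.Adj c c' := fun h => hs (hD.sg_eq_of_adj hl hl' ht h)
      refine SepOK.of_lt ?_ hna
      by_cases hwl : D.Wall (D.sg c) <;> by_cases hwl' : D.Wall (D.sg c')
      · rcases lt_trichotomy (D.idx (D.sg c)) (D.idx (D.sg c')) with h | h | h
        · exact hD.sep_wall_wall hg hl hl' ht hwl hwl' h hw hw'
        · exact absurd (hD.idx_injective h) hs
        · rw [dsq_comm, add_comm]
          exact hD.sep_wall_wall hg hl' hl ht.symm hwl' hwl h hw' hw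
      · exact hD.sep_wall_pocket hg hl hl' ht hwl hwl' hw hw'
      · rw [dsq_comm, add_comm]
        exact hD.sep_wall_pocket hg hl' hl ht.symm hwl' hwl hw' hw
      · rcases (wall_or (D := D) (D.sg c)).resolve_left hwl with h | h <;>
          rcases (wall_or (D := D) (D.sg c')).resolve_left hwl' with h' | h'
        · exact absurd (hD.before_unique hl hl' ht h h') hs
        · exact hD.sep_pocket_pocket hg hl hl' ht h h' hwl hwl' hw hw'
        · rw [dsq_comm, add_comm]
          exact hD.sep_pocket_pocket hg hl' hl ht.symm h' h hwl' hwl hw' hw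
        · exact absurd (hD.after_unique hl hl' ht h h') hs
  · exact light_heavy hl hh' ht hw hw'
  · exact (light_heavy hl' hh ht.symm hw' hw).symm
  · exact absurd (Option.some.inj (hh.2.symm.trans (ht ▸ hh'.2))) hne

end Combinatorial

end Layout


/-! ## The representation and its ratio -/

/-- With equality at `x = y`. Joining a smaller part to a larger one leaves room for the factor `2 ^
k - 1` on the smaller part, which pays for the enlargement of light children. -/
theorem pow_add_mul_pow_le {x y : ℝ} (hx : 0 ≤ x) (hxy : x ≤ y) (k : ℕ) :
    y ^ k + (2 ^ k - 1) * x ^ k ≤ (y + x) ^ k := by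
  induction k with
  | zero => simp
  | succ k ih =>
    have h2 : (1 : ℝ) ≤ 2 ^ k := one_le_pow₀ (by norm_num)
    have h3 : x ^ k ≤ y ^ k := pow_le_pow_left₀ hx hxy k
    have h4 : 0 ≤ x ^ k := pow_nonneg hx k
    calc y ^ (k + 1) + (2 ^ (k + 1) - 1) * x ^ (k + 1)
        = y * y ^ k + x * x ^ k + (2 ^ k - 1) * x ^ k * (x + x) := by ring
      _ ≤ y * y ^ k + x * y ^ k + (2 ^ k - 1) * x ^ k * (y + x) :=
        add_le_add (by nlinarith [mul_le_mul_of_nonneg_left h3 hx])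
          (mul_le_mul_of_nonneg_left (by linarith) (mul_nonneg (by linarith) h4))
      _ = (y ^ k + (2 ^ k - 1) * x ^ k) * (y + x) := by ring
      _ ≤ (y + x) ^ k * (y + x) := mul_le_mul_of_nonneg_right ih (by linarith)
      _ = (y + x) ^ (k + 1) := (pow_succ _ _).symm

theorem pow_add_sum_pow_le {ι : Type*} (s : Finset ι) {x : ι → ℝ} {y : ℝ} {A : ℝ} {k : ℕ}
    (hA : A ≤ 2 ^ k - 1) (hx : ∀ i ∈ s, 0 ≤ x i) (hxy : ∀ i ∈ s, x i ≤ y) :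
    y ^ k + ∑ i ∈ s, A * x i ^ k ≤ (y + ∑ i ∈ s, x i) ^ k := by
  classical
  induction s using Finset.induction_on with
  | empty => simp
  | insert a s ha ih =>
    rw [Finset.sum_insert ha, Finset.sum_insert ha]
    have h0 := hx a (Finset.mem_insert_self _ _)
    have h1 := hxy a (Finset.mem_insert_self _ _)
    have h2 : 0 ≤ ∑ i ∈ s, x i := Finset.sum_nonneg fun i hi => hx i (Finset.mem_insert_of_mem hi)
    have h3 := ih (fun i hi => hx i (Finset.mem_insert_of_mem hi))
      fun i hi => hxy i (Finset.mem_insert_of_mem hi)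
    have h4 := pow_add_mul_pow_le h0 (show x a ≤ y + ∑ i ∈ s, x i by linarith) k
    have h5 := mul_le_mul_of_nonneg_right hA (pow_nonneg h0 k)
    rw [show y + (x a + ∑ i ∈ s, x i) = y + ∑ i ∈ s, x i + x a by ring]
    linarith

/-! ### The weight of the root and the global assembly -/

namespace Layout

variable {V : Type*} {D : Layout V} [Fintype V] {G : SimpleGraph V}

namespace Combinatorial

variable (hD : D.Combinatorial G)
include hD

/-- The exponent is chosen such that `200000 ≤ 2 ^ 18 - 1`. Then the 18th root of the weight is at
most one plus the sum over the children, and summing over all vertices leaves the root with at most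
the number of vertices. -/
theorem W_root_le : D.W D.root ≤ (Fintype.card V : ℝ) ^ 18 := by
  classical
  set z : V → ℝ := fun v => D.W v ^ (1 / 18 : ℝ) with hz
  have hW0 : ∀ v, 0 ≤ D.W v := fun v => zero_le_one.trans (hD.one_le_W v).1
  have hz0 : ∀ v, 0 ≤ z v := fun v => Real.rpow_nonneg (hW0 v) _
  have hzp : ∀ v, z v ^ 18 = D.W v := fun v => by
    rw [hz, ← Real.rpow_natCast, ← Real.rpow_mul (hW0 v)]; norm_num
  have hstep : ∀ p, z p ≤ 1 + ∑ c with c ≠ D.root ∧ D.top c = p, z c := by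
    intro p
    have hs0 : 0 ≤ ∑ c with c ≠ D.root ∧ D.top c = p, z c := Finset.sum_nonneg fun i _ => hz0 i
    refine le_of_pow_le_pow_left₀ (n := 18) (by norm_num) (by linarith) ?_
    have h1 := pow_add_pow_le (show (0 : ℝ) ≤ 1 by norm_num) hs0 (show 18 ≠ 0 by norm_num)
    refine le_trans ?_ h1
    rw [hzp, one_pow, hD.W_eq, add_assoc]
    refine add_le_add le_rfl ?_
    cases hh : D.hv p with
    | none =>
      have : D.L p = 0 := by
        rw [hD.L_eq]
        refine Finset.sum_eq_zero fun c hc => ?_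
        rw [Finset.mem_filter] at hc
        exact absurd hc.2.2 (hD.hv_none p hh c hc.2.1.1)
      rw [this]
      simpa using pow_nonneg hs0 18
    | some h =>
      obtain ⟨k1, k2, k3⟩ := hD.hv_some p h hh
      have hset : (Finset.univ.filter fun c => c ≠ D.root ∧ D.top c = p) =
          insert h (Finset.univ.filter fun c => D.Light c ∧ D.top c = p) := by
        ext c
        simp only [Finset.mem_filter, Finset.mem_univ, true_and, Finset.mem_insert]
        constructor
        · rintro ⟨h1, h2⟩
          by_cases hc : c = h
          · exact Or.inl hc
          · refine Or.inr ⟨⟨h1, fun h3 => hc ?_⟩, h2⟩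
            rw [h2, hh] at h3
            exact (Option.some.inj h3).symm
        · rintro (rfl | h1)
          · exact ⟨k1, k2⟩
          · exact ⟨h1.1.1, h1.2⟩
      have hnot : h ∉ Finset.univ.filter fun c => D.Light c ∧ D.top c = p := by
        simp only [Finset.mem_filter, Finset.mem_univ, true_and]
        rintro ⟨h1, -⟩
        exact h1.2 (by rw [k2, hh])
      rw [hset, Finset.sum_insert hnot, hD.L_eq, Option.elim_some]
      -- The heavy child plays the role of `y`; it has maximal weight among the children.
      have := pow_add_sum_pow_le (Finset.univ.filter fun c => D.Light c ∧ D.top c = p) (x := z)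
        (y := z h) (A := 200000) (k := 18) (by norm_num) (fun i _ => hz0 i) (fun i hi => ?_)
      · rw [hzp] at this
        refine le_trans (le_of_eq ?_) this
        rw [add_comm]
        congr 1
        refine Finset.sum_congr rfl fun c _ => ?_
        rw [hzp, b]; ring
      · rw [Finset.mem_filter] at hi
        exact Real.rpow_le_rpow (hW0 i) (k3 i hi.2.1.1 hi.2.2) (by norm_num)
  -- Every vertex other than the root is a child of exactly one vertex, so the inner sums regroup.
  have hsum : ∑ p, z p ≤ Fintype.card V + ∑ c with c ≠ D.root, z c := by
    refine (Finset.sum_le_sum fun p _ => hstep p).trans (le_of_eq ?_)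
    rw [Finset.sum_add_distrib, Finset.sum_const, nsmul_eq_mul, mul_one, Finset.card_univ]
    congr 1
    rw [← Finset.sum_fiberwise (Finset.univ.filter fun c => c ≠ D.root) D.top z]
    simp only [Finset.filter_filter]
  have hroot : ∑ p, z p = z D.root + ∑ c with c ≠ D.root, z c := by
    rw [Finset.filter_ne', Finset.add_sum_erase _ _ (Finset.mem_univ _)]
  have : z D.root ≤ Fintype.card V := by linarith
  calc D.W D.root = z D.root ^ 18 := (hzp _).symm
    _ ≤ _ := pow_le_pow_left₀ (hz0 _) this 18

section Tree

theorem anc_idx_le {u v : V} (h : Anc D.root D.top u v) : D.idx u ≤ D.idx v := by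
  induction h with
  | refl => exact le_rfl
  | tail _ h ih => exact ih.trans (by have := hD.idx_top h.1; rw [h.2] at this; exact this.le)

theorem anc_root (v : V) : Anc D.root D.top D.root v := by
  induction hn : D.idx v using Nat.strong_induction_on generalizing v with
  | _ n ih =>
    by_cases hv : v = D.root
    · rw [hv]; exact Relation.ReflTransGen.refl
    · exact IsDFSTree.anc_par hv (ih _ (hn ▸ hD.idx_top hv) _ rfl)

theorem trichotomy (v w : V) : Anc D.root D.top v w ∨ Anc D.root D.top w v ∨
    ∃ c c', c ≠ D.root ∧ c' ≠ D.root ∧ c ≠ c' ∧ D.top c = D.top c' ∧ Anc D.root D.top c v ∧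
      Anc D.root D.top c' w := by
  have child : ∀ {u v : V}, Anc D.root D.top u v → u = v ∨
      ∃ c, c ≠ D.root ∧ D.top c = u ∧ Anc D.root D.top c v := by
    intro u v h
    rcases Relation.ReflTransGen.cases_head h with h | ⟨c, ⟨h1, h2⟩, h3⟩
    · exact Or.inl h
    · exact Or.inr ⟨c, h1, h2, h3⟩
  induction hn : D.idx w using Nat.strong_induction_on generalizing w with
  | _ n ih =>
    by_cases hw : w = D.root
    · exact Or.inr (Or.inl (hw ▸ hD.anc_root v))
    · rcases ih _ (hn ▸ hD.idx_top hw) (D.top w) rfl with h | h | ⟨c, c', h1, h2, h3, h4, h5, h6⟩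
      · exact Or.inl (IsDFSTree.anc_par hw h)
      · rcases child h with h | ⟨c, h1, h2, h3⟩
        · exact Or.inl (IsDFSTree.anc_par hw (h ▸ Relation.ReflTransGen.refl))
        · by_cases hc : c = w
          · exact Or.inr (Or.inl (hc ▸ h3))
          · exact Or.inr (Or.inr ⟨c, w, h1, hw, hc, h2, h3, Relation.ReflTransGen.refl⟩)
      · exact Or.inr (Or.inr ⟨c, c', h1, h2, h3, h4, h5, IsDFSTree.anc_par hw h6⟩)

theorem anc_siblings {c c' v : V} (hc : c ≠ D.root) (hc' : c' ≠ D.root) (ht : D.top c = D.top c')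
    (h : Anc D.root D.top c v) (h' : Anc D.root D.top c' v) : c = c' := by
  have key : ∀ {c c' : V}, c' ≠ D.root → D.top c = D.top c' → c ≠ D.root →
      Anc D.root D.top c c' → c = c' := by
    intro c c' _ ht hc h
    rcases IsDFSTree.anc_cases h with h | ⟨_, h1⟩
    · exact h
    · have h2 := hD.anc_idx_le h1
      rw [← ht] at h2
      exact absurd (hD.idx_top hc) (not_lt.2 h2)
  rcases IsDFSTree.anc_total h h' with h | h
  · exact key hc' ht hc h
  · exact (key hc ht.symm hc' h).symm

/-- In the tree of tops, edges of the graph join parent and child or two siblings. This is why the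
geometric analysis of a single vertex with its children suffices. -/
theorem adj_related {u v : V} (h : G.Adj u v) (hlt : D.idx v < D.idx u) : u ≠ D.root ∧
    (D.top u = v ∨ (v ≠ D.root ∧ D.top u = D.top v)) := by
  obtain ⟨h1, h2 | h2⟩ := hD.blockTree.adj_cases u v h hlt
  · refine ⟨h1, ?_⟩
    rw [h2]
    exact hD.blockTree.top_cases u h1
  · exact ⟨h1, Or.inl h2.1.symm⟩

theorem adj_below {c w : V} (hc : c ≠ D.root) (hw : Anc D.root D.top c w) (hwc : w ≠ c) :
    ¬ G.Adj w (D.top c) := by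
  intro h
  have h1 := hD.anc_idx_le hw
  have h2 := hD.idx_top hc
  obtain ⟨-, h3⟩ := (IsDFSTree.anc_cases hw).resolve_left (Ne.symm hwc)
  have h4 := hD.anc_idx_le h3
  obtain ⟨-, h5 | ⟨h5, h6⟩⟩ := hD.adj_related h (h2.trans_le h1)
  · rw [h5] at h4; omega
  · have := hD.idx_top h5
    rw [h6] at h4; omega

theorem adj_apart {c c' w w' : V} (hc : c ≠ D.root) (hc' : c' ≠ D.root) (hne : c ≠ c')
    (ht : D.top c = D.top c') (hw : Anc D.root D.top c w) (hw' : Anc D.root D.top c' w')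
    (h : G.Adj w w') : w = c ∧ w' = c' := by
  have key : ∀ {c c' w w' : V}, c ≠ D.root → c' ≠ D.root → c ≠ c' → D.top c = D.top c' →
      Anc D.root D.top c w → Anc D.root D.top c' w' → G.Adj w w' → D.idx w' < D.idx w →
      w = c ∧ w' = c' := by
    intro c c' w w' hc hc' hne ht hw hw' h hlt
    obtain ⟨h1, h2 | ⟨h2, h3⟩⟩ := hD.adj_related h hlt
    · rcases IsDFSTree.anc_cases hw with h4 | ⟨-, h4⟩
      · have h5 := hD.anc_idx_le hw'
        rw [← h2, ← h4, ht] at h5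
        exact absurd (hD.idx_top hc') (not_lt.2 h5)
      · rw [h2] at h4
        exact absurd (hD.anc_siblings hc hc' ht h4 hw') hne
    · rcases IsDFSTree.anc_cases hw with h4 | ⟨-, h4⟩
      · rcases IsDFSTree.anc_cases hw' with h5 | ⟨-, h5⟩
        · exact ⟨h4.symm, h5.symm⟩
        · have h6 := hD.anc_idx_le h5
          rw [← h3, ← h4, ht] at h6
          exact absurd (hD.idx_top hc') (not_lt.2 h6)
      · rw [h3] at h4
        exact absurd (hD.anc_siblings hc hc' ht (IsDFSTree.anc_par h2 h4) hw') hne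
  rcases lt_trichotomy (D.idx w) (D.idx w') with hlt | heq | hlt
  · exact (key hc' hc hne.symm ht.symm hw' hw h.symm hlt).symm
  · exact absurd (hD.idx_injective heq) h.ne
  · exact key hc hc' hne ht hw hw' h hlt

end Tree

variable (hg : D.Geometric)
include hg

theorem inBox_of_anc {c w : V} (h : Anc D.root D.top c w) : w = c ∨ D.InBox c w := by
  induction h using Relation.ReflTransGen.head_induction_on with
  | refl => exact Or.inl rfl
  | head h _ ih =>
    rw [← h.2]
    exact Or.inr (hD.inBox_top hg h.1 ih)

/-- Two vertices are comparable in the tree of tops or lie below two different siblings. The boxes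
decide both cases, and strict inequality holds exactly where `adj_below` and `adj_apart` exclude an
edge. -/
theorem separated {v w : V} (hne : v ≠ w) : (D.r v + D.r w) ^ 2 ≤ D.dsq v w ∧
    (G.Adj v w ↔ D.dsq v w = (D.r v + D.r w) ^ 2) := by
  have key : ∀ {v w : V}, v ≠ w → Anc D.root D.top w v → (D.r v + D.r w) ^ 2 ≤ D.dsq v w ∧
      (G.Adj v w ↔ D.dsq v w = (D.r v + D.r w) ^ 2) := by
    intro v w hne h
    rcases Relation.ReflTransGen.cases_head h with h | ⟨c, ⟨h1, rfl⟩, h3⟩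
    · exact absurd h.symm hne
    · obtain ⟨k1, k2, k3⟩ := hD.sep_top hg h1 (hD.inBox_of_anc hg h3)
      refine ⟨k1, ?_⟩
      by_cases hvc : v = c
      · exact k3 hvc
      · exact ⟨fun h => absurd h (hD.adj_below h1 h3 hvc), fun h => absurd h (k2 hvc).ne'⟩
  rcases hD.trichotomy v w with h | h | ⟨c, c', h1, h2, h3, h4, h5, h6⟩
  · rw [dsq_comm, add_comm, G.adj_comm]
    exact key hne.symm h
  · exact key hne h
  · obtain ⟨k1, k2, k3⟩ := hD.sep_siblings hg h1 h2 h3 h4 (hD.inBox_of_anc hg h5)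
      (hD.inBox_of_anc hg h6)
    refine ⟨k1, ?_⟩
    by_cases hn : v ≠ c ∨ w ≠ c'
    · refine ⟨fun h => ?_, fun h => absurd h (k2 hn).ne'⟩
      obtain ⟨h7, h8⟩ := hD.adj_apart h1 h2 h3 h4 h5 h6 h
      rcases hn with hn | hn
      exacts [absurd h7 hn, absurd h8 hn]
    · push Not at hn
      exact k3 hn.1 hn.2

theorem isCircleContactRep :
    IsCircleContactRep G (fun v => (!₂[D.cx v, D.cy v] : EuclideanSpace ℝ (Fin 2))) D.r := by
  have hdist : ∀ v w, dist (!₂[D.cx v, D.cy v] : EuclideanSpace ℝ (Fin 2)) !₂[D.cx w, D.cy w] =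
      √(D.dsq v w) := fun v w => by
    rw [EuclideanSpace.dist_eq]
    simp [Fin.sum_univ_two, Real.dist_eq, dsq]
  have hr := hD.radius_pos hg
  refine ⟨hr, fun v w hne => ?_, fun v w hne => ?_⟩
  · apply Metric.ball_disjoint_ball
    rw [hdist]
    exact Real.le_sqrt_of_sq_le (hD.separated hg hne).1
  · rw [hdist, (hD.separated hg hne).2, Real.sqrt_eq_iff_eq_sq (by rw [dsq]; positivity)
      (add_pos (hr v) (hr w)).le]

/-- Every circle lies in the box of the root, so its radius is at most `100000 * W root`; every
radius is at least one. -/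
theorem diameterRatioLE : DiameterRatioLE D.r ((100000 : ℕ) * (Fintype.card V : ℝ) ^ 18) := by
  intro u v
  have h1 : D.r u ≤ D.b D.root := by
    rw [← hg.root_r]
    rcases hD.inBox_of_anc hg (hD.anc_root u) with h | h
    · rw [h]
    · rcases h with h | h
      · exact absurd rfl h.1.1
      · have := abs_nonneg (D.across D.root u)
        linarith [h.2.1]
  have h2 : 1 ≤ D.r v := by
    have := (hD.radius_facts hg v).1
    have := (hD.one_le_W v).2.2.1
    linarith
  have h3 := hD.W_root_le
  have h4 : 0 ≤ (Fintype.card V : ℝ) ^ 18 := by positivity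
  rw [b] at h1
  push_cast
  nlinarith [mul_le_mul_of_nonneg_left h2 h4]

end Combinatorial

end Layout


/-! ## A program logic for the real RAM -/

namespace RealRAM

/-- The number of rounds of a counting loop is bounded by the right side of its test. -/
def Test.limit : Test → WExpr
  | wordLT _ f => f
  | _ => .lit 0

namespace Program

/-- An upper bound for the running time in terms of the input `s`. -/
def time (s : State) : Program → ℕ
  | skip => 1
  | setWord _ _ _ => 1
  | setReal _ _ _ => 1
  | seq p q => p.time s + q.time s
  | ite _ p q => p.time s + q.time s + 1
  | loop b p => b.limit.eval s * (p.time s + 1) + 1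

/-- The word arrays that are written. -/
def wordWrites : Program → List ℕ
  | skip => []
  | setWord a _ _ => [a]
  | setReal _ _ _ => []
  | seq p q => p.wordWrites ++ q.wordWrites
  | ite _ p q => p.wordWrites ++ q.wordWrites
  | loop _ p => p.wordWrites

/-- The real arrays that are written. -/
def realWrites : Program → List ℕ
  | skip => []
  | setWord _ _ _ => []
  | setReal a _ _ => [a]
  | seq p q => p.realWrites ++ q.realWrites
  | ite _ p q => p.realWrites ++ q.realWrites
  | loop _ p => p.realWrites

/-- A loop with counter `c`. -/
def forTo (c : ℕ) (lim : WExpr) (p : Program) : Program :=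
  .seq (.setWord c (.lit 0) (.lit 0)) (.loop (.wordLT (.get c (.lit 0)) lim)
    (.seq p (.setWord c (.lit 0) (.add (.get c (.lit 0)) (.lit 1)))))

end Program

/-- Only the arrays in the lists differ. -/
structure Frame (A R : List ℕ) (s s' : State) : Prop where
  word : ∀ a, a ∉ A → s'.word a = s.word a
  real : ∀ a, a ∉ R → s'.real a = s.real a

theorem Frame.refl (A R : List ℕ) (s : State) : Frame A R s s := ⟨fun _ _ => rfl, fun _ _ => rfl⟩

theorem Frame.trans {A R : List ℕ} {s s' s'' : State} (h : Frame A R s s') (h' : Frame A R s' s'') :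
    Frame A R s s'' :=
  ⟨fun a ha => (h'.word a ha).trans (h.word a ha), fun a ha => (h'.real a ha).trans (h.real a ha)⟩

theorem Frame.mono {A R A' R' : List ℕ} {s s' : State} (h : Frame A R s s') (hA : A ⊆ A')
    (hR : R ⊆ R') : Frame A' R' s s' :=
  ⟨fun a ha => h.word a fun h' => ha (hA h'), fun a ha => h.real a fun h' => ha (hR h')⟩

theorem Frame.putWord (s : State) {a i x : ℕ} {A R : List ℕ} (ha : a ∈ A) :
    Frame A R s (s.putWord a i x) :=
  ⟨fun b hb => by
    have : b ≠ a := fun h => hb (h ▸ ha)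
    simp [State.putWord, this], fun _ _ => rfl⟩

theorem Frame.putReal (s : State) {a i : ℕ} {x : ℝ} {A R : List ℕ} (ha : a ∈ R) :
    Frame A R s (s.putReal a i x) :=
  ⟨fun _ _ => rfl, fun b hb => by
    have : b ≠ a := fun h => hb (h ▸ ha)
    simp [State.putReal, this]⟩

theorem Exec.frame {B : ℕ} {p : Program} {s s' : State} {t : ℕ} (h : Exec B p s t s') :
    Frame p.wordWrites p.realWrites s s' := by
  induction h with
  | skip s => exact Frame.refl _ _ _
  | setWord a i e s h => exact Frame.putWord s (by simp [Program.wordWrites])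
  | setReal a i e s => exact Frame.putReal s (by simp [Program.realWrites])
  | seq _ _ h1 h2 =>
    exact (h1.mono (List.subset_append_left _ _) (List.subset_append_left _ _)).trans
      (h2.mono (List.subset_append_right _ _) (List.subset_append_right _ _))
  | ite_true _ _ h => exact h.mono (List.subset_append_left _ _) (List.subset_append_left _ _)
  | ite_false _ _ h => exact h.mono (List.subset_append_right _ _) (List.subset_append_right _ _)
  | loop_done _ => exact Frame.refl _ _ _
  | loop_step _ _ _ h1 h2 => exact Frame.trans h1 h2

/-- Started in `s`, the program halts within its time bound for the input `s₀` in a state that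
satisfies `Q`. -/
def Tri (B : ℕ) (s₀ : State) (p : Program) (s : State) (Q : State → Prop) : Prop :=
  ∃ t s', Exec B p s t s' ∧ t ≤ p.time s₀ ∧ Q s'

section Rules

variable {B : ℕ} {s₀ s : State} {p q : Program} {Q Q' : State → Prop}

theorem Tri.mono (h : Tri B s₀ p s Q) (hQ : ∀ s', Frame p.wordWrites p.realWrites s s' → Q s' → Q' s') :
    Tri B s₀ p s Q' := by
  obtain ⟨t, s', h1, h2, h3⟩ := h
  exact ⟨t, s', h1, h2, hQ s' h1.frame h3⟩

theorem Tri.skip (h : Q s) : Tri B s₀ .skip s Q := ⟨1, s, .skip s, le_rfl, h⟩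

theorem Tri.setWord {a : ℕ} {i e : WExpr} (he : e.eval s ≤ B)
    (h : Q (s.putWord a (i.eval s) (e.eval s))) : Tri B s₀ (.setWord a i e) s Q :=
  ⟨1, _, .setWord a i e s he, le_rfl, h⟩

theorem Tri.setReal {a : ℕ} {i : WExpr} {e : RExpr}
    (h : Q (s.putReal a (i.eval s) (e.eval s))) : Tri B s₀ (.setReal a i e) s Q :=
  ⟨1, _, .setReal a i e s, le_rfl, h⟩

theorem Tri.seq (h : Tri B s₀ p s fun s' => Tri B s₀ q s' Q) : Tri B s₀ (.seq p q) s Q := by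
  obtain ⟨t, s', h1, h2, t', s'', h3, h4, h5⟩ := h
  exact ⟨t + t', s'', .seq h1 h3, add_le_add h2 h4, h5⟩

theorem Tri.ite {b : Test} (hp : b.holds s → Tri B s₀ p s Q) (hq : ¬ b.holds s → Tri B s₀ q s Q) :
    Tri B s₀ (.ite b p q) s Q := by
  by_cases hb : b.holds s
  · obtain ⟨t, s', h1, h2, h3⟩ := hp hb
    exact ⟨t + 1, s', .ite_true hb h1, by rw [Program.time]; omega, h3⟩
  · obtain ⟨t, s', h1, h2, h3⟩ := hq hb
    exact ⟨t + 1, s', .ite_false hb h1, by rw [Program.time]; omega, h3⟩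

/-- As the body never writes the word array `0`, the limit has the same value in every round and in
the input `s₀`. This is what makes `Program.time s₀` a valid bound. The invariant is required after
the increment of the counter. -/
theorem Tri.forTo {c N : ℕ} {lim : WExpr} (I : ℕ → State → Prop) (hs : s.word 0 = s₀.word 0)
    (hlim : ∀ s', s'.word 0 = s₀.word 0 → lim.eval s' = N) (hN : N ≤ B) (hc : c ≠ 0)
    (hw0 : 0 ∉ p.wordWrites) (hwc : c ∉ p.wordWrites) (h0 : I 0 (s.putWord c 0 0))
    (hstep : ∀ k < N, ∀ s', s'.word 0 = s₀.word 0 →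
      Frame (c :: p.wordWrites) p.realWrites s s' → s'.word c 0 = k → I k s' →
      Tri B s₀ p s' fun s'' => I (k + 1) (s''.putWord c 0 (k + 1)))
    (hQ : ∀ s', s'.word 0 = s₀.word 0 → Frame (c :: p.wordWrites) p.realWrites s s' → I N s' → Q s') :
    Tri B s₀ (.forTo c lim p) s Q := by
  set body := Program.seq p (.setWord c (.lit 0) (.add (.get c (.lit 0)) (.lit 1))) with hbody
  set test := Test.wordLT (.get c (.lit 0)) lim with htest
  have hput : ∀ (s : State) x, (s.putWord c 0 x).word 0 = s.word 0 := fun s x => by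
    simp [State.putWord, hc.symm]
  have hputc : ∀ (s : State) x, (s.putWord c 0 x).word c 0 = x := fun s x => by
    simp [State.putWord]
  -- Induction on the number `j` of remaining rounds.
  have main : ∀ j k, k + j = N → ∀ s', s'.word 0 = s₀.word 0 →
      Frame (c :: p.wordWrites) p.realWrites s s' → s'.word c 0 = k → I k s' →
      ∃ t s'', Exec B (.loop test body) s' t s'' ∧ t ≤ j * (body.time s₀ + 1) + 1 ∧ Q s'' := by
    intro j
    induction j with
    | zero =>
      intro k hk s' h1 h2 h3 h4
      refine ⟨1, s', .loop_done ?_, by omega, hQ s' h1 h2 (by rwa [← hk, add_zero])⟩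
      change ¬ s'.word c 0 < lim.eval s'
      rw [hlim s' h1, h3]; omega
    | succ j ih =>
      intro k hk s' h1 h2 h3 h4
      obtain ⟨t, s1, e1, e2, e3⟩ := hstep k (by omega) s' h1 h2 h3 h4
      have hf := e1.frame
      have hc1 : s1.word c 0 = k := by rw [hf.word c hwc, h3]
      obtain ⟨t', s2, k1, k2, k3⟩ := ih (k + 1) (by omega) (s1.putWord c 0 (k + 1))
        (by rw [hput, hf.word 0 hw0, h1])
        (h2.trans ((hf.mono (List.subset_cons_self _ _) (List.Subset.refl _)).trans
          (Frame.putWord s1 List.mem_cons_self))) (hputc _ _) e3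
      have hb : Exec B body s' (t + 1) (s1.putWord c 0 (k + 1)) := by
        have := Exec.setWord (B := B) c (.lit 0) (.add (.get c (.lit 0)) (.lit 1)) s1
          (by simp only [WExpr.eval]; rw [hc1]; omega)
        simp only [WExpr.eval, hc1] at this
        exact .seq e1 this
      refine ⟨t + 1 + t' + 1, s2, .loop_step ?_ hb k1, ?_, k3⟩
      · change s'.word c 0 < lim.eval s'
        rw [hlim s' h1, h3]; omega
      · have : body.time s₀ = p.time s₀ + 1 := rfl
        rw [add_mul, one_mul]
        omega
  obtain ⟨t, s', k1, k2, k3⟩ := main N 0 (zero_add N) (s.putWord c 0 0) (by rw [hput, hs])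
    (Frame.putWord s List.mem_cons_self) (hputc _ _) h0
  refine ⟨1 + t, s', .seq (.setWord c (.lit 0) (.lit 0) s (Nat.zero_le _)) k1, ?_, k3⟩
  have : (Program.forTo c lim p).time s₀ = 1 + (lim.eval s₀ * (body.time s₀ + 1) + 1) := rfl
  rw [this, hlim s₀ rfl]
  omega

/-- Search: the scalar `x` is set to `e` for the numbers that pass the test. -/
def Program.scan (c x : ℕ) (T : Test) (e : WExpr) : Program :=
  .seq (.setWord x (.lit 0) (.lit 0))
    (.forTo c (.get 0 (.lit 0)) (.ite T (.setWord x (.lit 0) e) .skip))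

/-- Accumulation in the real scalar `x`. -/
def Program.scanReal (c x : ℕ) (T : Test) (e : RExpr) : Program :=
  .seq (.setReal x (.lit 0) (.ofWord (.lit 0)))
    (.forTo c (.get 0 (.lit 0)) (.ite T (.setReal x (.lit 0) e) .skip))

theorem Tri.scan {c x N : ℕ} {T : Test} {e : WExpr} (J : ℕ → ℕ → Prop)
    (hs : s.word 0 = s₀.word 0) (hN : s₀.word 0 0 = N) (hNB : N ≤ B) (hc : c ≠ 0) (hx : x ≠ 0)
    (hcx : c ≠ x) (h0 : J 0 0)
    (h : ∀ j < N, ∀ s', Frame [c, x] [] s s' → s'.word c 0 = j → J j (s'.word x 0) →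
      (T.holds s' → e.eval s' ≤ B ∧ J (j + 1) (e.eval s')) ∧
      (¬ T.holds s' → J (j + 1) (s'.word x 0)))
    (hQ : ∀ s', s'.word 0 = s₀.word 0 → Frame [c, x] [] s s' → J N (s'.word x 0) → Q s') :
    Tri B s₀ (.scan c x T e) s Q := by
  refine Tri.seq (Tri.setWord (Nat.zero_le _) ?_)
  simp only [WExpr.eval]
  have hfr : ∀ s', Frame [c, x] [] (s.putWord x 0 0) s' → Frame [c, x] [] s s' := fun s' h' =>
    (Frame.putWord s (by simp)).trans h'
  have hput : ∀ (s : State) y, (s.putWord c 0 y).word x = s.word x := fun s y => by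
    simp [State.putWord, hcx.symm]
  refine Tri.forTo (N := N) (fun k s' => J k (s'.word x 0)) (by simpa [State.putWord, hx.symm] using hs)
    (fun s' h' => by simp [WExpr.eval, h', hN]) hNB hc (by simp [Program.wordWrites, hx.symm])
    (by simp [Program.wordWrites, hcx]) ?_ ?_ ?_
  · simp only [hput]
    simpa [State.putWord] using h0
  · intro k hk s' h1 h2 h3 h4
    obtain ⟨k1, k2⟩ := h k hk s' (hfr s' h2) h3 h4
    refine Tri.ite (fun hT => Tri.setWord (k1 hT).1 ?_) (fun hT => Tri.skip ?_)
    · simp only [hput]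
      simpa [State.putWord, WExpr.eval] using (k1 hT).2
    · simp only [hput]
      exact k2 hT
  · intro s' h1 h2 h3
    exact hQ s' h1 (hfr s' h2) h3

theorem Tri.scanReal {c x N : ℕ} {T : Test} {e : RExpr} (J : ℕ → ℝ → Prop)
    (hs : s.word 0 = s₀.word 0) (hN : s₀.word 0 0 = N) (hNB : N ≤ B) (hc : c ≠ 0) (h0 : J 0 0)
    (h : ∀ j < N, ∀ s', Frame [c] [x] s s' → s'.word c 0 = j → J j (s'.real x 0) →
      (T.holds s' → J (j + 1) (e.eval s')) ∧ (¬ T.holds s' → J (j + 1) (s'.real x 0)))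
    (hQ : ∀ s', s'.word 0 = s₀.word 0 → Frame [c] [x] s s' → J N (s'.real x 0) → Q s') :
    Tri B s₀ (.scanReal c x T e) s Q := by
  refine Tri.seq (Tri.setReal ?_)
  simp only [WExpr.eval, RExpr.eval, Nat.cast_zero]
  have hfr : ∀ s', Frame [c] [x] (s.putReal x 0 0) s' → Frame [c] [x] s s' := fun s' h' =>
    (Frame.putReal s (by simp)).trans h'
  refine Tri.forTo (N := N) (fun k s' => J k (s'.real x 0)) hs
    (fun s' h' => by simp [WExpr.eval, h', hN]) hNB hc (by simp [Program.wordWrites])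
    (by simp [Program.wordWrites]) ?_ ?_ ?_
  · simpa [State.putWord, State.putReal] using h0
  · intro k hk s' h1 h2 h3 h4
    obtain ⟨k1, k2⟩ := h k hk s' (hfr s' h2) h3 h4
    refine Tri.ite (fun hT => Tri.setReal ?_) (fun hT => Tri.skip ?_)
    · simpa [State.putReal, State.putWord, WExpr.eval] using k1 hT
    · exact k2 hT
  · intro s' h1 h2 h3
    exact hQ s' h1 (hfr s' h2) h3

/-- A search for a number with a property. -/
theorem Tri.find {c x N : ℕ} {T : Test} {e : WExpr} (τ : ℕ → Prop) (ε : ℕ → ℕ)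
    (hs : s.word 0 = s₀.word 0) (hN : s₀.word 0 0 = N) (hNB : N ≤ B) (hc : c ≠ 0) (hx : x ≠ 0)
    (hcx : c ≠ x) (h : ∀ j < N, ∀ s', Frame [c, x] [] s s' → s'.word c 0 = j →
      (T.holds s' ↔ τ j) ∧ (τ j → e.eval s' = ε j ∧ ε j ≤ B))
    (hQ : ∀ s', s'.word 0 = s₀.word 0 → Frame [c, x] [] s s' →
      ((∃ j < N, τ j ∧ s'.word x 0 = ε j) ∨ ((∀ j < N, ¬ τ j) ∧ s'.word x 0 = 0)) → Q s') :
    Tri B s₀ (.scan c x T e) s Q := by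
  refine Tri.scan (N := N) (fun k y => (∃ j < k, τ j ∧ y = ε j) ∨ ((∀ j < k, ¬ τ j) ∧ y = 0)) hs hN hNB
    hc hx hcx (Or.inr ⟨by simp, rfl⟩) ?_ hQ
  intro j hj s' h1 h2 h3
  obtain ⟨k1, k2⟩ := h j hj s' h1 h2
  refine ⟨fun hT => ?_, fun hT => ?_⟩
  · obtain ⟨k3, k4⟩ := k2 (k1.1 hT)
    exact ⟨k3 ▸ k4, Or.inl ⟨j, by omega, k1.1 hT, k3⟩⟩
  · rw [k1] at hT
    rcases h3 with ⟨i, h3, h4⟩ | ⟨h3, h4⟩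
    · exact Or.inl ⟨i, by omega, h4⟩
    · refine Or.inr ⟨fun i hi => ?_, h4⟩
      rcases Nat.lt_succ_iff_lt_or_eq.1 hi with hi | rfl
      exacts [h3 i hi, hT]

open Classical in
/-- A sum over the numbers with a property. -/
theorem Tri.sum {c x N : ℕ} {T : Test} {e : RExpr} (τ : ℕ → Prop) (ε : ℕ → ℝ)
    (hs : s.word 0 = s₀.word 0) (hN : s₀.word 0 0 = N) (hNB : N ≤ B) (hc : c ≠ 0)
    (h : ∀ j < N, ∀ s', Frame [c] [x] s s' → s'.word c 0 = j →
      (T.holds s' ↔ τ j) ∧ (τ j → e.eval s' = ε j))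
    (hQ : ∀ s', s'.word 0 = s₀.word 0 → Frame [c] [x] s s' →
      s'.real x 0 = ∑ j ∈ Finset.range N, (if τ j then ε j else 0) → Q s') :
    Tri B s₀ (.scanReal c x T (.add (.get x (.lit 0)) e)) s Q := by
  refine Tri.scanReal (N := N) (fun k y => y = ∑ j ∈ Finset.range k, (if τ j then ε j else 0)) hs hN
    hNB hc (by simp) ?_ hQ
  intro j hj s' h1 h2 h3
  obtain ⟨k1, k2⟩ := h j hj s' h1 h2
  rw [Finset.sum_range_succ, ← h3]
  refine ⟨fun hT => ?_, fun hT => ?_⟩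
  · rw [if_pos (k1.1 hT), ← k2 (k1.1 hT)]; rfl
  · rw [if_neg fun h => hT (k1.2 h), add_zero]

/-- The arrays in the lists agree at `i`. -/
def Agree (A R : List ℕ) (s s' : State) (i : ℕ) : Prop :=
  (∀ a ∈ A, s.word a i = s'.word a i) ∧ ∀ a ∈ R, s.real a i = s'.real a i

theorem Agree.trans {A R : List ℕ} {s s' s'' : State} {i : ℕ} (h : Agree A R s s' i)
    (h' : Agree A R s' s'' i) : Agree A R s s'' i :=
  ⟨fun a ha => (h.1 a ha).trans (h'.1 a ha), fun a ha => (h.2 a ha).trans (h'.2 a ha)⟩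

theorem Agree.symm {A R : List ℕ} {s s' : State} {i : ℕ} (h : Agree A R s s' i) :
    Agree A R s' s i :=
  ⟨fun a ha => (h.1 a ha).symm, fun a ha => (h.2 a ha).symm⟩

theorem Agree.putWord {A R : List ℕ} {s : State} {c x i : ℕ} (hc : c ∉ A) :
    Agree A R s (s.putWord c 0 x) i :=
  ⟨fun a ha => by
    have : a ≠ c := fun h => hc (h ▸ ha)
    simp [State.putWord, this], fun _ _ => rfl⟩

/-- A loop that fills each cell of some arrays once: every round can be described in terms of the
final state. -/
theorem Tri.pass {c N : ℕ} {lim : WExpr} (A R : List ℕ) (o : ℕ → ℕ) (Step : ℕ → State → State → Prop)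
    (ho : ∀ j < N, ∀ k < N, o j = o k → j = k) (hs : s.word 0 = s₀.word 0)
    (hlim : ∀ s', s'.word 0 = s₀.word 0 → lim.eval s' = N) (hN : N ≤ B) (hc : c ≠ 0)
    (hw0 : 0 ∉ p.wordWrites) (hwc : c ∉ p.wordWrites) (hcA : c ∉ A)
    (hstep : ∀ k < N, ∀ s', s'.word 0 = s₀.word 0 →
      Frame (c :: p.wordWrites) p.realWrites s s' → s'.word c 0 = k →
      Tri B s₀ p s' fun s'' => Step k s' s'' ∧ ∀ i, i ≠ o k → Agree A R s'' s' i)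
    (hQ : ∀ F, F.word 0 = s₀.word 0 → Frame (c :: p.wordWrites) p.realWrites s F →
      (∀ k < N, ∃ s' s'', Frame (c :: p.wordWrites) p.realWrites s s' ∧ s'.word c 0 = k ∧
        Step k s' s'' ∧ (∀ j < k, Agree A R s' F (o j)) ∧ Agree A R s'' F (o k)) → Q F) :
    Tri B s₀ (.forTo c lim p) s Q := by
  refine Tri.forTo (N := N) (fun m F => m ≤ N → ∀ k < m, ∃ s' s'',
    Frame (c :: p.wordWrites) p.realWrites s s' ∧ s'.word c 0 = k ∧
      Step k s' s'' ∧ (∀ j < k, Agree A R s' F (o j)) ∧ Agree A R s'' F (o k)) hs hlim hN hc hw0 hwc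
    (by simp) ?_ (fun F h1 h2 h3 => hQ F h1 h2 (h3 le_rfl))
  intro m hm s1 h1 h2 h3 h4
  refine (hstep m hm s1 h1 h2 h3).mono ?_
  rintro s2 - ⟨k1, k2⟩ hm1 k hk
  have hput : ∀ i, Agree A R s2 (s2.putWord c 0 (m + 1)) i := fun i => Agree.putWord hcA
  rcases Nat.lt_succ_iff_lt_or_eq.1 hk with hk | rfl
  · obtain ⟨s', s'', e1, e2, e3, e4, e5⟩ := h4 hm.le k hk
    -- By injectivity of `o` the new round leaves the cells of earlier rounds alone, so what was
    -- recorded about them persists.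
    have hne : ∀ j < m, o j ≠ o m := fun j hj h => by
      have := ho j (by omega) m (by omega) h
      omega
    refine ⟨s', s'', e1, e2, e3, fun j hj => ?_, ?_⟩
    · exact (e4 j hj).trans ((k2 _ (hne j (by omega))).symm.trans (hput _))
    · exact e5.trans ((k2 _ (hne k hk)).symm.trans (hput _))
  · refine ⟨s1, s2, h2, h3, k1, fun j hj => ?_, hput _⟩
    have : o j ≠ o k := fun h => by
      have := ho j (by omega) k (by omega) h
      omega
    exact (k2 _ this).symm.trans (hput _)

end Rules

end RealRAM


/-! ## Depth first search -/

/-- The invariant of depth first search: `num v` is the number of `v`, starting with `1`, and `0` if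
`v` has not been visited; `cnt` vertices have been visited and `cur` is the current one. -/
structure DFSState {V : Type*} (G : SimpleGraph V) (root : V) (par : V → V) (num : V → ℕ)
    (ord : ℕ → V) (cur : V) (cnt : ℕ) : Prop where
  par_root : par root = root
  num_root : num root ≠ 0
  num_le : ∀ v, num v ≤ cnt
  ord_num : ∀ v, num v ≠ 0 → ord (num v - 1) = v
  num_ord : ∀ k < cnt, num (ord k) = k + 1
  adj_par : ∀ v, num v ≠ 0 → v ≠ root → G.Adj v (par v)
  par_ne : ∀ v, num v ≠ 0 → num (par v) ≠ 0
  num_par : ∀ v, num v ≠ 0 → v ≠ root → num (par v) < num v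
  num_cur : num cur ≠ 0
  anc_of_adj : ∀ u v, num u ≠ 0 → G.Adj u v → num u < num v → Anc root par u v
  closed : ∀ v, num v ≠ 0 → ¬ Anc root par v cur → ∀ u, G.Adj v u → num u ≠ 0

namespace DFSState

variable {V : Type*} {G : SimpleGraph V} {root : V} {par : V → V} {num : V → ℕ}
  {ord : ℕ → V} {cur : V} {cnt : ℕ}

theorem cnt_le [Fintype V] (h : DFSState G root par num ord cur cnt) : cnt ≤ Fintype.card V := by
  have : Function.Injective fun k : Fin cnt => ord k := by
    intro j k hjk
    have h1 := h.num_ord j j.2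
    have h2 := h.num_ord k k.2
    have : ord j = ord k := hjk
    rw [this, h2] at h1
    exact Fin.ext (by omega)
  simpa using Fintype.card_le_of_injective _ this

open Classical in
theorem init : DFSState G root (fun _ => root) (fun v => if v = root then 1 else 0) (fun _ => root)
    root 1 where
  par_root := rfl
  num_root := by simp
  num_le v := by split_ifs <;> simp
  ord_num v hv := by
    by_contra h
    exact hv (if_neg fun h' => h h'.symm)
  num_ord k hk := by simp; omega
  adj_par v hv hne := absurd (if_neg hne) hv
  par_ne v _ := by simp
  num_par v hv hne := absurd (if_neg hne) hv
  num_cur := by simp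
  anc_of_adj u v hu huv hlt := by
    have h1 : u = root := by by_contra h; exact hu (if_neg h)
    have h2 : v = root := by
      by_contra h
      rw [if_neg h] at hlt
      omega
    exact absurd (h1.trans h2.symm) huv.ne
  closed v hv hn := by
    have h1 : v = root := by by_contra h; exact hv (if_neg h)
    exact absurd (h1 ▸ Relation.ReflTransGen.refl) hn

variable (h : DFSState G root par num ord cur cnt)
include h

/-- Ancestors of a visited vertex are visited, so the new parent of the unvisited `u` does not
matter. -/
theorem anc_update [DecidableEq V] {u x : V} (hu : num u = 0) {a b : V} (hb : num b ≠ 0)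
    (hab : Anc root par a b) : Anc root (Function.update par u x) a b := by
  induction hab with
  | refl => exact Relation.ReflTransGen.refl
  | @tail c d _ hcd ih =>
    have hdu : d ≠ u := fun h' => hb (h' ▸ hu)
    have hc : num c ≠ 0 := by rw [← hcd.2]; exact h.par_ne d hb
    exact (ih hc).tail ⟨hcd.1, by rw [Function.update_of_ne hdu, hcd.2]⟩

/-- The field `closed` says that a visited vertex with an unvisited neighbor is an ancestor of
`cur`. So all visited neighbors of `u` become ancestors of `u`, which is the depth-first property
for the new edges. -/
theorem visit [DecidableEq V] {u : V} (hu : num u = 0) (hadj : G.Adj cur u) :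
    DFSState G root (Function.update par u cur) (Function.update num u (cnt + 1))
      (Function.update ord cnt u) u (cnt + 1) := by
  have hur : u ≠ root := fun h' => h.num_root (h' ▸ hu)
  have hcu : cur ≠ u := hadj.ne
  have hold : ∀ v, v ≠ u → Function.update num u (cnt + 1) v = num v := fun v hv =>
    Function.update_of_ne hv _ _
  have hnew : Function.update num u (cnt + 1) u = cnt + 1 := Function.update_self _ _ _
  have hvis : ∀ v, v ≠ u → Function.update num u (cnt + 1) v ≠ 0 → num v ≠ 0 := fun v hv h' => by
    rwa [hold v hv] at h'
  have hanc_cur : ∀ v, num v ≠ 0 → G.Adj v u → Anc root par v cur := fun v hv hvu => by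
    by_contra hn
    exact h.closed v hv hn u hvu hu
  have hanc_u : ∀ v, Anc root par v cur → Anc root (Function.update par u cur) v u := fun v hv =>
    (h.anc_update hu h.num_cur hv).tail ⟨hur, Function.update_self _ _ _⟩
  refine ⟨?_, ?_, ?_, ?_, ?_, ?_, ?_, ?_, ?_, ?_, ?_⟩
  · rw [Function.update_of_ne hur.symm, h.par_root]
  · rw [hold _ hur.symm]; exact h.num_root
  · intro v
    by_cases hv : v = u
    · rw [hv, hnew]
    · rw [hold v hv]; exact (h.num_le v).trans (Nat.le_succ _)
  · intro v hv
    by_cases hvu : v = u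
    · rw [hvu, hnew, Nat.add_sub_cancel, Function.update_self]
    · rw [hold v hvu] at hv ⊢
      have := h.num_le v
      rw [Function.update_of_ne (by omega), h.ord_num v hv]
  · intro k hk
    rcases Nat.lt_succ_iff_lt_or_eq.1 hk with hk | rfl
    · have h1 := h.num_ord k hk
      rw [Function.update_of_ne hk.ne, hold, h1]
      intro h'
      rw [h', hu] at h1
      omega
    · rw [Function.update_self, hnew]
  · intro v hv hvr
    by_cases hvu : v = u
    · rw [hvu, Function.update_self]; exact hadj.symm
    · rw [Function.update_of_ne hvu]
      exact h.adj_par v (hvis v hvu hv) hvr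
  · intro v hv
    by_cases hvu : v = u
    · rw [hvu, Function.update_self, hold _ hcu]; exact h.num_cur
    · have h1 := h.par_ne v (hvis v hvu hv)
      rw [Function.update_of_ne hvu, hold]
      · exact h1
      · exact fun h' => h1 (h' ▸ hu)
  · intro v hv hvr
    by_cases hvu : v = u
    · rw [hvu, Function.update_self, hold _ hcu, hnew]
      have := h.num_le cur
      omega
    · have h1 := h.par_ne v (hvis v hvu hv)
      rw [Function.update_of_ne hvu, hold _ hvu, hold]
      · exact h.num_par v (hvis v hvu hv) hvr
      · exact fun h' => h1 (h' ▸ hu)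
  · rw [hnew]; omega
  · intro a b ha hab hlt
    by_cases hbu : b = u
    · subst hbu
      have hau : a ≠ b := hab.ne
      exact hanc_u a (hanc_cur a (hvis a hau ha) hab)
    · have hau : a ≠ u := by
        intro h'
        rw [h', hnew, hold b hbu] at hlt
        have := h.num_le b
        omega
      rw [hold a hau, hold b hbu] at hlt
      exact h.anc_update hu (by omega) (h.anc_of_adj a b (hvis a hau ha) hab hlt)
  · intro v hv hn w hvw
    have hvu : v ≠ u := fun h' => hn (h' ▸ Relation.ReflTransGen.refl)
    have h1 := h.closed v (hvis v hvu hv) (fun h' => hn (hanc_u v h')) w hvw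
    by_cases hwu : w = u
    · rw [hwu, hnew]; omega
    · rwa [hold w hwu]

/-- Only `cur` ceases to be an ancestor of the current vertex, and its neighbors are all visited. -/
theorem back (hc : ∀ u, G.Adj cur u → num u ≠ 0) : DFSState G root par num ord (par cur) cnt where
  par_root := h.par_root
  num_root := h.num_root
  num_le := h.num_le
  ord_num := h.ord_num
  num_ord := h.num_ord
  adj_par := h.adj_par
  par_ne := h.par_ne
  num_par := h.num_par
  num_cur := h.par_ne _ h.num_cur
  anc_of_adj := h.anc_of_adj
  closed v hv hn := by
    by_cases hvc : v = cur
    · rw [hvc]; exact hc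
    · refine h.closed v hv fun h' => hn ?_
      rcases IsDFSTree.anc_cases h' with h1 | ⟨-, h1⟩
      · exact absurd h1 hvc
      · exact h1

/-- When the search is stuck at the root, no other vertex is an ancestor of `cur`, so the visited
set is closed under adjacency. -/
theorem all_visited (hG : G.Connected) (hcur : cur = root) (hc : ∀ u, G.Adj cur u → num u ≠ 0)
    (v : V) : num v ≠ 0 := by
  have hcl : ∀ a b, num a ≠ 0 → G.Adj a b → num b ≠ 0 := by
    intro a b ha hab
    by_cases har : a = cur
    · exact hc b (har ▸ hab)
    · refine h.closed a ha (fun h' => ?_) b hab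
      rcases IsDFSTree.anc_cases h' with h1 | ⟨h1, -⟩
      · exact har h1
      · exact h1 hcur
  obtain ⟨w⟩ := hG root v
  have : ∀ {a b : V}, G.Walk a b → num a ≠ 0 → num b ≠ 0 := by
    intro a b w
    induction w with
    | nil => exact id
    | cons hab _ ih => exact fun ha => ih (hcl _ _ ha hab)
  exact this w h.num_root

theorem isDFSTree (hall : ∀ v, num v ≠ 0) :
    IsDFSTree G root par (fun v => num v - 1) ∧ ∀ v, Anc root par root v := by
  have hlt : ∀ v, v ≠ root → num (par v) - 1 < num v - 1 := fun v hv => by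
    have := h.num_par v (hall v) hv
    have := hall (par v)
    omega
  refine ⟨⟨?_, fun v hv => h.adj_par v (hall v) hv, hlt, ?_⟩, ?_⟩
  · intro u v huv
    have := h.ord_num u (hall u)
    rw [← h.ord_num u (hall u), ← h.ord_num v (hall v)]
    exact congrArg ord huv
  · intro u v huv hlt
    exact h.anc_of_adj u v (hall u) huv (by omega)
  · intro v
    induction hn : num v - 1 using Nat.strong_induction_on generalizing v with
    | _ n ih =>
      by_cases hv : v = root
      · rw [hv]; exact Relation.ReflTransGen.refl
      · exact IsDFSTree.anc_par hv (ih _ (hn ▸ hlt v hv) _ rfl)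

end DFSState


/-! ## The program: search tree -/

namespace RealRAM

/-- A scalar variable. -/
abbrev WExpr.var (a : ℕ) : WExpr := .get a (.lit 0)

/-- The number of vertices. -/
abbrev WExpr.order : WExpr := .get 0 (.lit 0)

/-- The entry of a matrix. -/
abbrev WExpr.entry (a : ℕ) (i j : WExpr) : WExpr := .get a (.add (.mul i .order) j)

theorem State.putWord_word (s : State) (a i x b j : ℕ) :
    (s.putWord a i x).word b j = if b = a ∧ j = i then x else s.word b j := by
  by_cases hb : b = a
  · subst hb
    by_cases hj : j = i
    · simp [State.putWord, hj]
    · simp [State.putWord, hj]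
  · simp [State.putWord, hb]

theorem State.putWord_real (s : State) (a i x : ℕ) : (s.putWord a i x).real = s.real := rfl

theorem State.putReal_word (s : State) (a i : ℕ) (x : ℝ) : (s.putReal a i x).word = s.word := rfl

theorem State.putReal_real (s : State) (a i : ℕ) (x : ℝ) (b j : ℕ) :
    (s.putReal a i x).real b j = if b = a ∧ j = i then x else s.real b j := by
  by_cases hb : b = a
  · subst hb
    by_cases hj : j = i
    · simp [State.putReal, hj]
    · simp [State.putReal, hj]
  · simp [State.putReal, hb]

theorem mul_add_inj {n : ℕ} {a b c d : ℕ} (hb : b < n) (hd : d < n) :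
    a * n + b = c * n + d ↔ a = c ∧ b = d := by
  constructor
  · intro h
    have h1 : a = c := by
      have := congrArg (· / n) h
      simpa [Nat.add_div_of_dvd_right, Nat.mul_add_div, mul_comm _ n, Nat.div_eq_of_lt hb,
        Nat.div_eq_of_lt hd, Nat.mul_add_div (show 0 < n by omega)] using this
    subst h1
    exact ⟨rfl, by omega⟩
  · rintro ⟨rfl, rfl⟩; rfl

/-- The adjacency matrix in array `3`. -/
def adjacencyProgram : Program :=
  .forTo 20 (.get 0 (.lit 1))
    (.seq (.setWord 3 (.add (.mul (.get 1 (.var 20)) .order) (.get 2 (.var 20))) (.lit 1))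
      (.setWord 3 (.add (.mul (.get 2 (.var 20)) .order) (.get 1 (.var 20))) (.lit 1)))

/-- Array `3` is the adjacency matrix. -/
def HasAdj {n : ℕ} (G : SimpleGraph (Fin n)) (s : State) : Prop :=
  ∀ u v : Fin n, s.word 3 (u * n + v) = 1 ↔ G.Adj u v

theorem IsEdgeList.length_le {n : ℕ} {G : SimpleGraph (Fin n)} {E : List (Fin n × Fin n)}
    (hE : IsEdgeList G E) : E.length ≤ n * n := by
  have := (List.Nodup.of_map _ hE.nodup).length_le_card
  simpa using this

theorem adjacencyProgram_spec {n B : ℕ} {G : SimpleGraph (Fin n)} {E : List (Fin n × Fin n)}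
    (hE : IsEdgeList G E) (hB : 4 * (n * n) ≤ B) {Q : State → Prop}
    (hQ : ∀ s, s.word 0 = (input n E).word 0 → Frame [20, 3] [] (input n E) s → HasAdj G s → Q s) :
    Tri B (input n E) adjacencyProgram (input n E) Q := by
  have hlen := hE.length_le
  have h00 : (input n E).word 0 0 = n := by simp [input]
  have h01 : (input n E).word 0 1 = E.length := by simp [input]
  have h1 : ∀ (j : ℕ) (hj : j < E.length), (input n E).word 1 j = (E[j].1 : ℕ) := fun j hj => by
    simp [input, List.getD_eq_getElem?_getD, hj]
  have h2 : ∀ (j : ℕ) (hj : j < E.length), (input n E).word 2 j = (E[j].2 : ℕ) := fun j hj => by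
    simp [input, List.getD_eq_getElem?_getD, hj]
  refine Tri.forTo (N := E.length) (fun k s => ∀ u v : Fin n, s.word 3 (u * n + v) = 1 ↔
    ∃ (j : ℕ) (hj : j < E.length), j < k ∧ (E[j] = (u, v) ∨ E[j] = (v, u))) rfl
    (fun s hs => by simp [WExpr.eval, hs, h01]) (by omega) (by norm_num)
    (by simp [Program.wordWrites]) (by simp [Program.wordWrites]) ?_ ?_ ?_
  · intro u v
    simp [State.putWord_word, input]
  · intro k hk s hs hf hc hI
    have e1 : s.word 1 k = (E[k].1 : ℕ) := by
      rw [hf.word 1 (by simp [Program.wordWrites]), h1 k hk]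
    have e2 : s.word 2 k = (E[k].2 : ℕ) := by
      rw [hf.word 2 (by simp [Program.wordWrites]), h2 k hk]
    have e0 : s.word 0 0 = n := by rw [hs, h00]
    have hB1 : 1 ≤ B := by omega
    refine Tri.seq (Tri.setWord hB1 (Tri.setWord hB1 ?_))
    intro u v
    have key : ∀ a b : Fin n, (u : ℕ) * n + v = a * n + b ↔ u = a ∧ v = b := fun a b => by
      rw [mul_add_inj v.2 b.2, Fin.val_inj, Fin.val_inj]
    simp only [State.putWord_word, WExpr.eval, hc, e0, e1, e2, key,
      Nat.reduceEqDiff, false_and, true_and, if_false, OfNat.one_ne_ofNat, OfNat.zero_ne_ofNat]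
    constructor
    · intro h
      split_ifs at h with h3 h4
      · exact ⟨k, hk, by omega, Or.inr (Prod.ext h3.2.symm h3.1.symm)⟩
      · exact ⟨k, hk, by omega, Or.inl (Prod.ext h4.1.symm h4.2.symm)⟩
      · obtain ⟨j, hj, h5, h6⟩ := (hI u v).1 h
        exact ⟨j, hj, by omega, h6⟩
    · rintro ⟨j, hj, h5, h6⟩
      rcases Nat.lt_succ_iff_lt_or_eq.1 h5 with h5 | rfl
      · have := (hI u v).2 ⟨j, hj, h5, h6⟩
        split_ifs
        exacts [rfl, rfl, this]
      · rcases h6 with h6 | h6 <;> simp [h6]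
  · intro s hs hf hI
    refine hQ s hs (hf.mono (by decide) (by decide)) fun u v => ?_
    rw [hI, ← hE.mem_iff, List.mem_map]
    constructor
    · rintro ⟨j, hj, -, h | h⟩
      · exact ⟨E[j], List.getElem_mem hj, by rw [h]⟩
      · exact ⟨E[j], List.getElem_mem hj, by rw [h, Sym2.eq_swap]⟩
    · rintro ⟨e, he, h⟩
      obtain ⟨j, hj, rfl⟩ := List.getElem_of_mem he
      refine ⟨j, hj, hj, ?_⟩
      rcases Sym2.eq_iff.1 h with ⟨h1, h2⟩ | ⟨h1, h2⟩
      · exact Or.inl (Prod.ext h1 h2)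
      · exact Or.inr (Prod.ext h1 h2)

/-- Depth first search. Array `4` receives the vertices in the order of their discovery, array `5`
their numbers, array `6` the parents. -/
def searchProgram : Program :=
  .seq (.setWord 5 (.lit 0) (.lit 1)) (.seq (.setWord 24 (.lit 0) (.lit 1))
    (.forTo 20 (.add .order .order)
      (.seq (.scan 21 22 (.and (.wordEq (.entry 3 (.var 23) (.var 21)) (.lit 1))
          (.wordEq (.get 5 (.var 21)) (.lit 0))) (.add (.var 21) (.lit 1)))
        (.ite (.wordEq (.var 22) (.lit 0))
          (.setWord 23 (.lit 0) (.get 6 (.var 23)))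
          (.seq (.setWord 6 (.sub (.var 22) (.lit 1)) (.var 23))
            (.seq (.setWord 4 (.var 24) (.sub (.var 22) (.lit 1)))
              (.seq (.setWord 24 (.lit 0) (.add (.var 24) (.lit 1)))
                (.seq (.setWord 5 (.sub (.var 22) (.lit 1)) (.var 24))
                  (.setWord 23 (.lit 0) (.sub (.var 22) (.lit 1)))))))))))

/-- The arrays describe the state of the search. -/
structure SearchState {n : ℕ} (G : SimpleGraph (Fin n)) (root : Fin n) (par : Fin n → Fin n)
    (num : Fin n → ℕ) (ord : ℕ → Fin n) (cur : Fin n) (cnt : ℕ) (d : Fin n → ℕ) (s : State) :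
    Prop where
  dfs : DFSState G root par num ord cur cnt
  depth_root : d root = 0
  depth : ∀ v, num v ≠ 0 → v ≠ root → d v = d (par v) + 1
  par_eq : ∀ v : Fin n, s.word 6 v = par v
  num_eq : ∀ v : Fin n, s.word 5 v = num v
  ord_eq : ∀ k, s.word 4 k = ord k
  cur_eq : s.word 23 0 = cur
  cnt_eq : s.word 24 0 = cnt

/-- The result of the search. -/
structure SearchTree {n : ℕ} (G : SimpleGraph (Fin n)) (root : Fin n) (par : Fin n → Fin n)
    (idx : Fin n → ℕ) (ord : ℕ → Fin n) (s : State) : Prop where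
  isDFSTree : IsDFSTree G root par idx
  anc_root : ∀ v, Anc root par root v
  par_root : par root = root
  root_eq : (root : ℕ) = 0
  idx_lt : ∀ v, idx v < n
  ord_idx : ∀ v, ord (idx v) = v
  idx_ord : ∀ k < n, idx (ord k) = k
  par_eq : ∀ v : Fin n, s.word 6 v = par v
  num_eq : ∀ v : Fin n, s.word 5 v = idx v + 1
  ord_eq : ∀ k, s.word 4 k = ord k

/-- Each round either discovers a vertex or backtracks. A vertex is entered once and left at most
once, so `2 * n` rounds suffice; idle rounds at the root are harmless. -/
theorem searchProgram_spec {n B : ℕ} {G : SimpleGraph (Fin n)} {s₀ s : State} (hn : 0 < n)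
    (hG : G.Connected) (hB : 4 * (n * n) ≤ B) (h0 : s₀.word 0 0 = n) (hs : s.word 0 = s₀.word 0)
    (hadj : HasAdj G s) (h4 : ∀ k, s.word 4 k = 0) (h5 : ∀ k, s.word 5 k = 0)
    (h6 : ∀ k, s.word 6 k = 0) (h23 : s.word 23 0 = 0) {Q : State → Prop}
    (hQ : ∀ s', s'.word 0 = s₀.word 0 → Frame [20, 21, 22, 23, 24, 4, 5, 6] [] s s' →
      (∃ root par idx ord, SearchTree G root par idx ord s') → Q s') :
    Tri B s₀ searchProgram s Q := by
  classical
  have hnn : n ≤ n * n := Nat.le_mul_self n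
  -- With vertex `0` as the root, zeroed memory already makes it current, its own parent and the
  -- first entry of the order.
  set root : Fin n := ⟨0, hn⟩ with hroot
  have hr0 : (root : ℕ) = 0 := rfl
  refine Tri.seq (Tri.setWord (by simp only [WExpr.eval]; omega) (Tri.seq (Tri.setWord
    (by simp only [WExpr.eval]; omega) ?_)))
  simp only [WExpr.eval]
  -- Until the search is complete, `k + 2 + d cur ≤ 2 * cnt` with `d` the depth: a visit raises the
  -- right side by two and the depth by one, a step back lowers the depth by one.
  refine Tri.forTo (N := n + n) (fun k s' => ∃ par num ord cur cnt d,
      SearchState G root par num ord cur cnt d s' ∧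
      (k + 2 + d cur ≤ 2 * cnt ∨ ∀ v, num v ≠ 0)) (by funext j; simp [State.putWord_word, hs])
    (fun s' h => by simp [WExpr.eval, h, h0]) (by omega) (by norm_num) (by decide) (by decide)
    ?_ ?_ ?_
  · refine ⟨_, _, _, _, _, fun _ => 0, ⟨DFSState.init, rfl, ?_, ?_, ?_, ?_, ?_, ?_⟩, Or.inl le_rfl⟩
    · exact fun v hv hne => absurd (if_neg hne) hv
    · intro v; simp [State.putWord_word, h6, hr0]
    · intro v
      simp [State.putWord_word, h5, hroot, Fin.ext_iff]
    · intro k; simp [State.putWord_word, h4, hr0]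
    · simp [State.putWord_word, h23, hr0]
    · simp [State.putWord_word]
  · rintro k hk s' hs' hf hc ⟨par, num, ord, cur, cnt, d, hS, hΦ⟩
    have hadj' : HasAdj G s' := fun u v => by
      rw [hf.word 3 (by decide), ← hadj u v]
      simp [State.putWord_word]
    have hn0 : s'.word 0 0 = n := by rw [hs', h0]
    have hcnt := hS.dfs.cnt_le
    rw [Fintype.card_fin] at hcnt
    refine Tri.seq (Tri.find (N := n)
      (fun j => ∃ hj : j < n, G.Adj cur ⟨j, hj⟩ ∧ num ⟨j, hj⟩ = 0) (fun j => j + 1) hs' h0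
      (by omega) (by norm_num) (by norm_num) (by norm_num) ?_ ?_)
    · intro j hj s1 hf1 hc1
      refine ⟨?_, fun _ => ⟨by simp [WExpr.eval, hc1], by omega⟩⟩
      have e1 := hadj' cur ⟨j, hj⟩
      have e2 := hS.num_eq ⟨j, hj⟩
      simp only [Test.holds, WExpr.eval, hf1.word 3 (by decide), hf1.word 5 (by decide),
        hf1.word 0 (by decide), hf1.word 23 (by decide), hc1, hn0, hS.cur_eq]
      rw [e1, e2]
      exact ⟨fun h => ⟨hj, h⟩, fun ⟨_, h⟩ => h⟩
    · intro s1 hs1 hf1 hx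
      refine Tri.ite (fun hb => ?_) (fun hb => ?_)
      · have hb : s1.word 22 0 = 0 := hb
        have hcl : ∀ u, G.Adj cur u → num u ≠ 0 := by
          rcases hx with ⟨j, _, _, hx⟩ | ⟨hx, _⟩
          · omega
          · exact fun u hu h => hx u u.2 ⟨u.2, hu, h⟩
        have hcur1 : s1.word 23 0 = cur := by rw [hf1.word 23 (by decide), hS.cur_eq]
        have hpar1 : ∀ v : Fin n, s1.word 6 v = par v := fun v => by
          rw [hf1.word 6 (by decide), hS.par_eq]
        have heval : (WExpr.get 6 (.var 23)).eval s1 = par cur := by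
          simp only [WExpr.eval, hcur1, hpar1]
        refine Tri.setWord (by rw [heval]; have := (par cur).2; omega) ?_
        rw [heval]
        refine ⟨par, num, ord, par cur, cnt, d, ⟨hS.dfs.back hcl, hS.depth_root, hS.depth, ?_, ?_,
          ?_, ?_, ?_⟩, ?_⟩
        · intro v; simp [State.putWord_word, WExpr.eval, hpar1]
        · intro v; simp [State.putWord_word, WExpr.eval, hf1.word 5, hS.num_eq]
        · intro v; simp [State.putWord_word, WExpr.eval, hf1.word 4, hS.ord_eq]
        · simp [State.putWord_word, WExpr.eval]
        · simp [State.putWord_word, WExpr.eval, hf1.word 24, hS.cnt_eq]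
        · by_cases hcr : cur = root
          · exact Or.inr (hS.dfs.all_visited hG hcr hcl)
          · refine hΦ.imp_left fun h => ?_
            have := hS.depth cur hS.dfs.num_cur hcr
            omega
      · have hb : s1.word 22 0 ≠ 0 := hb
        obtain ⟨u, hu, hnu, hxu⟩ : ∃ u : Fin n, G.Adj cur u ∧ num u = 0 ∧ s1.word 22 0 = u + 1 := by
          rcases hx with ⟨j, hj, ⟨_, h1, h2⟩, h3⟩ | ⟨_, hx⟩
          · exact ⟨⟨j, hj⟩, h1, h2, h3⟩
          · exact absurd hx hb
        have hV := hS.dfs.visit hnu hu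
        have hcnt' := hV.cnt_le
        rw [Fintype.card_fin] at hcnt'
        have hcur1 : s1.word 23 0 = cur := by rw [hf1.word 23 (by decide), hS.cur_eq]
        have hcnt1 : s1.word 24 0 = cnt := by rw [hf1.word 24 (by decide), hS.cnt_eq]
        have huc := u.2
        have hcc := cur.2
        have hur : u ≠ root := fun h' => hS.dfs.num_root (h' ▸ hnu)
        have hcu : cur ≠ u := hu.ne
        refine Tri.seq (Tri.setWord ?_ (Tri.seq (Tri.setWord ?_ (Tri.seq (Tri.setWord ?_
          (Tri.seq (Tri.setWord ?_ (Tri.setWord ?_ ?_))))))))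
        · simp only [WExpr.eval, hcur1]; omega
        · simp only [WExpr.eval, State.putWord_word, hxu, Nat.reduceEqDiff, false_and, if_false]; omega
        · simp only [WExpr.eval, State.putWord_word, hcnt1, Nat.reduceEqDiff, false_and, if_false]
          omega
        · simp [WExpr.eval, State.putWord_word, hcnt1]; omega
        · simp [WExpr.eval, State.putWord_word, hxu]; omega
        · refine ⟨_, _, _, _, _, Function.update d u (d cur + 1), ⟨hV, ?_, ?_, ?_, ?_, ?_, ?_, ?_⟩, ?_⟩
          · rw [Function.update_of_ne hur.symm, hS.depth_root]
          · intro v hv hvr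
            by_cases hvu : v = u
            · rw [hvu, Function.update_self, Function.update_self, Function.update_of_ne hcu]
            · rw [Function.update_of_ne hvu] at hv
              have hpu : par v ≠ u := fun h' => hS.dfs.par_ne v hv (h' ▸ hnu)
              rw [Function.update_of_ne hvu, Function.update_of_ne hvu, Function.update_of_ne hpu]
              exact hS.depth v hv hvr
          · intro v
            simp [State.putWord_word, WExpr.eval, hxu, hf1.word 6, hf1.word 23, hS.cur_eq,
              hS.par_eq, Function.update_apply, Fin.ext_iff]
            split_ifs <;> rfl
          · intro v
            simp [State.putWord_word, WExpr.eval, hxu, hf1.word 5, hcnt1,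
              hS.num_eq, Function.update_apply, Fin.ext_iff]
          · intro k
            simp [State.putWord_word, WExpr.eval, hxu, hf1.word 4, hcnt1,
              hS.ord_eq, Function.update_apply]
            split_ifs <;> rfl
          · simp [State.putWord_word, WExpr.eval, hxu]
          · simp [State.putWord_word, WExpr.eval, hcnt1]
          · rcases hΦ with h | h
            · left
              rw [Function.update_self]
              omega
            · exact absurd hnu (h u)
  · rintro s' hs' hf ⟨par, num, ord, cur, cnt, d, hS, hΦ⟩
    have hcnt := hS.dfs.cnt_le
    rw [Fintype.card_fin] at hcnt
    -- After `2 * n` rounds the first alternative would force `cnt > n`.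
    have hall : ∀ v, num v ≠ 0 := by
      rcases hΦ with h | h
      · omega
      · exact h
    have hcn : cnt = n := by
      refine le_antisymm hcnt ?_
      have : Function.Injective fun v : Fin n => (⟨num v - 1, by
          have := hall v; have := hS.dfs.num_le v; omega⟩ : Fin cnt) := by
        intro u v huv
        have h1 : num u - 1 = num v - 1 := congrArg Fin.val huv
        rw [← hS.dfs.ord_num u (hall u), ← hS.dfs.ord_num v (hall v), h1]
      simpa using Fintype.card_le_of_injective _ this
    obtain ⟨hT, hanc⟩ := hS.dfs.isDFSTree hall
    refine hQ s' hs' (((Frame.putWord s (by simp)).trans (Frame.putWord _ (by simp))).trans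
      (hf.mono (by decide) (by decide)))
      ⟨root, par, _, ord, hT, hanc, hS.dfs.par_root, hr0, ?_, ?_, ?_, hS.par_eq, ?_, hS.ord_eq⟩
    · intro v
      have := hS.dfs.num_le v
      have := hall v
      omega
    · exact fun v => hS.dfs.ord_num v (hall v)
    · intro k hk
      have := hS.dfs.num_ord k (by omega)
      omega
    · intro v
      have := hall v
      rw [hS.num_eq]; omega

end RealRAM


/-! ## The program: blocks -/

namespace RealRAM

/-- A loop that fills each cell with a value that has a property. -/
theorem Tri.each {α : Type*} {B : ℕ} {s₀ s : State} {p : Program} {Q : State → Prop} {c N : ℕ}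
    {lim : WExpr} (A R : List ℕ) (o : ℕ → ℕ)
    (val : State → ℕ → α) (hval : ∀ s s' i, Agree A R s s' i → val s i = val s' i)
    (P : ℕ → α → Prop) (ho : ∀ j < N, ∀ k < N, o j = o k → j = k) (hs : s.word 0 = s₀.word 0)
    (hlim : ∀ s', s'.word 0 = s₀.word 0 → lim.eval s' = N) (hN : N ≤ B) (hc : c ≠ 0)
    (hw0 : 0 ∉ p.wordWrites) (hwc : c ∉ p.wordWrites) (hcA : c ∉ A)
    (hstep : ∀ k < N, ∀ s', s'.word 0 = s₀.word 0 →
      Frame (c :: p.wordWrites) p.realWrites s s' → s'.word c 0 = k →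
      Tri B s₀ p s' fun s'' => P k (val s'' (o k)) ∧ ∀ i, i ≠ o k → Agree A R s'' s' i)
    (hQ : ∀ F, F.word 0 = s₀.word 0 → Frame (c :: p.wordWrites) p.realWrites s F →
      (∀ k < N, P k (val F (o k))) → Q F) :
    Tri B s₀ (.forTo c lim p) s Q :=
  Tri.pass A R o (fun k _ s'' => P k (val s'' (o k))) ho hs hlim hN hc hw0 hwc hcA hstep
    fun F h1 h2 h3 => hQ F h1 h2 fun k hk => by
      obtain ⟨_, s'', -, -, h4, -, h5⟩ := h3 k hk
      rwa [← hval _ _ _ h5]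

/-- The matrix of the ancestor relation in array `8`. -/
def ancestorProgram : Program :=
  .forTo 20 .order (.seq (.setWord 25 (.lit 0) (.get 4 (.var 20)))
    (.forTo 21 .order (.ite (.wordEq (.var 21) (.var 25))
      (.setWord 8 (.add (.mul (.var 21) .order) (.var 25)) (.lit 1))
      (.ite (.and (.not (.wordEq (.var 25) (.lit 0)))
          (.wordEq (.entry 8 (.var 21) (.get 6 (.var 25))) (.lit 1)))
        (.setWord 8 (.add (.mul (.var 21) .order) (.var 25)) (.lit 1))
        (.setWord 8 (.add (.mul (.var 21) .order) (.var 25)) (.lit 0))))))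

section

variable {n B : ℕ} {G : SimpleGraph (Fin n)} {s₀ s : State} {root : Fin n} {par : Fin n → Fin n}
  {idx : Fin n → ℕ} {ord : ℕ → Fin n}

theorem SearchTree.frame {s' : State} (h : SearchTree G root par idx ord s) (h4 : s'.word 4 = s.word 4)
    (h5 : s'.word 5 = s.word 5) (h6 : s'.word 6 = s.word 6) : SearchTree G root par idx ord s' :=
  { h with
    par_eq := fun v => by rw [h6, h.par_eq]
    num_eq := fun v => by rw [h5, h.num_eq]
    ord_eq := fun v => by rw [h4, h.ord_eq] }

theorem SearchTree.ord_inj (h : SearchTree G root par idx ord s) :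
    ∀ j < n, ∀ k < n, (ord j : ℕ) = ord k → j = k := fun j hj k hk hjk => by
  rw [← h.idx_ord j hj, ← h.idx_ord k hk, Fin.ext hjk]

/-- Array `8` is the matrix of the ancestor relation. -/
def HasAnc (root : Fin n) (par : Fin n → Fin n) (s : State) : Prop :=
  ∀ u v : Fin n, s.word 8 (u * n + v) = 1 ↔ Anc root par u v

/-- In the order of discovery the column of `par v` is complete before the column of `v`, and `u` is
an ancestor of `v` if they are equal or if it is one of `par v`. -/
theorem ancestorProgram_spec (hB : 4 * (n * n) ≤ B) (h0 : s₀.word 0 0 = n)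
    (hs : s.word 0 = s₀.word 0) (hT : SearchTree G root par idx ord s) {Q : State → Prop}
    (hQ : ∀ s', s'.word 0 = s₀.word 0 → Frame [20, 21, 25, 8] [] s s' → HasAnc root par s' → Q s') :
    Tri B s₀ ancestorProgram s Q := by
  have hnn : n ≤ n * n := Nat.le_mul_self n
  have hn : 0 < n := root.pos
  have hvr : ∀ v : Fin n, (v : ℕ) = 0 ↔ v = root := fun v => by rw [Fin.ext_iff, hT.root_eq]
  refine Tri.forTo (N := n) (fun k s' => ∀ u v : Fin n, idx v < k →
    (s'.word 8 (u * n + v) = 1 ↔ Anc root par u v)) hs (fun s' h => by simp [WExpr.eval, h, h0])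
    (by omega) (by norm_num) (by decide) (by decide) (by simp) ?_ ?_
  · intro k hk s1 hs1 hf1 hc1 hI
    have hT1 := hT.frame (hf1.word 4 (by decide)) (hf1.word 5 (by decide)) (hf1.word 6 (by decide))
    have hnk : s1.word 0 0 = n := by rw [hs1, h0]
    have hord := (ord k).2
    have hx := hT.idx_ord k hk
    refine Tri.seq (Tri.setWord (by simp only [WExpr.eval, hc1, hT1.ord_eq]; omega) ?_)
    simp only [WExpr.eval, hc1, hT1.ord_eq]
    refine Tri.forTo (N := n) (fun j s' => (∀ u v : Fin n, idx v < k →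
      (s'.word 8 (u * n + v) = 1 ↔ Anc root par u v)) ∧ ∀ u : Fin n, (u : ℕ) < j →
      (s'.word 8 (u * n + ord k) = 1 ↔ Anc root par u (ord k))) ?_
      (fun s' h => by simp [WExpr.eval, h, h0]) (by omega) (by norm_num) (by decide) (by decide)
      ⟨?_, ?_⟩ ?_ ?_
    · funext i; simp [State.putWord_word, hs1]
    · intro u v huv
      simp [State.putWord_word, hI u v huv]
    · simp
    · rintro j hj s2 hs2 hf2 hc2 ⟨hJ1, hJ2⟩
      have hn2 : s2.word 0 0 = n := by rw [hs2, h0]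
      have h25 : s2.word 25 0 = ord k := by
        rw [hf2.word 25 (by decide)]; simp [State.putWord_word]
      have h6 : ∀ v : Fin n, s2.word 6 v = par v := fun v => by
        rw [hf2.word 6 (by decide)]; simp [State.putWord_word, hT1.par_eq]
      have key : ∀ x ≤ 1, (x = 1 ↔ Anc root par ⟨j, hj⟩ (ord k)) →
          (∀ u v : Fin n, idx v < k → (((s2.putWord 8 (j * n + ord k) x).putWord 21 0 (j + 1)).word 8
            (u * n + v) = 1 ↔ Anc root par u v)) ∧ ∀ u : Fin n, (u : ℕ) < j + 1 →
            (((s2.putWord 8 (j * n + ord k) x).putWord 21 0 (j + 1)).word 8 (u * n + ord k) = 1 ↔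
              Anc root par u (ord k)) := by
        intro x _ hx1
        constructor
        · intro u v huv
          have hne : ¬ ((u : ℕ) * n + v = j * n + ord k) := by
            rw [mul_add_inj v.2 hord]
            rintro ⟨-, h⟩
            rw [Fin.ext h] at huv
            omega
          simp only [State.putWord_word, hne, Nat.reduceEqDiff, false_and, and_false, if_false]
          exact hJ1 u v huv
        · intro u hu
          simp only [State.putWord_word, Nat.reduceEqDiff, false_and, if_false, true_and,
            mul_add_inj hord hord, and_true]
          split_ifs with h
          · rw [hx1]
            have : u = ⟨j, hj⟩ := Fin.ext h
            rw [this]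
          · exact hJ2 u (by omega)
      have hanc := hJ1 ⟨j, hj⟩ (par (ord k))
      refine Tri.ite (fun hb => ?_) (fun hb => Tri.ite (fun hb2 => ?_) (fun hb2 => ?_))
      all_goals
        simp only [Test.holds, WExpr.eval, hc2, h25] at hb
        refine Tri.setWord (by simp only [WExpr.eval]; omega) ?_
        simp only [WExpr.eval, hc2, h25, hn2]
        refine key _ (by omega) ?_
      · have : (⟨j, hj⟩ : Fin n) = ord k := Fin.ext hb
        simp only [this, true_iff]
        exact Relation.ReflTransGen.refl
      all_goals
        simp only [Test.holds, WExpr.eval, hc2, h25, h6, hn2, hvr] at hb2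
      · simp only [true_iff]
        have hlt := hT.isDFSTree.idx_par _ hb2.1
        exact IsDFSTree.anc_par hb2.1 ((hanc (by omega)).1 hb2.2)
      · simp only [zero_ne_one, false_iff]
        intro h
        rcases IsDFSTree.anc_cases h with h | ⟨h1, h2⟩
        · exact hb (by rw [← h])
        · have hlt := hT.isDFSTree.idx_par _ h1
          exact hb2 ⟨h1, (hanc (by omega)).2 h2⟩
    · rintro s2 hs2 hf2 ⟨hJ1, hJ2⟩ u v huv
      have h8 : ∀ i, (s2.putWord 20 0 (k + 1)).word 8 i = s2.word 8 i := fun i => by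
        simp [State.putWord_word]
      rw [h8]
      rcases Nat.lt_succ_iff_lt_or_eq.1 huv with h | h
      · exact hJ1 u v h
      · have : v = ord k := by rw [← hT.ord_idx v, h]
        rw [this]
        exact hJ2 u u.2
  · intro s1 hs1 hf1 hI
    exact hQ s1 hs1 (hf1.mono (by decide) (by decide)) fun u v => hI u v (hT.idx_lt v)

/-- The upper ends of the edges that are not in the tree, plus one, in array `9`. -/
def backProgram : Program :=
  .forTo 20 .order (.seq
    (.scan 21 22 (.and (.wordEq (.entry 3 (.var 21) (.var 20)) (.lit 1))
      (.and (.wordEq (.entry 8 (.var 21) (.var 20)) (.lit 1))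
        (.not (.wordEq (.get 6 (.var 20)) (.var 21))))) (.add (.var 21) (.lit 1)))
    (.setWord 9 (.var 20) (.var 22)))

/-- The edge between `a` and `z` is not in the tree and `a` is the upper end. -/
def IsBack (G : SimpleGraph (Fin n)) (root : Fin n) (par : Fin n → Fin n) (z a : Fin n) : Prop :=
  G.Adj a z ∧ Anc root par a z ∧ par z ≠ a

theorem backProgram_spec (hB : 4 * (n * n) ≤ B) (h0 : s₀.word 0 0 = n)
    (hs : s.word 0 = s₀.word 0) (hA : HasAdj G s) (hT : SearchTree G root par idx ord s)
    (hAn : HasAnc root par s) {Q : State → Prop}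
    (hQ : ∀ s', s'.word 0 = s₀.word 0 → Frame [20, 21, 22, 9] [] s s' →
      (∀ z : Fin n, (∃ a, IsBack G root par z a ∧ s'.word 9 z = a + 1) ∨
        ((∀ a, ¬ IsBack G root par z a) ∧ s'.word 9 z = 0)) → Q s') :
    Tri B s₀ backProgram s Q := by
  have hnn : n ≤ n * n := Nat.le_mul_self n
  have hn : 0 < n := root.pos
  refine Tri.each (N := n) [9] [] id (fun s i => s.word 9 i) (fun s s' i h => h.1 9 (by simp))
    (fun k x => ∀ hk : k < n, (∃ a, IsBack G root par ⟨k, hk⟩ a ∧ x = a + 1) ∨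
        ((∀ a, ¬ IsBack G root par ⟨k, hk⟩ a) ∧ x = 0)) (fun _ _ _ _ h => h) hs
    (fun s' h => by simp [WExpr.eval, h, h0]) (by omega) (by norm_num) (by decide) (by decide)
    (by decide) ?_ ?_
  · intro k hk s1 hs1 hf1 hc1
    have hn1 : s1.word 0 0 = n := by rw [hs1, h0]
    have h3 := hf1.word 3 (by decide)
    have h8 := hf1.word 8 (by decide)
    have h6 := hf1.word 6 (by decide)
    refine Tri.seq (Tri.find (N := n) (fun j => ∃ hj : j < n, IsBack G root par ⟨k, hk⟩ ⟨j, hj⟩)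
      (fun j => j + 1) hs1 h0 (by omega) (by norm_num) (by norm_num) (by norm_num) ?_ ?_)
    · intro j hj s2 hf2 hc2
      refine ⟨?_, fun _ => ⟨by simp [WExpr.eval, hc2], by omega⟩⟩
      have e1 := hA ⟨j, hj⟩ ⟨k, hk⟩
      have e2 := hAn ⟨j, hj⟩ ⟨k, hk⟩
      have e3 := hT.par_eq ⟨k, hk⟩
      simp only [Test.holds, WExpr.eval, hf2.word 3 (by decide), hf2.word 8 (by decide),
        hf2.word 6 (by decide), hf2.word 0 (by decide), hf2.word 20 (by decide), hc2, hc1, hn1,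
        h3, h8, h6]
      simp only at e1 e2 e3
      rw [e1, e2, e3]
      simp only [hj, exists_true_left, IsBack, ne_eq, Fin.ext_iff]
    · intro s2 hs2 hf2 hx
      have h20 : s2.word 20 0 = k := by rw [hf2.word 20 (by decide), hc1]
      refine Tri.setWord ?_ ⟨?_, ?_⟩
      · simp only [WExpr.eval]
        rcases hx with ⟨j, hj, -, hx⟩ | ⟨-, hx⟩ <;> omega
      · intro _
        simp only [WExpr.eval, h20, State.putWord_word, id, true_and, if_true]
        rcases hx with ⟨j, hj, ⟨_, h⟩, hx⟩ | ⟨h, hx⟩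
        · exact Or.inl ⟨⟨j, hj⟩, h, hx⟩
        · exact Or.inr ⟨fun a ha => h a a.2 ⟨a.2, ha⟩, hx⟩
      · intro i hi
        simp only [id] at hi
        simp only [Agree, List.mem_singleton, forall_eq, List.not_mem_nil, false_imp_iff,
          implies_true, and_true, WExpr.eval, h20, State.putWord_word, hi, and_false, if_false]
        rw [hf2.word 9 (by decide)]
  · intro F hF hf h
    exact hQ F hF (hf.mono (by decide) (by decide)) fun z => h z z.2 z.2

/-- The tops of the blocks in array `7`. -/
def topProgram : Program :=
  .forTo 20 .order (.seq
    (.scan 21 22 (.and (.not (.wordEq (.get 9 (.var 21)) (.lit 0)))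
      (.and (.wordEq (.entry 8 (.var 20) (.var 21)) (.lit 1))
        (.wordEq (.entry 8 (.sub (.get 9 (.var 21)) (.lit 1)) (.get 6 (.var 20))) (.lit 1))))
      (.get 9 (.var 21)))
    (.ite (.wordEq (.var 22) (.lit 0))
      (.setWord 7 (.var 20) (.get 6 (.var 20)))
      (.setWord 7 (.var 20) (.sub (.var 22) (.lit 1)))))

/-- One number per vertex records all back edges, because by `Covers.unique` a vertex is the lower
end of at most one. A scan over the lower ends thus finds the cover of a tree edge if it exists. -/
theorem topProgram_spec (hG : IsCactus G) (hB : 4 * (n * n) ≤ B) (h0 : s₀.word 0 0 = n)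
    (hs : s.word 0 = s₀.word 0) (hT : SearchTree G root par idx ord s)
    (hAn : HasAnc root par s) (hBk : ∀ z : Fin n, (∃ a, IsBack G root par z a ∧ s.word 9 z = a + 1) ∨
        ((∀ a, ¬ IsBack G root par z a) ∧ s.word 9 z = 0)) {Q : State → Prop}
    (hQ : ∀ s', s'.word 0 = s₀.word 0 → Frame [20, 21, 22, 7] [] s s' →
      (∃ top : Fin n → Fin n, BlockTree G root par top idx ∧ ∀ v : Fin n, s'.word 7 v = top v) →
      Q s') :
    Tri B s₀ topProgram s Q := by
  have hnn : n ≤ n * n := Nat.le_mul_self n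
  have hn : 0 < n := root.pos
  have hback : ∀ z a, IsBack G root par z a → Covers G root par z a z := by
    rintro z a ⟨h1, h2, h3⟩
    rcases IsDFSTree.anc_cases h2 with h4 | ⟨h4, h5⟩
    · exact absurd h4 h1.ne
    · exact ⟨h1, h3, h4, h5, Relation.ReflTransGen.refl⟩
  have hcov : ∀ {z a v}, Covers G root par z a v → IsBack G root par z a := by
    intro z a v h
    exact ⟨h.adj, (IsDFSTree.anc_par h.ne_root h.anc_left).trans h.anc_right, h.par_ne⟩
  refine Tri.each (N := n) [7] [] id (fun s i => s.word 7 i) (fun s s' i h => h.1 7 (by simp))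
    (fun k x => ∀ hk : k < n, ∃ t : Fin n, x = t ∧ ((⟨k, hk⟩ : Fin n) ≠ root →
      (∃ z, Covers G root par z t ⟨k, hk⟩) ∨
        (t = par ⟨k, hk⟩ ∧ ∀ z a, ¬ Covers G root par z a ⟨k, hk⟩))) (fun _ _ _ _ h => h) hs
    (fun s' h => by simp [WExpr.eval, h, h0]) (by omega) (by norm_num) (by decide) (by decide)
    (by decide) ?_ ?_
  · intro k hk s1 hs1 hf1 hc1
    have hn1 : s1.word 0 0 = n := by rw [hs1, h0]
    have h9 := hf1.word 9 (by decide)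
    have h8 := hf1.word 8 (by decide)
    have h6 := hf1.word 6 (by decide)
    have e3 := hT.par_eq ⟨k, hk⟩
    simp only at e3
    refine Tri.seq (Tri.find (N := n) (fun j => ∃ hj : j < n, ∃ a : Fin n,
      IsBack G root par ⟨j, hj⟩ a ∧ s.word 9 j = a + 1 ∧ Anc root par ⟨k, hk⟩ ⟨j, hj⟩ ∧
        Anc root par a (par ⟨k, hk⟩))
      (fun j => s.word 9 j) hs1 h0 (by omega) (by norm_num) (by norm_num) (by norm_num) ?_ ?_)
    · intro j hj s2 hf2 hc2
      refine ⟨?_, ?_⟩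
      · have e2 := hAn ⟨k, hk⟩ ⟨j, hj⟩
        simp only [Test.holds, WExpr.eval, hf2.word 8 (by decide), hf2.word 9 (by decide),
          hf2.word 6 (by decide), hf2.word 0 (by decide), hf2.word 20 (by decide), hc2, hc1, hn1,
          h8, h6, h9, e3]
        simp only at e2
        rw [e2]
        constructor
        · rintro ⟨k1, k2, k3⟩
          rcases hBk ⟨j, hj⟩ with ⟨a, ha, ha'⟩ | ⟨-, ha⟩
          · simp only at ha'
            rw [ha', Nat.add_sub_cancel, hAn] at k3
            exact ⟨hj, a, ha, ha', k2, k3⟩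
          · exact absurd ha k1
        · rintro ⟨_, a, ha, ha', k2, k3⟩
          rw [ha', Nat.add_sub_cancel, hAn]
          exact ⟨Nat.succ_ne_zero _, k2, k3⟩
      · rintro ⟨_, a, _, ha, _⟩
        refine ⟨by simp only [WExpr.eval, hf2.word 9 (by decide), hc2, h9], ?_⟩
        have := a.2
        omega
    · intro s2 hs2 hf2 hx
      have h20 : s2.word 20 0 = k := by rw [hf2.word 20 (by decide), hc1]
      have h62 : s2.word 6 k = par ⟨k, hk⟩ := by rw [hf2.word 6 (by decide), h6, e3]
      have hpk := (par ⟨k, hk⟩).2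
      have hagree : ∀ x, ∀ i, i ≠ k → Agree [7] [] (s2.putWord 7 k x) s1 i := by
        intro x i hi
        simp only [Agree, List.mem_singleton, forall_eq, List.not_mem_nil, false_imp_iff,
          implies_true, and_true, State.putWord_word, hi, and_false, if_false]
        rw [hf2.word 7 (by decide)]
      refine Tri.ite (fun hb => Tri.setWord ?_ ?_) (fun hb => Tri.setWord ?_ ?_)
      · simp only [WExpr.eval, h20, h62]; omega
      · simp only [WExpr.eval, h20, h62]
        have hb : s2.word 22 0 = 0 := hb
        refine ⟨fun _ => ⟨par ⟨k, hk⟩, by simp [State.putWord_word], fun hkr => Or.inr ⟨rfl, ?_⟩⟩,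
          hagree _⟩
        intro z a hza
        have ha := hcov hza
        rcases hx with ⟨j, hj, ⟨_, a', _, h1, _⟩, h2⟩ | ⟨hx, -⟩
        · omega
        · rcases hBk z with ⟨a', ha', hz⟩ | ⟨hz, -⟩
          · have := ((hback z a' ha').unique hG hT.isDFSTree (hback z a ha)).2
            subst this
            exact hx z z.2 ⟨z.2, a', ha', hz, hza.anc_right, hza.anc_left⟩
          · exact hz a ha
      · simp only [WExpr.eval]
        rcases hx with ⟨j, hj, ⟨_, a', _, h1, _⟩, h2⟩ | ⟨-, hx⟩
        · have := a'.2
          omega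
        · omega
      · simp only [WExpr.eval, h20]
        have hb : s2.word 22 0 ≠ 0 := hb
        rcases hx with ⟨j, hj, ⟨_, a, h1, h2, h3, h4⟩, h5⟩ | ⟨-, hx⟩
        · refine ⟨fun _ => ⟨a, by simp [State.putWord_word, h5, h2], fun hkr => Or.inl ⟨⟨j, hj⟩, ?_⟩⟩,
            hagree _⟩
          exact ⟨h1.1, h1.2.2, hkr, h4, h3⟩
        · exact absurd hx hb
  · intro F hF hf h
    choose top h1 h2 using fun v : Fin n => h v v.2 v.2
    exact hQ F hF (hf.mono (by decide) (by decide))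
      ⟨top, hT.isDFSTree.blockTree hG (fun v _ => hT.anc_root v) h2, h1⟩

end

end RealRAM


/-! ## The program: weights and runs -/

namespace RealRAM

/-- The code of a vertex or of nothing. -/
def encode {n : ℕ} (h : Option (Fin n)) : ℕ := h.elim 0 fun x => x + 1

theorem encode_inj {n : ℕ} {h h' : Option (Fin n)} : encode h = encode h' ↔ h = h' := by
  cases h <;> cases h' <;> simp [encode, Fin.ext_iff]

theorem encode_le {n : ℕ} (h : Option (Fin n)) : encode h ≤ n := by
  cases h with
  | none => exact Nat.zero_le _
  | some x => exact x.2

/-- Weights in the real array `5`, sizes of the light children in the real array `6`, and heavy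
children, plus one, in the word array `10`. -/
def weightProgram : Program :=
  .forTo 20 .order (.seq (.setWord 25 (.lit 0) (.get 4 (.sub (.sub .order (.lit 1)) (.var 20))))
    (.seq (.scan 21 22 (.and (.not (.wordEq (.var 21) (.lit 0)))
        (.and (.wordEq (.get 7 (.var 21)) (.var 25))
          (.not (.and (.not (.wordEq (.var 22) (.lit 0)))
            (.not (.realLT (.get 5 (.sub (.var 22) (.lit 1))) (.get 5 (.var 21))))))))
        (.add (.var 21) (.lit 1)))
      (.seq (.scanReal 21 10 (.and (.not (.wordEq (.var 21) (.lit 0)))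
          (.and (.wordEq (.get 7 (.var 21)) (.var 25))
            (.not (.wordEq (.var 22) (.add (.var 21) (.lit 1))))))
          (.add (.get 10 (.lit 0)) (.mul (.ofWord (.lit 200000)) (.get 5 (.var 21)))))
        (.seq (.setWord 10 (.var 25) (.var 22))
          (.seq (.setReal 6 (.var 25) (.get 10 (.lit 0)))
            (.ite (.wordEq (.var 22) (.lit 0))
              (.setReal 5 (.var 25) (.add (.ofWord (.lit 1)) (.get 10 (.lit 0))))
              (.setReal 5 (.var 25) (.add (.add (.ofWord (.lit 1)) (.get 10 (.lit 0)))
                (.get 5 (.sub (.var 22) (.lit 1)))))))))))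

/-- The arrays hold the block structure and the weights of the layout. -/
structure HasTree {n : ℕ} (D : Layout (Fin n)) (ord : ℕ → Fin n) (s : State) : Prop where
  root_eq : (D.root : ℕ) = 0
  par_root : D.par D.root = D.root
  idx_lt : ∀ v, D.idx v < n
  ord_idx : ∀ v, ord (D.idx v) = v
  idx_ord : ∀ k < n, D.idx (ord k) = k
  par_eq : ∀ v : Fin n, s.word 6 v = D.par v
  num_eq : ∀ v : Fin n, s.word 5 v = D.idx v + 1
  ord_eq : ∀ k, s.word 4 k = ord k
  top_eq : ∀ v : Fin n, s.word 7 v = D.top v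
  hv_eq : ∀ v : Fin n, s.word 10 v = encode (D.hv v)
  W_eq : ∀ v : Fin n, s.real 5 v = D.W v
  L_eq : ∀ v : Fin n, s.real 6 v = D.L v

/-- The laws of the weights. -/
structure IsWeighted {V : Type*} [Fintype V] [DecidableEq V] (D : Layout V) : Prop where
  hv_some : ∀ p h, D.hv p = some h →
    h ≠ D.root ∧ D.top h = p ∧ ∀ c, c ≠ D.root → D.top c = p → D.W c ≤ D.W h
  hv_none : ∀ p, D.hv p = none → ∀ c, c ≠ D.root → D.top c ≠ p
  W_eq : ∀ p, D.W p = 1 + D.L p + (D.hv p).elim 0 D.W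
  L_eq : ∀ p, D.L p = ∑ c, if c ≠ D.root ∧ D.top c = p ∧ D.hv p ≠ some c then 200000 * D.W c else 0

/-- The reverse of the order of discovery treats children before their top, so all weights that are
read are final. Heavy children are found by comparing reals. -/
theorem weightProgram_spec {n B : ℕ} {G : SimpleGraph (Fin n)} {s₀ s : State} {root : Fin n}
    {par top : Fin n → Fin n} {idx : Fin n → ℕ} {ord : ℕ → Fin n}
    (hB : 4 * (n * n) ≤ B) (h0 : s₀.word 0 0 = n) (hs : s.word 0 = s₀.word 0)
    (hT : SearchTree G root par idx ord s) (hb : BlockTree G root par top idx)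
    (htop : ∀ v : Fin n, s.word 7 v = top v) {Q : State → Prop}
    (hQ : ∀ s', s'.word 0 = s₀.word 0 → Frame [20, 21, 22, 25, 10] [10, 5, 6] s s' →
      (∃ D : Layout (Fin n), D.root = root ∧ D.par = par ∧ D.top = top ∧ D.idx = idx ∧
        HasTree D ord s' ∧ IsWeighted D) → Q s') :
    Tri B s₀ weightProgram s Q := by
  have hnn : n ≤ n * n := Nat.le_mul_self n
  have hn : 0 < n := root.pos
  have hvr : ∀ v : Fin n, (v : ℕ) = 0 ↔ v = root := fun v => by rw [Fin.ext_iff, hT.root_eq]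
  have hidx_top : ∀ c, c ≠ root → idx (top c) < idx c := by
    intro c hc
    induction hn : idx c using Nat.strong_induction_on generalizing c with
    | _ m ih =>
      have h1 := hb.idx_par c hc
      rcases hb.top_cases c hc with h | ⟨h2, h⟩
      · rw [h]; omega
      · have := ih _ (hn ▸ h1) (par c) h2 rfl
        rw [h]; omega
  refine Tri.pass (N := n) [10] [5, 6] (fun k => ord (n - 1 - k)) (fun k s' s'' =>
    ∃ h : Option (Fin n), s''.word 10 (ord (n - 1 - k)) = encode h ∧
      (∀ x, h = some x → x ≠ root ∧ top x = ord (n - 1 - k) ∧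
        ∀ c, c ≠ root → top c = ord (n - 1 - k) → s'.real 5 c ≤ s'.real 5 x) ∧
      (h = none → ∀ c, c ≠ root → top c ≠ ord (n - 1 - k)) ∧
      s''.real 6 (ord (n - 1 - k)) = (∑ c : Fin n, if c ≠ root ∧ top c = ord (n - 1 - k) ∧
        h ≠ some c then 200000 * s'.real 5 c else 0) ∧
      s''.real 5 (ord (n - 1 - k)) = 1 + s''.real 6 (ord (n - 1 - k)) +
        h.elim 0 fun x => s'.real 5 x) ?_ hs
    (fun s' h => by simp [WExpr.eval, h, h0]) (by omega) (by norm_num) (by decide) (by decide)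
    (by decide) ?_ ?_
  · intro j hj k hk hjk
    have := hT.ord_inj _ (show n - 1 - j < n by omega) _ (show n - 1 - k < n by omega) hjk
    omega
  · intro k hk s1 hs1 hf1 hc1
    have hn1 : s1.word 0 0 = n := by rw [hs1, h0]
    have h4 : s1.word 4 (n - 1 - k) = ord (n - 1 - k) := by
      rw [hf1.word 4 (by decide), hT.ord_eq]
    have h7 : ∀ v : Fin n, s1.word 7 v = top v := fun v => by rw [hf1.word 7 (by decide), htop]
    generalize hv : ord (n - 1 - k) = v at *
    refine Tri.seq (Tri.setWord (by simp only [WExpr.eval, hc1, hn1, h4]; omega) ?_)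
    simp only [WExpr.eval, hc1, hn1, h4]
    set s2 := s1.putWord 25 0 v with hs2
    have h25 : s2.word 25 0 = v := by simp [hs2, State.putWord_word]
    have hs20 : s2.word 0 = s₀.word 0 := by funext i; simp [hs2, State.putWord_word, hs1]
    have hf2 : Frame [25] [] s1 s2 := Frame.putWord _ (by simp)
    have h72 : ∀ v : Fin n, s2.word 7 v = top v := fun v => by rw [hf2.word 7 (by decide), h7]
    have h52 : s2.real 5 = s1.real 5 := hf2.real 5 (by decide)
    -- The invariant of a running maximum, with `0` for no child so far and `h + 1` for the best
    -- child.
    refine Tri.seq (Tri.scan (N := n) (fun j x => (x = 0 ∧ ∀ c : Fin n, (c : ℕ) < j → c ≠ root →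
        top c ≠ v) ∨ ∃ h : Fin n, x = h + 1 ∧ h ≠ root ∧ top h = v ∧
        ∀ c : Fin n, (c : ℕ) < j → c ≠ root → top c = v → s1.real 5 c ≤ s1.real 5 h) hs20 h0
      (by omega) (by norm_num) (by norm_num) (by norm_num) (Or.inl ⟨rfl, by simp⟩) ?_ ?_)
    · intro j hj s3 hf3 hc3 hJ
      have e1 : s3.word 7 j = top ⟨j, hj⟩ := by
        rw [hf3.word 7 (by decide)]; exact h72 ⟨j, hj⟩
      have e2 := hvr ⟨j, hj⟩
      simp only [Test.holds, WExpr.eval, RExpr.eval, hc3, e1, hf3.word 25 (by decide), h25,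
        hf3.real 5 (by decide), h52, Fin.val_inj]
      simp only at e2
      rw [e2]
      have hlt : ∀ c : Fin n, (c : ℕ) < j + 1 → (c : ℕ) < j ∨ c = ⟨j, hj⟩ := fun c hc => by
        rcases Nat.lt_succ_iff_lt_or_eq.1 hc with h | h
        exacts [Or.inl h, Or.inr (Fin.ext h)]
      refine ⟨?_, ?_⟩
      · rintro ⟨k1, k2, k3⟩
        refine ⟨by omega, Or.inr ⟨⟨j, hj⟩, rfl, k1, k2, fun c hc hcr hcv => ?_⟩⟩
        rcases hlt c hc with h | rfl
        · rcases hJ with ⟨-, hJ⟩ | ⟨h', hx, -, -, hJ⟩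
          · exact absurd hcv (hJ c h hcr)
          · refine (hJ c h hcr hcv).trans ?_
            rw [hx, Nat.add_sub_cancel] at k3
            by_contra hlt
            exact k3 ⟨Nat.succ_ne_zero _, fun h => hlt h.le⟩
        · exact le_rfl
      · intro hnot
        rcases hJ with ⟨hx, hJ⟩ | ⟨h', hx, h1, h2, hJ⟩
        · refine Or.inl ⟨hx, fun c hc hcr hcv => ?_⟩
          rcases hlt c hc with h | rfl
          · exact hJ c h hcr hcv
          · exact hnot ⟨hcr, hcv, fun h => h.1 hx⟩
        · refine Or.inr ⟨h', hx, h1, h2, fun c hc hcr hcv => ?_⟩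
          rcases hlt c hc with h | rfl
          · exact hJ c h hcr hcv
          · by_contra hlt
            refine hnot ⟨hcr, hcv, fun h => h.2 ?_⟩
            rw [hx, Nat.add_sub_cancel]
            exact not_le.1 hlt
    · intro s3 hs3 hf3 hJ
      obtain ⟨h, hh1, hh2, hh3⟩ : ∃ h : Option (Fin n), s3.word 22 0 = encode h ∧
          (∀ x, h = some x → x ≠ root ∧ top x = v ∧
            ∀ c, c ≠ root → top c = v → s1.real 5 c ≤ s1.real 5 x) ∧
          (h = none → ∀ c, c ≠ root → top c ≠ v) := by
        rcases hJ with ⟨hx, hJ⟩ | ⟨h', hx, h1, h2, hJ⟩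
        · exact ⟨none, hx, by simp, fun _ c => hJ c c.2⟩
        · refine ⟨some h', hx, ?_, by simp⟩
          intro x hx
          obtain rfl := Option.some.inj hx
          exact ⟨h1, h2, fun c => hJ c c.2⟩
      have h73 : ∀ v : Fin n, s3.word 7 v = top v := fun v => by rw [hf3.word 7 (by decide), h72]
      have h53 : s3.real 5 = s1.real 5 := by rw [hf3.real 5 (by decide), h52]
      have h253 : s3.word 25 0 = v := by rw [hf3.word 25 (by decide), h25]
      have hle := encode_le h
      refine Tri.seq (Tri.sum (N := n) (fun j => ∃ hj : j < n, (⟨j, hj⟩ : Fin n) ≠ root ∧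
          top ⟨j, hj⟩ = v ∧ h ≠ some ⟨j, hj⟩) (fun j => 200000 * s1.real 5 j) hs3 h0 (by omega)
          (by norm_num) ?_ ?_)
      · intro j hj s4 hf4 hc4
        have e1 : s4.word 7 j = top ⟨j, hj⟩ := by
          rw [hf4.word 7 (by decide)]; exact h73 ⟨j, hj⟩
        have e2 := hvr ⟨j, hj⟩
        have e3 : encode h = j + 1 ↔ h = some ⟨j, hj⟩ := by
          rw [← encode_inj]; rfl
        simp only at e2
        refine ⟨?_, fun _ => ?_⟩
        · simp only [Test.holds, WExpr.eval, hc4, e1, hf4.word 25 (by decide), h253,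
            hf4.word 22 (by decide), hh1, e2, e3, Fin.val_inj, ne_eq, hj, exists_true_left]
        · simp only [WExpr.eval, RExpr.eval, hc4, hf4.real 5 (by decide), h53]
          norm_num
      · intro s4 hs4 hf4 hsum
        have h224 : s4.word 22 0 = encode h := by rw [hf4.word 22 (by decide), hh1]
        have h254 : s4.word 25 0 = v := by rw [hf4.word 25 (by decide), h253]
        have h54 : s4.real 5 = s1.real 5 := by rw [hf4.real 5 (by decide), h53]
        have h64 : s4.real 6 = s1.real 6 := by
          rw [hf4.real 6 (by decide), hf3.real 6 (by decide), hf2.real 6 (by decide)]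
        have h104 : s4.word 10 = s1.word 10 := by
          rw [hf4.word 10 (by decide), hf3.word 10 (by decide), hf2.word 10 (by decide)]
        rw [Finset.sum_range] at hsum
        simp only [Fin.is_lt, Fin.eta, exists_true_left] at hsum
        refine Tri.seq (Tri.setWord (by simp only [WExpr.eval, h224]; omega)
          (Tri.seq (Tri.setReal (Tri.ite (fun hb => Tri.setReal ?_) (fun hb => Tri.setReal ?_)))))
        all_goals
          simp [Test.holds, WExpr.eval, State.putWord_word, State.putReal_word,
            h224] at hb
          simp only [WExpr.eval, RExpr.eval, State.putWord_word, State.putReal_word,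
            State.putReal_real, State.putWord_real, h224, h254, Nat.reduceEqDiff, false_and,
            if_false, hsum]
          refine ⟨⟨h, ?_, hh2, hh3, ?_, ?_⟩, fun i hi => ⟨?_, ?_⟩⟩
        · simp
        · simp
        · cases h with
          | none => simp
          | some x => simp [encode] at hb
        · simp [State.putWord_word, State.putReal_word, hi, h104]
        · simp [State.putReal_real, State.putWord_real, hi, h54, h64]
        · simp
        · simp
        · cases h with
          | none => simp [encode] at hb
          | some x => simp [encode, h54]
        · simp [State.putWord_word, State.putReal_word, hi, h104]
        · simp [State.putReal_real, State.putWord_real, hi, h54, h64]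
  · intro F hF hf hst
    have hst' : ∀ v : Fin n, ∃ h : Option (Fin n), F.word 10 v = encode h ∧
        (∀ x, h = some x → x ≠ root ∧ top x = v ∧
          ∀ c, c ≠ root → top c = v → F.real 5 c ≤ F.real 5 x) ∧
        (h = none → ∀ c, c ≠ root → top c ≠ v) ∧
        F.real 6 v = (∑ c : Fin n, if c ≠ root ∧ top c = v ∧
          h ≠ some c then 200000 * F.real 5 c else 0) ∧
        F.real 5 v = 1 + F.real 6 v + h.elim 0 fun x => F.real 5 x := by
      intro v
      have hiv := hT.idx_lt v
      obtain ⟨s', s'', -, -, ⟨h, k1, k2, k3, k4, k5⟩, hag, hag'⟩ := hst (n - 1 - idx v) (by omega)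
      have hov : ord (n - 1 - (n - 1 - idx v)) = v := by
        rw [show n - 1 - (n - 1 - idx v) = idx v by omega, hT.ord_idx]
      rw [hov] at k1 k2 k3 k4 k5 hag'
      -- A child has a larger number than `v`, so its cell was filled in an earlier round and is not
      -- changed afterwards.
      have hch : ∀ c, c ≠ root → top c = v → s'.real 5 c = F.real 5 c := by
        intro c hc hcv
        have h1 := hidx_top c hc
        have h2 := hT.idx_lt c
        rw [hcv] at h1
        have := (hag (n - 1 - idx c) (by omega)).2 5 (by simp)
        rwa [show n - 1 - (n - 1 - idx c) = idx c by omega, hT.ord_idx] at this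
      rw [hag'.1 10 (by simp)] at k1
      rw [hag'.2 6 (by simp)] at k4 k5
      rw [hag'.2 5 (by simp)] at k5
      refine ⟨h, k1, fun x hx => ?_, k3, ?_, ?_⟩
      · obtain ⟨h1, h2, h3⟩ := k2 x hx
        refine ⟨h1, h2, fun c hc hcv => ?_⟩
        rw [← hch c hc hcv, ← hch x h1 h2]
        exact h3 c hc hcv
      · rw [k4]
        refine Finset.sum_congr rfl fun c _ => ?_
        split_ifs with hc
        · rw [hch c hc.1 hc.2.1]
        · rfl
      · rw [k5]
        cases h with
        | none => rfl
        | some x =>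
          obtain ⟨h1, h2, -⟩ := k2 x rfl
          simp only [Option.elim_some]
          rw [hch x h1 h2]
    choose hv k1 k2 k3 k4 k5 using hst'
    -- The fields not yet computed get placeholders, which neither `HasTree` nor `IsWeighted`
    -- mentions.
    refine hQ F hF (hf.mono (by decide) (by decide)) ⟨⟨root, par, top, id, id, hv, idx,
      fun v => F.real 5 v, fun v => F.real 6 v, 0, 0, 0, 0, 0, 0, 0, 0⟩, rfl, rfl, rfl, rfl, ?_, ?_⟩
    · have hT' := hT.frame (hf.word 4 (by decide)) (hf.word 5 (by decide)) (hf.word 6 (by decide))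
      exact ⟨hT.root_eq, hT.par_root, hT.idx_lt, hT.ord_idx, hT.idx_ord, hT'.par_eq, hT'.num_eq,
        hT'.ord_eq, fun v => by rw [hf.word 7 (by decide), htop], k1, fun _ => rfl, fun _ => rfl⟩
    · exact ⟨fun p => k2 p, k3, k5, k4⟩

end RealRAM


/-! ### Starts of blocks and runs, and generic loops for flags and sums -/

namespace RealRAM

section

variable {n B : ℕ} {D : Layout (Fin n)} {ord : ℕ → Fin n} {s₀ s : State}

theorem HasTree.frame {s' : State} {A R : List ℕ} (h : HasTree D ord s) (hf : Frame A R s s')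
    (hA : ∀ a ∈ [4, 5, 6, 7, 10], a ∉ A) (hR : ∀ a ∈ [5, 6], a ∉ R) : HasTree D ord s' :=
  { h with
    par_eq := fun v => by rw [hf.word 6 (hA 6 (by simp)), h.par_eq]
    num_eq := fun v => by rw [hf.word 5 (hA 5 (by simp)), h.num_eq]
    ord_eq := fun v => by rw [hf.word 4 (hA 4 (by simp)), h.ord_eq]
    top_eq := fun v => by rw [hf.word 7 (hA 7 (by simp)), h.top_eq]
    hv_eq := fun v => by rw [hf.word 10 (hA 10 (by simp)), h.hv_eq]
    W_eq := fun v => by rw [hf.real 5 (hR 5 (by simp)), h.W_eq]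
    L_eq := fun v => by rw [hf.real 6 (hR 6 (by simp)), h.L_eq] }

theorem HasTree.val_eq_zero (h : HasTree D ord s) (v : Fin n) : (v : ℕ) = 0 ↔ v = D.root := by
  rw [Fin.ext_iff, h.root_eq]

theorem HasTree.ord_inj (h : HasTree D ord s) :
    ∀ j < n, ∀ k < n, (ord j : ℕ) = ord k → j = k := fun j hj k hk hjk => by
  rw [← h.idx_ord j hj, ← h.idx_ord k hk, Fin.ext hjk]

/-- Heavy vertices. -/
def heavyTest (e : WExpr) : Test :=
  .and (.not (.wordEq e (.lit 0))) (.wordEq (.get 10 (.get 7 e)) (.add e (.lit 1)))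

/-- Light vertices. -/
def lightTest (e : WExpr) : Test :=
  .and (.not (.wordEq e (.lit 0))) (.not (.wordEq (.get 10 (.get 7 e)) (.add e (.lit 1))))

/-- First vertices of runs. -/
def firstTest (e : WExpr) : Test :=
  .not (.and (.not (.wordEq (.get 6 e) (.get 7 e))) (.not (heavyTest (.get 6 e))))

theorem HasTree.heavyTest_iff (h : HasTree D ord s) {e : WExpr} {v : Fin n} (he : e.eval s = v) :
    (heavyTest e).holds s ↔ D.Heavy v := by
  have : encode (D.hv (D.top v)) = v + 1 ↔ D.hv (D.top v) = some v := by rw [← encode_inj]; rfl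
  simp only [heavyTest, Test.holds, WExpr.eval, he, h.top_eq, h.hv_eq, this, h.val_eq_zero,
    Layout.Heavy, ne_eq]

theorem HasTree.lightTest_iff (h : HasTree D ord s) {e : WExpr} {v : Fin n} (he : e.eval s = v) :
    (lightTest e).holds s ↔ D.Light v := by
  have : encode (D.hv (D.top v)) = v + 1 ↔ D.hv (D.top v) = some v := by rw [← encode_inj]; rfl
  simp only [lightTest, Test.holds, WExpr.eval, he, h.top_eq, h.hv_eq, this, h.val_eq_zero,
    Layout.Light, ne_eq]

theorem HasTree.firstTest_iff (h : HasTree D ord s) {e : WExpr} {v : Fin n} (he : e.eval s = v) :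
    (firstTest e).holds s ↔ D.First v := by
  have h1 := h.heavyTest_iff (e := .get 6 e) (v := D.par v) (by rw [WExpr.eval, he, h.par_eq])
  simp only [firstTest, Test.holds, WExpr.eval, he, h.par_eq, h.top_eq, h1, Layout.First,
    Fin.val_inj]
  tauto

/-- Remainder modulo the number of vertices. -/
def WExpr.modOrder (e : WExpr) : WExpr := .sub e (.mul (.div e .order) .order)

theorem WExpr.modOrder_eval {e : WExpr} (h0 : s.word 0 0 = n) : e.modOrder.eval s = e.eval s % n := by
  simp only [modOrder, eval, h0, Nat.mod_eq_sub_div_mul]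

/-- The first vertices of blocks in array `11` and those of runs in array `12`. -/
def runProgram : Program :=
  .forTo 20 .order (.seq (.setWord 25 (.lit 0) (.get 4 (.var 20)))
    (.ite (.wordEq (.var 25) (.lit 0))
      (.seq (.setWord 11 (.var 25) (.lit 0)) (.setWord 12 (.var 25) (.lit 0)))
      (.seq (.ite (.wordEq (.get 6 (.var 25)) (.get 7 (.var 25)))
          (.setWord 11 (.var 25) (.var 25))
          (.setWord 11 (.var 25) (WExpr.modOrder (.get 11 (.get 6 (.var 25))))))
        (.ite (firstTest (.var 25))
          (.setWord 12 (.var 25) (.var 25))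
          (.setWord 12 (.var 25) (WExpr.modOrder (.get 12 (.get 6 (.var 25)))))))))

open Classical in
-- The remainder modulo `n` makes each stored word visibly small within its own round, without
-- knowledge of what earlier rounds stored. In the final memory all entries are below `n`, so it
-- changes nothing.
theorem runProgram_spec (hB : 4 * (n * n) ≤ B) (h0 : s₀.word 0 0 = n) (hs : s.word 0 = s₀.word 0)
    (hT : HasTree D ord s) (hidx : ∀ v, v ≠ D.root → D.idx (D.par v) < D.idx v) {Q : State → Prop}
    (hQ : ∀ s', s'.word 0 = s₀.word 0 → Frame [20, 25, 11, 12] [] s s' →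
      (∃ blk sg : Fin n → Fin n, (∀ v : Fin n, s'.word 11 v = blk v) ∧
        (∀ v : Fin n, s'.word 12 v = sg v) ∧
        (∀ v, v ≠ D.root → blk v = if D.par v = D.top v then v else blk (D.par v)) ∧
        (∀ v, v ≠ D.root → sg v = if D.First v then v else sg (D.par v))) → Q s') :
    Tri B s₀ runProgram s Q := by
  have hnn : n ≤ n * n := Nat.le_mul_self n
  have hn : 0 < n := D.root.pos
  refine Tri.pass (N := n) [11, 12] [] (fun k => ord k) (fun k s' s'' =>
    s''.word 11 (ord k) = (if ord k = D.root then 0 else if D.par (ord k) = D.top (ord k) then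
      (ord k : ℕ) else s'.word 11 (D.par (ord k)) % n) ∧
    s''.word 12 (ord k) = (if ord k = D.root then 0 else if D.First (ord k) then
      (ord k : ℕ) else s'.word 12 (D.par (ord k)) % n)) hT.ord_inj hs
    (fun s' h => by simp [WExpr.eval, h, h0]) (by omega) (by norm_num) (by decide) (by decide)
    (by decide) ?_ ?_
  · intro k hk s1 hs1 hf1 hc1
    have hT1 := hT.frame hf1 (by decide) (by decide)
    generalize hv : ord k = v at *
    have hvn := v.2
    refine Tri.seq (Tri.setWord (by simp only [WExpr.eval, hc1, hT1.ord_eq, hv]; omega) ?_)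
    simp only [WExpr.eval, hc1, hT1.ord_eq, hv]
    set s2 := s1.putWord 25 0 v with hs2
    have h25 : s2.word 25 0 = v := by simp [hs2, State.putWord_word]
    have hf2 : Frame [25] [] s1 s2 := Frame.putWord _ (by simp)
    have hT2 := hT1.frame hf2 (by decide) (by decide)
    have h02 : s2.word 0 0 = n := by rw [hf2.word 0 (by decide), hs1, h0]
    have h11 := hf2.word 11 (by decide)
    have h12 := hf2.word 12 (by decide)
    refine Tri.ite (fun hb => ?_) (fun hb => ?_)
    all_goals simp only [Test.holds, WExpr.eval, h25, hT2.val_eq_zero] at hb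
    · refine Tri.seq (Tri.setWord (Nat.zero_le _) (Tri.setWord (Nat.zero_le _) ?_))
      simp only [WExpr.eval, State.putWord_word, h25, hb, Nat.reduceEqDiff, false_and, if_false,
        if_true, and_true]
      refine ⟨trivial, fun i hi => ⟨?_, by simp⟩⟩
      simp [State.putWord_word, hi, h11, h12]
    · have step2 : ∀ (s3 : State) x, Frame [11] [] s2 s3 → s3.word 11 v = x →
          (∀ i : ℕ, i ≠ v → s3.word 11 i = s2.word 11 i) →
          Tri B s₀ (.ite (firstTest (.var 25)) (.setWord 12 (.var 25) (.var 25))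
            (.setWord 12 (.var 25) (WExpr.modOrder (.get 12 (.get 6 (.var 25)))))) s3 fun s'' =>
            (s''.word 11 v = x ∧ s''.word 12 v = (if v = D.root then 0 else if D.First v then
              (v : ℕ) else s1.word 12 (D.par v) % n)) ∧
            ∀ i : ℕ, i ≠ v → Agree [11, 12] [] s'' s1 i := by
        intro s3 x hf3 hx hi3
        have hT3 := hT2.frame hf3 (by decide) (by decide)
        have h253 : (WExpr.var 25).eval s3 = v := by
          simp only [WExpr.eval, hf3.word 25 (by decide), h25]
        have h03 : s3.word 0 0 = n := by rw [hf3.word 0 (by decide), h02]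
        have h123 : s3.word 12 = s1.word 12 := by rw [hf3.word 12 (by decide), h12]
        have hfirst := hT3.firstTest_iff h253
        have hm : (WExpr.modOrder (.get 12 (.get 6 (.var 25)))).eval s3 =
            s1.word 12 (D.par v) % n := by
          rw [WExpr.modOrder_eval h03, WExpr.eval, WExpr.eval, h253, hT3.par_eq, h123]
        have hmod := Nat.mod_lt (s1.word 12 (D.par v)) hn
        refine Tri.ite (fun hb2 => Tri.setWord ?_ ?_) (fun hb2 => Tri.setWord ?_ ?_)
        · rw [h253]; omega
        · rw [h253]
          rw [hfirst] at hb2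
          refine ⟨⟨?_, ?_⟩, fun i hi => ⟨?_, by simp⟩⟩
          · simp [State.putWord_word, hx]
          · simp [State.putWord_word, hb, hb2]
          · simp [State.putWord_word, hi, h11, h123, hi3]
        · rw [hm]; omega
        · rw [h253, hm]
          rw [hfirst] at hb2
          refine ⟨⟨?_, ?_⟩, fun i hi => ⟨?_, by simp⟩⟩
          · simp [State.putWord_word, hx]
          · simp [State.putWord_word, hb, hb2]
          · simp [State.putWord_word, hi, h11, h123, hi3]
      have hm : (WExpr.modOrder (.get 11 (.get 6 (.var 25)))).eval s2 =
          s1.word 11 (D.par v) % n := by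
        rw [WExpr.modOrder_eval h02]
        simp only [WExpr.eval, h25, hT2.par_eq, h11]
      have hmod := Nat.mod_lt (s1.word 11 (D.par v)) hn
      refine Tri.seq (Tri.ite (fun hb2 => Tri.setWord ?_ ?_) (fun hb2 => Tri.setWord ?_ ?_))
      all_goals
        simp only [Test.holds, WExpr.eval, h25, hT2.par_eq, hT2.top_eq, Fin.val_inj] at hb2
      · simp only [WExpr.eval, h25]; omega
      · simp only [WExpr.eval, h25]
        refine step2 _ _ (Frame.putWord _ (by simp)) ?_ ?_
        · simp [State.putWord_word, hb, hb2]
        · intro i hi; simp [State.putWord_word, hi]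
      · rw [hm]; omega
      · rw [hm]
        simp only [WExpr.eval, h25]
        refine step2 _ _ (Frame.putWord _ (by simp)) ?_ ?_
        · simp [State.putWord_word, hb, hb2]
        · intro i hi; simp [State.putWord_word, hi]
  · intro F hF hf hst
    have hst' : ∀ v : Fin n,
        F.word 11 v = (if v = D.root then 0 else if D.par v = D.top v then
          (v : ℕ) else F.word 11 (D.par v) % n) ∧
        F.word 12 v = (if v = D.root then 0 else if D.First v then
          (v : ℕ) else F.word 12 (D.par v) % n) := by
      intro v
      obtain ⟨s', s'', -, -, ⟨k1, k2⟩, hag, hag'⟩ := hst (D.idx v) (hT.idx_lt v)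
      rw [hT.ord_idx] at k1 k2 hag'
      rw [hag'.1 11 (by simp)] at k1
      rw [hag'.1 12 (by simp)] at k2
      rw [k1, k2]
      by_cases hv : v = D.root
      · simp [hv]
      · have := hag _ (hidx v hv)
        rw [hT.ord_idx] at this
        rw [this.1 11 (by simp), this.1 12 (by simp)]
        exact ⟨rfl, rfl⟩
    refine hQ F hF (hf.mono (by decide) (by decide))
      ⟨fun v => ⟨F.word 11 v % n, Nat.mod_lt _ hn⟩, fun v => ⟨F.word 12 v % n, Nat.mod_lt _ hn⟩,
        fun v => ?_, fun v => ?_, fun v hv => ?_, fun v hv => ?_⟩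
    · refine (Nat.mod_eq_of_lt ?_).symm
      rw [(hst' v).1]
      split_ifs
      exacts [hn, v.2, Nat.mod_lt _ hn]
    · refine (Nat.mod_eq_of_lt ?_).symm
      rw [(hst' v).2]
      split_ifs
      exacts [hn, v.2, Nat.mod_lt _ hn]
    · have := (hst' v).1
      rw [if_neg hv] at this
      apply Fin.ext
      simp only [this]
      split_ifs <;> simp [Nat.mod_eq_of_lt]
    · have := (hst' v).2
      rw [if_neg hv] at this
      apply Fin.ext
      simp only [this]
      split_ifs <;> simp [Nat.mod_eq_of_lt]

/-- Marks in array `a` the vertices for which the search with test `T` succeeds. -/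
def flagProgram (a : ℕ) (T : Test) : Program :=
  .forTo 20 .order (.seq (.scan 21 22 T (.lit 1)) (.setWord a (.var 20) (.var 22)))

theorem flagProgram_spec {a : ℕ} {T : Test} (ha : a ≠ 0 ∧ a ≠ 20 ∧ a ≠ 21 ∧ a ≠ 22)
    (hB : 4 * (n * n) ≤ B) (h0 : s₀.word 0 0 = n) (hs : s.word 0 = s₀.word 0)
    (τ : Fin n → Fin n → Prop)
    (hT : ∀ (v j : Fin n) s', Frame [20, 21, 22, a] [] s s' → s'.word 20 0 = v → s'.word 21 0 = j →
      (T.holds s' ↔ τ v j)) {Q : State → Prop}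
    (hQ : ∀ s', s'.word 0 = s₀.word 0 → Frame [20, 21, 22, a] [] s s' →
      (∀ v : Fin n, s'.word a v = 0 ↔ ∀ j, ¬ τ v j) → Q s') :
    Tri B s₀ (flagProgram a T) s Q := by
  obtain ⟨ha0, ha1, ha2, ha3⟩ := ha
  have hnn : n ≤ n * n := Nat.le_mul_self n
  have hw : (Program.seq (.scan 21 22 T (.lit 1)) (.setWord a (.var 20) (.var 22))).wordWrites ⊆
      [20, 21, 22, a] := by
    simp [Program.wordWrites, Program.scan, Program.forTo]
  refine Tri.each (N := n) [a] [] id (fun s i => s.word a i) (fun s s' i h => h.1 a (by simp))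
    (fun k x => ∀ hk : k < n, x = 0 ↔ ∀ j, ¬ τ ⟨k, hk⟩ j) (fun _ _ _ _ h => h) hs
    (fun s' h => by simp [WExpr.eval, h, h0]) (by omega) (by norm_num)
    (by simp [Program.wordWrites, Program.scan, Program.forTo, ha0.symm])
    (by simp [Program.wordWrites, Program.scan, Program.forTo, ha1.symm]) (by simp [ha1.symm]) ?_ ?_
  · intro k hk s1 hs1 hf1 hc1
    have hf1' : Frame [20, 21, 22, a] [] s s1 := hf1.mono
      (List.cons_subset.2 ⟨by simp, hw⟩) (by simp [Program.realWrites, Program.scan, Program.forTo])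
    refine Tri.seq (Tri.find (N := n) (fun j => ∃ hj : j < n, τ ⟨k, hk⟩ ⟨j, hj⟩) (fun _ => 1)
      hs1 h0 (by omega) (by norm_num) (by norm_num) (by norm_num) ?_ ?_)
    · intro j hj s2 hf2 hc2
      refine ⟨?_, fun _ => ⟨rfl, by omega⟩⟩
      rw [hT ⟨k, hk⟩ ⟨j, hj⟩ s2 (hf1'.trans (hf2.mono (by simp) (by simp)))
        (by rw [hf2.word 20 (by decide), hc1]) hc2]
      simp [hj]
    · intro s2 hs2 hf2 hx
      have h20 : s2.word 20 0 = k := by rw [hf2.word 20 (by decide), hc1]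
      refine Tri.setWord ?_ ⟨fun _ => ?_, fun i hi => ⟨?_, by simp⟩⟩
      · simp only [WExpr.eval]
        rcases hx with ⟨j, hj, _, hx⟩ | ⟨_, hx⟩ <;> omega
      · simp only [WExpr.eval, State.putWord_word, h20, id, and_self, if_true]
        rcases hx with ⟨j, hj, ⟨_, h⟩, hx⟩ | ⟨h, hx⟩
        · rw [hx]
          exact ⟨fun h => absurd h one_ne_zero, fun h' => absurd h (h' _)⟩
        · exact ⟨fun _ j hj => h j j.2 ⟨j.2, hj⟩, fun _ => hx⟩
      · have : s2.word a = s1.word a := hf2.word a (by simp [ha2, ha3])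
        simp only [id] at hi
        simp [State.putWord_word, WExpr.eval, h20, hi, this]
  · intro F hF hf h
    exact hQ F hF (hf.mono (List.cons_subset.2 ⟨by simp, hw⟩)
      (by simp [Program.realWrites, Program.scan, Program.forTo])) fun v => h v v.2 v.2

/-- Sums `e` over the vertices that pass the test `T` into the real array `a`. -/
def sumProgram (a : ℕ) (T : Test) (e : RExpr) : Program :=
  .forTo 20 .order (.seq (.scanReal 21 10 T (.add (.get 10 (.lit 0)) e))
    (.setReal a (.var 20) (.get 10 (.lit 0))))

open Classical in
theorem sumProgram_spec {a : ℕ} {T : Test} {e : RExpr} (ha : a ≠ 10)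
    (hB : 4 * (n * n) ≤ B) (h0 : s₀.word 0 0 = n) (hs : s.word 0 = s₀.word 0)
    (τ : Fin n → Fin n → Prop) (ε : Fin n → ℝ)
    (hT : ∀ (v j : Fin n) s', Frame [20, 21] [10, a] s s' → s'.word 20 0 = v → s'.word 21 0 = j →
      (T.holds s' ↔ τ v j) ∧ e.eval s' = ε j) {Q : State → Prop}
    (hQ : ∀ s', s'.word 0 = s₀.word 0 → Frame [20, 21] [10, a] s s' →
      (∀ v : Fin n, s'.real a v = ∑ j, if τ v j then ε j else 0) → Q s') :
    Tri B s₀ (sumProgram a T e) s Q := by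
  have hnn : n ≤ n * n := Nat.le_mul_self n
  have hw : (Program.seq (.scanReal 21 10 T (.add (.get 10 (.lit 0)) e))
      (.setReal a (.var 20) (.get 10 (.lit 0)))).realWrites ⊆ [10, a] := by
    simp [Program.realWrites, Program.scanReal, Program.forTo]
  have hw' : (Program.seq (.scanReal 21 10 T (.add (.get 10 (.lit 0)) e))
      (.setReal a (.var 20) (.get 10 (.lit 0)))).wordWrites ⊆ [20, 21] := by
    simp [Program.wordWrites, Program.scanReal, Program.forTo]
  refine Tri.each (N := n) [] [a] id (fun s i => s.real a i) (fun s s' i h => h.2 a (by simp))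
    (fun k x => ∀ hk : k < n, x = ∑ j, if τ ⟨k, hk⟩ j then ε j else 0) (fun _ _ _ _ h => h) hs
    (fun s' h => by simp [WExpr.eval, h, h0]) (by omega) (by norm_num)
    (by simp [Program.wordWrites, Program.scanReal, Program.forTo])
    (by simp [Program.wordWrites, Program.scanReal, Program.forTo]) (by simp) ?_ ?_
  · intro k hk s1 hs1 hf1 hc1
    have hf1' : Frame [20, 21] [10, a] s s1 := hf1.mono (List.cons_subset.2 ⟨by simp, hw'⟩) hw
    refine Tri.seq (Tri.sum (N := n) (fun j => ∃ hj : j < n, τ ⟨k, hk⟩ ⟨j, hj⟩)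
      (fun j => if hj : j < n then ε ⟨j, hj⟩ else 0) hs1 h0 (by omega) (by norm_num) ?_ ?_)
    · intro j hj s2 hf2 hc2
      obtain ⟨h1, h2⟩ := hT ⟨k, hk⟩ ⟨j, hj⟩ s2 (hf1'.trans (hf2.mono (by simp) (by simp)))
        (by rw [hf2.word 20 (by decide), hc1]) hc2
      rw [h1, h2]
      simp [hj]
    · intro s2 hs2 hf2 hx
      have h20 : s2.word 20 0 = k := by rw [hf2.word 20 (by decide), hc1]
      rw [Finset.sum_range] at hx
      simp only [Fin.is_lt, Fin.eta, exists_true_left, dif_pos] at hx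
      refine Tri.setReal ⟨fun _ => ?_, fun i hi => ⟨by simp, ?_⟩⟩
      · simp only [WExpr.eval, RExpr.eval, State.putReal_real, h20, id, and_self, if_true, hx]
      · have : s2.real a = s1.real a := hf2.real a (by simp [ha])
        simp only [id] at hi
        simp [State.putReal_real, WExpr.eval, h20, hi, this]
  · intro F hF hf h
    exact hQ F hF (hf.mono (List.cons_subset.2 ⟨by simp, hw'⟩) hw) fun v => h v v.2 v.2

end

end RealRAM


/-! ## The program: sizes of runs -/

namespace RealRAM

/-- The arrays hold the combinatorial part of the layout. -/
structure HasSizes {n : ℕ} (D : Layout (Fin n)) (ord : ℕ → Fin n) (s : State) : Prop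
    extends HasTree D ord s where
  blk_eq : ∀ v : Fin n, s.word 11 v = D.blk v
  sg_eq : ∀ v : Fin n, s.word 12 v = D.sg v
  last_iff : ∀ v : Fin n, s.word 13 v = 0 ↔ D.Last v
  S_eq : ∀ v : Fin n, s.real 7 v = D.S v
  M_eq : ∀ v : Fin n, s.real 8 v = D.M v
  pre_eq : ∀ v : Fin n, s.real 9 v = D.pre v
  gap_eq : ∀ v : Fin n, s.real 11 v = D.gap v
  pocketLength_eq : ∀ v : Fin n, s.real 12 v = D.pocketLength v
  heavy_eq : ∀ v : Fin n, s.real 13 v = open Classical in if D.Heavy v then 1 else 0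

theorem HasSizes.frame {n : ℕ} {D : Layout (Fin n)} {ord : ℕ → Fin n} {s s' : State} {A R : List ℕ}
    (h : HasSizes D ord s) (hf : Frame A R s s')
    (hA : ∀ a ∈ [4, 5, 6, 7, 10, 11, 12, 13], a ∉ A)
    (hR : ∀ a ∈ [5, 6, 7, 8, 9, 11, 12, 13], a ∉ R) : HasSizes D ord s' :=
  { h.toHasTree.frame hf (fun a ha => hA a (by simp at ha ⊢; omega))
      (fun a ha => hR a (by simp at ha ⊢; omega)) with
    blk_eq := fun v => by rw [hf.word 11 (hA 11 (by simp)), h.blk_eq]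
    sg_eq := fun v => by rw [hf.word 12 (hA 12 (by simp)), h.sg_eq]
    last_iff := fun v => by rw [hf.word 13 (hA 13 (by simp)), h.last_iff]
    S_eq := fun v => by rw [hf.real 7 (hR 7 (by simp)), h.S_eq]
    M_eq := fun v => by rw [hf.real 8 (hR 8 (by simp)), h.M_eq]
    pre_eq := fun v => by rw [hf.real 9 (hR 9 (by simp)), h.pre_eq]
    gap_eq := fun v => by rw [hf.real 11 (hR 11 (by simp)), h.gap_eq]
    pocketLength_eq := fun v => by rw [hf.real 12 (hR 12 (by simp)), h.pocketLength_eq]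
    heavy_eq := fun v => by rw [hf.real 13 (hR 13 (by simp)), h.heavy_eq] }

/-- The vertex `e` has a child `f` in its block. -/
def nextTest (f e : WExpr) : Test :=
  .and (.not (.wordEq f (.lit 0))) (.and (.wordEq (.get 6 f) e) (.not (.wordEq (.get 7 f) e)))

/-- Twice the size of a light vertex. -/
def lightSize (e : WExpr) : RExpr := .mul (.ofWord (.lit 200000)) (.get 5 e)

/-- First vertices of blocks and runs, ends of runs and of blocks, sizes of runs, gaps, and an
indicator of the heavy vertices. -/
def sizeProgram : Program :=
  .seq runProgram <| .seq (flagProgram 13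
    (.and (nextTest (.var 21) (.var 20)) (.not (heavyTest (.var 21))))) <|
  .seq (flagProgram 14 (nextTest (.var 21) (.var 20))) <|
  .seq (sumProgram 7 (.and (lightTest (.var 21)) (.wordEq (.get 12 (.var 21)) (.var 20)))
    (lightSize (.var 21))) <|
  .seq (sumProgram 8 (.and (.and (lightTest (.var 21)) (.and (.not (firstTest (.var 21)))
    (.not (.wordEq (.get 13 (.var 21)) (.lit 0))))) (.wordEq (.get 12 (.var 21)) (.var 20)))
    (lightSize (.var 21))) <|
  .seq (sumProgram 9 (.and (.and (lightTest (.var 21))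
    (.wordEq (.get 7 (.var 21)) (.get 7 (.var 20))))
    (.wordLT (.get 5 (.get 12 (.var 21))) (.get 5 (.var 20)))) (lightSize (.var 21))) <|
  .seq (sumProgram 11 (.and (.wordEq (.var 21) (.var 20))
    (.and (.not (.wordEq (.get 6 (.var 21)) (.get 7 (.var 21))))
      (.not (.wordEq (.get 14 (.var 21)) (.lit 0))))) (.ofWord (.lit 1))) <|
  .seq (sumProgram 12 (.and (.wordEq (.var 21) (.var 20))
      (.not (.wordEq (.get 13 (.var 21)) (.lit 0))))
    (.add (.get 8 (.var 21)) (.mul (.ofWord (.lit 2)) (.get 7 (.var 21))))) <|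
  sumProgram 13 (.and (.wordEq (.var 21) (.var 20)) (heavyTest (.var 21))) (.ofWord (.lit 1))

open Classical in
-- Every quantity is a flag or a sum over all vertices. Gaps, pocket lengths and the indicator of
-- heavy vertices are sums with at most one term, restricted to the vertex itself, so that the same
-- loop computes them.
theorem sizeProgram_spec {n B : ℕ} {G : SimpleGraph (Fin n)} {D : Layout (Fin n)} {ord : ℕ → Fin n}
    {s₀ s : State} (hB : 4 * (n * n) ≤ B) (h0 : s₀.word 0 0 = n) (hs : s.word 0 = s₀.word 0)
    (hT : HasTree D ord s) (hW : IsWeighted D) (hb : BlockTree G D.root D.par D.top D.idx)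
    {Q : State → Prop}
    (hQ : ∀ s', s'.word 0 = s₀.word 0 →
      (∃ D' : Layout (Fin n), D'.Combinatorial G ∧ HasSizes D' ord s') → Q s') :
    Tri B s₀ sizeProgram s Q := by
  have hlast : ∀ v : Fin n, (∀ w, ¬ ((w ≠ D.root ∧ D.par w = v ∧ D.top w ≠ v) ∧ ¬ D.Heavy w)) ↔
      D.Last v := fun v => forall_congr' fun w => by tauto
  have hblast : ∀ v : Fin n, (∀ w, ¬ (w ≠ D.root ∧ D.par w = v ∧ D.top w ≠ v)) ↔
      D.BlockLast v := fun v => forall_congr' fun w => by tauto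
  have hnext : ∀ (v j : Fin n) s', HasTree D ord s' → s'.word 20 0 = v → s'.word 21 0 = j →
      ((nextTest (.var 21) (.var 20)).holds s' ↔ j ≠ D.root ∧ D.par j = v ∧ D.top j ≠ v) := by
    intro v j s' hT' h20 h21
    simp only [nextTest, Test.holds, WExpr.eval, h20, h21, hT'.val_eq_zero, hT'.par_eq, hT'.top_eq,
      Fin.val_inj, ne_eq]
  have hsize : ∀ (j : Fin n) s', HasTree D ord s' → s'.word 21 0 = j →
      (lightSize (.var 21)).eval s' = 2 * D.b j := by
    intro j s' hT' h21
    simp only [lightSize, RExpr.eval, WExpr.eval, h21, hT'.W_eq, Layout.b]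
    push_cast; ring
  refine Tri.seq (runProgram_spec hB h0 hs hT hb.idx_par ?_)
  rintro s1 hs1 hf1 ⟨blk, sg, hblk, hsg, hblk', hsg'⟩
  replace hT := hT.frame hf1 (by decide) (by decide)
  refine Tri.seq (flagProgram_spec (by decide) hB h0 hs1
    (fun v w => (w ≠ D.root ∧ D.par w = v ∧ D.top w ≠ v) ∧ ¬ D.Heavy w) ?_ ?_)
  · intro v j s' hf h20 h21
    have hT' := hT.frame hf (by decide) (by decide)
    rw [← hnext v j s' hT' h20 h21, ← hT'.heavyTest_iff (e := .var 21) h21]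
    rfl
  intro s2 hs2 hf2 h13
  simp only [hlast] at h13
  replace hT := hT.frame hf2 (by decide) (by decide)
  rw [← hf2.word 11 (by decide)] at hblk
  rw [← hf2.word 12 (by decide)] at hsg
  refine Tri.seq (flagProgram_spec (by decide) hB h0 hs2
    (fun v w => w ≠ D.root ∧ D.par w = v ∧ D.top w ≠ v) ?_ ?_)
  · intro v j s' hf h20 h21
    exact hnext v j s' (hT.frame hf (by decide) (by decide)) h20 h21
  intro s3 hs3 hf3 h14
  simp only [hblast] at h14
  replace hT := hT.frame hf3 (by decide) (by decide)
  rw [← hf3.word 11 (by decide)] at hblk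
  rw [← hf3.word 12 (by decide)] at hsg
  rw [← hf3.word 13 (by decide)] at h13
  refine Tri.seq (sumProgram_spec (by decide) hB h0 hs3 (fun v c => D.Light c ∧ sg c = v)
    (fun c => 2 * D.b c) ?_ ?_)
  · intro v j s' hf h20 h21
    have hT' := hT.frame hf (by decide) (by decide)
    refine ⟨?_, hsize j s' hT' h21⟩
    rw [← hT'.lightTest_iff (e := .var 21) h21]
    simp only [Test.holds, WExpr.eval, h20, h21, hf.word 12 (by decide), hsg, Fin.val_inj]
  intro s4 hs4 hf4 h7
  replace hT := hT.frame hf4 (by decide) (by decide)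
  rw [← hf4.word 11 (by decide)] at hblk
  rw [← hf4.word 12 (by decide)] at hsg
  rw [← hf4.word 13 (by decide)] at h13
  rw [← hf4.word 14 (by decide)] at h14
  refine Tri.seq (sumProgram_spec (by decide) hB h0 hs4 (fun v c => D.Mid c ∧ sg c = v)
    (fun c => 2 * D.b c) ?_ ?_)
  · intro v j s' hf h20 h21
    have hT' := hT.frame hf (by decide) (by decide)
    refine ⟨?_, hsize j s' hT' h21⟩
    rw [Layout.Mid, ← hT'.lightTest_iff (e := .var 21) h21, ← hT'.firstTest_iff (e := .var 21) h21]
    simp only [Test.holds, WExpr.eval, h20, h21, hf.word 12 (by decide), hsg, Fin.val_inj,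
      hf.word 13 (by decide), h13]
  intro s5 hs5 hf5 h8
  replace hT := hT.frame hf5 (by decide) (by decide)
  rw [← hf5.word 11 (by decide)] at hblk
  rw [← hf5.word 12 (by decide)] at hsg
  rw [← hf5.word 13 (by decide)] at h13
  rw [← hf5.word 14 (by decide)] at h14
  rw [← hf5.real 7 (by decide)] at h7
  refine Tri.seq (sumProgram_spec (by decide) hB h0 hs5
    (fun v c => (D.Light c ∧ D.top c = D.top v) ∧ D.idx (sg c) < D.idx v) (fun c => 2 * D.b c) ?_ ?_)
  · intro v j s' hf h20 h21
    have hT' := hT.frame hf (by decide) (by decide)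
    refine ⟨?_, hsize j s' hT' h21⟩
    rw [← hT'.lightTest_iff (e := .var 21) h21]
    simp only [Test.holds, WExpr.eval, h20, h21, hf.word 12 (by decide), hsg, Fin.val_inj,
      hT'.top_eq, hT'.num_eq, Nat.add_lt_add_iff_right]
  intro s6 hs6 hf6 h9
  replace hT := hT.frame hf6 (by decide) (by decide)
  rw [← hf6.word 11 (by decide)] at hblk
  rw [← hf6.word 12 (by decide)] at hsg
  rw [← hf6.word 13 (by decide)] at h13
  rw [← hf6.word 14 (by decide)] at h14
  rw [← hf6.real 7 (by decide)] at h7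
  rw [← hf6.real 8 (by decide)] at h8
  refine Tri.seq (sumProgram_spec (by decide) hB h0 hs6
    (fun v c => c = v ∧ ¬ (D.par c = D.top c ∨ D.BlockLast c)) (fun c => 1) ?_ ?_)
  · intro v j s' hf h20 h21
    have hT' := hT.frame hf (by decide) (by decide)
    simp only [Test.holds, RExpr.eval, WExpr.eval, h20, h21, Fin.val_inj, hT'.top_eq, hT'.par_eq,
      hf.word 14 (by decide), h14, Nat.cast_one, not_or, and_self]
  intro s7 hs7 hf7 h11
  replace hT := hT.frame hf7 (by decide) (by decide)
  rw [← hf7.word 11 (by decide)] at hblk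
  rw [← hf7.word 12 (by decide)] at hsg
  rw [← hf7.word 13 (by decide)] at h13
  rw [← hf7.real 7 (by decide)] at h7
  rw [← hf7.real 8 (by decide)] at h8
  rw [← hf7.real 9 (by decide)] at h9
  refine Tri.seq (sumProgram_spec (by decide) hB h0 hs7
    (fun v c => c = v ∧ ¬ D.Last c) (fun c => s7.real 8 c + 2 * s7.real 7 c) ?_ ?_)
  · intro v j s' hf h20 h21
    simp only [Test.holds, RExpr.eval, WExpr.eval, h20, h21, Fin.val_inj,
      hf.word 13 (by decide), h13, hf.real 7 (by decide), hf.real 8 (by decide), Nat.cast_ofNat,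
      and_self]
  intro s8 hs8 hf8 h12
  rw [← hf8.real 8 (by decide), ← hf8.real 7 (by decide)] at h12
  replace hT := hT.frame hf8 (by decide) (by decide)
  rw [← hf8.word 11 (by decide)] at hblk
  rw [← hf8.word 12 (by decide)] at hsg
  rw [← hf8.word 13 (by decide)] at h13
  rw [← hf8.real 7 (by decide)] at h7
  rw [← hf8.real 8 (by decide)] at h8
  rw [← hf8.real 9 (by decide)] at h9
  rw [← hf8.real 11 (by decide)] at h11
  refine sumProgram_spec (by decide) hB h0 hs8 (fun v c => c = v ∧ D.Heavy c) (fun c => 1) ?_ ?_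
  · intro v j s' hf h20 h21
    have hT' := hT.frame hf (by decide) (by decide)
    rw [← hT'.heavyTest_iff (e := .var 21) h21]
    simp only [Test.holds, RExpr.eval, WExpr.eval, h20, h21, Fin.val_inj, Nat.cast_one, and_self]
  intro s9 hs9 hf9 hh13
  rw [← hf9.real 8 (by decide), ← hf9.real 7 (by decide), ← hf9.real 12 (by decide)] at h12
  replace hT := hT.frame hf9 (by decide) (by decide)
  rw [← hf9.word 11 (by decide)] at hblk
  rw [← hf9.word 12 (by decide)] at hsg
  rw [← hf9.word 13 (by decide)] at h13
  rw [← hf9.real 7 (by decide)] at h7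
  rw [← hf9.real 8 (by decide)] at h8
  rw [← hf9.real 9 (by decide)] at h9
  rw [← hf9.real 11 (by decide)] at h11
  -- Collapses the sums with one term to conditionals, for whatever decidability instance occurs.
  have hpoint : ∀ (v : Fin n) (τ : Fin n → Prop) (f : Fin n → ℝ) {_ : ∀ c, Decidable (c = v ∧ τ c)},
      (∑ c, if c = v ∧ τ c then f c else 0) = if τ v then f v else 0 := fun v τ f _ => by
    rw [Finset.sum_eq_single v (fun c _ hc => if_neg fun h => hc h.1) (by simp)]
    simp
  have hneg : ∀ (v : Fin n) (τ : Fin n → Prop) (f : Fin n → ℝ)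
      {_ : ∀ c, Decidable (c = v ∧ ¬ τ c)} {_ : Decidable (τ v)},
      (∑ c, if c = v ∧ ¬ τ c then f c else 0) = if τ v then 0 else f v := fun v τ f _ _ => by
    rw [hpoint v]
    by_cases h : τ v <;> simp [h]
  have hfilter : ∀ (p q : Fin n → Prop) (f g : Fin n → ℝ) {_ : ∀ c, Decidable (p c)}
      {_ : DecidablePred q}, (∀ c, p c ↔ q c) → (∀ c, f c = g c) →
      (∑ c, if p c then f c else 0) = ∑ c with q c, g c := fun p q f g _ _ h1 h2 => by
    rw [Finset.sum_filter]
    exact Finset.sum_congr rfl fun c _ => by simp only [h1, h2]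
  replace hh13 := fun v => (hh13 v).trans (hpoint v _ _)
  refine hQ s9 hs9 ⟨{ D with
    blk := blk
    sg := sg
    S := fun v => s9.real 7 v
    M := fun v => s9.real 8 v
    pre := fun v => s9.real 9 v }, ?_, ?_⟩
  · exact
    { blockTree := hb
      hv_some := hW.hv_some
      hv_none := hW.hv_none
      W_eq := hW.W_eq
      L_eq := fun p => by
        refine (hW.L_eq p).trans ?_
        rw [Finset.sum_filter]
        refine Finset.sum_congr rfl fun c _ => ?_
        by_cases h : D.Light c ∧ D.top c = p
        · rw [if_pos ⟨h.1.1, h.2, h.2 ▸ h.1.2⟩]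
          refine Eq.trans ?_ (if_pos h).symm
          change _ = 2 * (100000 * D.W c)
          ring
        · rw [if_neg fun h' : c ≠ D.root ∧ D.top c = p ∧ D.hv p ≠ some c => h ⟨⟨h'.1, h'.2.1.symm ▸ h'.2.2⟩, h'.2.1⟩]
          exact (if_neg h).symm
      blk_first := fun c hc hp => (hblk' c hc).trans (if_pos hp)
      blk_next := fun c hc hp => (hblk' c hc).trans (if_neg hp)
      sg_first := fun c hc hp => (hsg' c hc.1).trans (if_pos hp)
      sg_next := fun c hc hp => (hsg' c hc.1).trans (if_neg hp)
      S_eq := fun u _ _ => (h7 u).trans (hfilter _ _ _ _ (fun _ => Iff.rfl) fun _ => rfl)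
      M_eq := fun u _ _ => (h8 u).trans (hfilter _ _ _ _ (fun _ => Iff.rfl) fun _ => rfl)
      pre_eq := fun u _ _ => (h9 u).trans (hfilter _ _ _ _ (fun _ => Iff.rfl) fun _ => rfl) }
  · exact
    { root_eq := hT.root_eq
      par_root := hT.par_root
      idx_lt := hT.idx_lt
      ord_idx := hT.ord_idx
      idx_ord := hT.idx_ord
      par_eq := hT.par_eq
      num_eq := hT.num_eq
      ord_eq := hT.ord_eq
      top_eq := hT.top_eq
      hv_eq := hT.hv_eq
      W_eq := hT.W_eq
      L_eq := hT.L_eq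
      blk_eq := hblk
      sg_eq := hsg
      last_iff := h13
      S_eq := fun _ => rfl
      M_eq := fun _ => rfl
      pre_eq := fun _ => rfl
      gap_eq := fun v => (h11 v).trans (hneg v _ _)
      pocketLength_eq := fun v => (h12 v).trans (hneg v _ _)
      heavy_eq := hh13 }

end RealRAM


/-! ## The program: positions -/

namespace RealRAM

/-- Operators and numerals let the placement formulas look like the real formulas that they compute.
-/
instance : Add RExpr := ⟨.add⟩
instance : Sub RExpr := ⟨.sub⟩
instance : Mul RExpr := ⟨.mul⟩
instance : Div RExpr := ⟨.div⟩
instance (k : ℕ) : OfNat RExpr k := ⟨.ofWord (.lit k)⟩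

namespace RExpr

variable (s : State) (e f : RExpr)

theorem eval_add : (e + f).eval s = e.eval s + f.eval s := rfl
theorem eval_sub : (e - f).eval s = e.eval s - f.eval s := rfl
theorem eval_mul : (e * f).eval s = e.eval s * f.eval s := rfl
theorem eval_div : (e / f).eval s = e.eval s / f.eval s := rfl
theorem eval_sqrt : e.sqrt.eval s = √(e.eval s) := rfl
theorem eval_get (a : ℕ) (i : WExpr) : (get a i).eval s = s.real a (i.eval s) := rfl
theorem eval_zero : (0 : RExpr).eval s = 0 := Nat.cast_zero
theorem eval_one : (1 : RExpr).eval s = 1 := Nat.cast_one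
theorem eval_ofNat (k : ℕ) [k.AtLeastTwo] : (ofNat(k) : RExpr).eval s = ofNat(k) :=
  Nat.cast_ofNat

/-- The square. -/
def sq : RExpr := e * e

theorem eval_sq : e.sq.eval s = e.eval s ^ 2 := (_root_.sq _).symm

/-- The entry at the current vertex. -/
def own (a : ℕ) : RExpr := .get a (.var 25)

/-- The entry at the vertex above the block. -/
def ofTop (a : ℕ) : RExpr := .get a (.get 7 (.var 25))

/-- The entry at the parent. -/
def ofPar (a : ℕ) : RExpr := .get a (.get 6 (.var 25))

/-- The entry at the heavy child of the vertex above the block. -/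
def ofHeavy (a : ℕ) : RExpr := .get a (.sub (.get 10 (.get 7 (.var 25))) (.lit 1))

/-- `Layout.wallStart`. -/
def wallStart : RExpr := ofTop 2 / 4 + 12 * own 9 + 4 * own 7

/-- `Layout.wallHeight`. -/
def wallHeight : RExpr := sqrt (sq (ofTop 2) - sq wallStart + 4 * own 7 * ofTop 2)

/-- `Layout.heavyRadius` of the heavy child of the vertex above the block. -/
def heavyRadius : RExpr := 1000 * (1 + ofHeavy 6 + ofTop 6)

/-- `Layout.pocketBase`. -/
def pocketBase : RExpr := ofTop 2 + heavyRadius + ofHeavy 11 - own 12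

/-- `Layout.pocketDepth`. -/
def pocketDepth : RExpr :=
  (sq pocketBase + sq (ofTop 2 + own 7) - sq (heavyRadius + own 7)) / (2 * pocketBase)

/-- `Layout.pocketSide`. -/
def pocketSide : RExpr := sqrt (sq (ofTop 2 + own 7) - sq pocketDepth)

/-- `Layout.lam` of the parent. -/
def lam : RExpr := (ofPar 0 - ofTop 0) * ofPar 4 - (ofPar 1 - ofTop 1) * ofPar 3

/-- `Layout.eta` of the parent. -/
def eta : RExpr := (ofPar 0 - ofTop 0) * ofPar 3 + (ofPar 1 - ofTop 1) * ofPar 4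

end RExpr

open RExpr

/-- The run of the vertex `e` lies on the wall. -/
def wallTest (e : WExpr) : Test :=
  .and (.wordEq (.get 6 e) (.get 7 e)) (.not (.and (.not (.wordEq (.get 10 (.get 7 e)) (.lit 0)))
    (.wordEq (.get 11 (.sub (.get 10 (.get 7 e)) (.lit 1))) e)))

/-- The circle at the current vertex. -/
def placeProgram (dx dy r cx cy : RExpr) : Program :=
  .seq (.setReal 3 (.var 25) dx) <| .seq (.setReal 4 (.var 25) dy) <|
  .seq (.setReal 2 (.var 25) r) <| .seq (.setReal 0 (.var 25) cx) (.setReal 1 (.var 25) cy)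

/-- The first circle of a run. -/
def placeRun (dx dy r x y : RExpr) : Program :=
  placeProgram dx dy r (ofTop 0 + (x * own 4 + y * own 3)) (ofTop 1 + (y * own 4 - x * own 3))

/-- A circle of a run that is not the first one. -/
def placeNext (r : RExpr) : Program :=
  placeProgram (ofPar 3) (ofPar 4) r (ofPar 0 + (ofPar 2 + own 2) * own 4)
    (ofPar 1 - (ofPar 2 + own 2) * own 3)

/-- Center, radius and direction of the current vertex in the real arrays `0` to `4`. -/
def positionStep : Program :=
  .ite (.wordEq (.var 25) (.lit 0)) (placeProgram 0 (0 - 1) (100000 * own 5) 0 0) <|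
  .ite (heavyTest (.var 25))
    (placeProgram (ofTop 3) (ofTop 4) (1000 * (1 + own 6 + ofTop 6))
      (ofTop 0 + (ofTop 2 + own 2 + own 11) * ofTop 3)
      (ofTop 1 + (ofTop 2 + own 2 + own 11) * ofTop 4)) <|
  .ite (firstTest (.var 25))
    (.ite (wallTest (.var 25))
      (.ite (.wordEq (.get 13 (.var 25)) (.lit 0))
        (placeRun ((1 - ofTop 13) * ofTop 3 - ofTop 13 * ofTop 4)
          ((1 - ofTop 13) * ofTop 4 + ofTop 13 * ofTop 3)
          (sqrt (sq (ofTop 2) + 4 * own 7 * ofTop 2) - ofTop 2) wallStart wallHeight)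
        (placeRun ((1 - ofTop 13) * ofTop 3 - ofTop 13 * ofTop 4)
          ((1 - ofTop 13) * ofTop 4 + ofTop 13 * ofTop 3)
          (2 * own 7 * ofTop 2 / (ofTop 2 + wallStart)) (wallStart - own 2) wallHeight))
      (.ite (.wordEq (.get 6 (.var 25)) (.get 7 (.var 25)))
        (placeRun (0 - ofTop 4) (ofTop 3) (own 7) pocketDepth pocketSide)
        (placeRun (ofTop 4) (0 - ofTop 3) (own 7) (0 - (pocketDepth + own 12)) pocketSide)))
    (.ite (.wordEq (.get 13 (.var 25)) (.lit 0))
      (.ite (wallTest (.get 12 (.var 25)))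
        (placeNext ((sq (lam + ofPar 2) + sq eta - sq (ofTop 2)) /
          (2 * (ofTop 2 - (lam + ofPar 2)))))
        (placeNext (.get 7 (.get 12 (.var 25)))))
      (placeNext (100000 * own 5)))

/-- Centers, radii and directions of all vertices. -/
def positionProgram : Program :=
  .forTo 20 .order <| .seq (.setWord 25 (.lit 0) (.get 4 (.var 20))) positionStep

section

variable {n B : ℕ} {D : Layout (Fin n)} {ord : ℕ → Fin n} {s₀ s s' : State} {v : Fin n}

/-- The state `s'` agrees with `s` except for the circle at the current vertex `v`. -/
structure Reads (D : Layout (Fin n)) (ord : ℕ → Fin n) (v : Fin n) (s s' : State) : Prop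
    extends HasSizes D ord s' where
  cur : s'.word 25 0 = v
  other : ∀ i : ℕ, i ≠ v → ∀ a ∈ [0, 1, 2, 3, 4], s'.real a i = s.real a i

theorem Reads.putReal (h : Reads D ord v s s') {a : ℕ} {x : ℝ} (ha : a ∈ [0, 1, 2, 3, 4]) :
    Reads D ord v s (s'.putReal a v x) :=
  { h.toHasSizes.frame (Frame.putReal (A := []) s' ha) (by decide) (by decide) with
    cur := h.cur
    other := fun i hi c hc => by
      rw [State.putReal_real, if_neg fun h => hi h.2, h.other i hi c hc] }

/-- Direction and radius are stored before the center, so the expressions for the center may read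
them; their hypotheses receive the values just stored. -/
theorem placeProgram_spec {dx dy r cx cy : RExpr} {Dx Dy R Cx Cy : ℝ} (h : Reads D ord v s s')
    (hdx : ∀ s', Reads D ord v s s' → dx.eval s' = Dx)
    (hdy : ∀ s', Reads D ord v s s' → dy.eval s' = Dy)
    (hr : ∀ s', Reads D ord v s s' → r.eval s' = R)
    (hcx : ∀ s', Reads D ord v s s' → s'.real 3 v = Dx → s'.real 4 v = Dy → s'.real 2 v = R →
      cx.eval s' = Cx)
    (hcy : ∀ s', Reads D ord v s s' → s'.real 3 v = Dx → s'.real 4 v = Dy → s'.real 2 v = R →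
      cy.eval s' = Cy) {Q : State → Prop}
    (hQ : ∀ s'', Reads D ord v s s'' → s''.real 3 v = Dx → s''.real 4 v = Dy → s''.real 2 v = R →
      s''.real 0 v = Cx → s''.real 1 v = Cy → Q s'') :
    Tri B s₀ (placeProgram dx dy r cx cy) s' Q := by
  have hi : ∀ {s'}, Reads D ord v s s' → (WExpr.var 25).eval s' = v := fun h => h.cur
  refine Tri.seq (Tri.setReal ?_)
  rw [hi h, hdx _ h]
  have h1 := h.putReal (a := 3) (x := Dx) (by decide)
  generalize hs1 : s'.putReal 3 v Dx = s1 at h1 ⊢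
  refine Tri.seq (Tri.setReal ?_)
  rw [hi h1, hdy _ h1]
  have h2 := h1.putReal (a := 4) (x := Dy) (by decide)
  generalize hs2 : s1.putReal 4 v Dy = s2 at h2 ⊢
  refine Tri.seq (Tri.setReal ?_)
  rw [hi h2, hr _ h2]
  have h3 := h2.putReal (a := 2) (x := R) (by decide)
  generalize hs3 : s2.putReal 2 v R = s3 at h3 ⊢
  have k3 : s3.real 3 v = Dx := by simp [← hs3, ← hs2, ← hs1, State.putReal_real]
  have k4 : s3.real 4 v = Dy := by simp [← hs3, ← hs2, State.putReal_real]
  have k2 : s3.real 2 v = R := by simp [← hs3, State.putReal_real]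
  refine Tri.seq (Tri.setReal ?_)
  rw [hi h3, hcx _ h3 k3 k4 k2]
  have h4 := h3.putReal (a := 0) (x := Cx) (by decide)
  generalize hs4 : s3.putReal 0 v Cx = s4 at h4 ⊢
  have l3 : s4.real 3 v = Dx := by simp [← hs4, State.putReal_real, k3]
  have l4 : s4.real 4 v = Dy := by simp [← hs4, State.putReal_real, k4]
  have l2 : s4.real 2 v = R := by simp [← hs4, State.putReal_real, k2]
  have l0 : s4.real 0 v = Cx := by simp [← hs4, State.putReal_real]
  refine Tri.setReal ?_
  rw [hi h4, hcy _ h4 l3 l4 l2]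
  refine hQ _ (h4.putReal (by decide)) ?_ ?_ ?_ ?_ ?_ <;> simp [State.putReal_real, *]

/-- The layout with the circles in the memory. -/
def _root_.Layout.withCircles (D : Layout (Fin n)) (s : State) : Layout (Fin n) :=
  { D with
    cx := fun v => s.real 0 v
    cy := fun v => s.real 1 v
    r := fun v => s.real 2 v
    dx := fun v => s.real 3 v
    dy := fun v => s.real 4 v }

open Classical in
theorem withCircles_fx (s : State) (p : Fin n) : (D.withCircles s).fx p =
    if D.Heavy p then - s.real 4 p else s.real 3 p := rfl

open Classical in
theorem withCircles_fy (s : State) (p : Fin n) : (D.withCircles s).fy p =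
    if D.Heavy p then s.real 3 p else s.real 4 p := rfl

/-- The values of the circle of `v` in `s'`. -/
def CircleIs (s' : State) (v : Fin n) (dx dy r cx cy : ℝ) : Prop :=
  s'.real 3 v = dx ∧ s'.real 4 v = dy ∧ s'.real 2 v = r ∧ s'.real 0 v = cx ∧ s'.real 1 v = cy

/-- The circle of `v` in `s'` starts a run above which the memory is `s`. -/
def StartsRun (D : Layout (Fin n)) (s s' : State) (v : Fin n) (dx dy r x y : ℝ) : Prop :=
  CircleIs s' v dx dy r (s.real 0 (D.top v) + (x * dy + y * dx))
    (s.real 1 (D.top v) + (y * dy - x * dx))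

/-- The circle of `v` in `s'` follows the circle of its parent in `s`. -/
def Follows (D : Layout (Fin n)) (s s' : State) (v : Fin n) (r : ℝ) : Prop :=
  CircleIs s' v (s.real 3 (D.par v)) (s.real 4 (D.par v)) r
    (s.real 0 (D.par v) + (s.real 2 (D.par v) + r) * s.real 4 (D.par v))
    (s.real 1 (D.par v) - (s.real 2 (D.par v) + r) * s.real 3 (D.par v))

theorem placeRun_spec {dx dy r x y : RExpr} {Dx Dy R X Y : ℝ} (h : Reads D ord v s s')
    (hv : D.top v ≠ v)
    (hdx : ∀ s', Reads D ord v s s' → dx.eval s' = Dx)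
    (hdy : ∀ s', Reads D ord v s s' → dy.eval s' = Dy)
    (hr : ∀ s', Reads D ord v s s' → r.eval s' = R)
    (hx : ∀ s', Reads D ord v s s' → s'.real 2 v = R → x.eval s' = X)
    (hy : ∀ s', Reads D ord v s s' → y.eval s' = Y) {Q : State → Prop}
    (hQ : ∀ s'', Reads D ord v s s'' → StartsRun D s s'' v Dx Dy R X Y → Q s'') :
    Tri B s₀ (placeRun dx dy r x y) s' Q := by
  have hne : (D.top v : ℕ) ≠ v := fun h => hv (Fin.ext h)
  refine placeProgram_spec h hdx hdy hr (fun s' h' k3 k4 k2 => ?_) (fun s' h' k3 k4 k2 => ?_)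
    fun s'' h' k3 k4 k2 k0 k1 => hQ s'' h' ⟨k3, k4, k2, k0, k1⟩ <;>
  · simp only [eval_add, eval_sub, eval_mul, hx s' h' k2, hy s' h', own, ofTop, eval_get, WExpr.eval,
      h'.cur, h'.top_eq, k3, k4]
    rw [h'.other _ hne _ (by decide)]

theorem placeNext_spec {r : RExpr} {R : ℝ} (h : Reads D ord v s s') (hv : D.par v ≠ v)
    (hr : ∀ s', Reads D ord v s s' → r.eval s' = R) {Q : State → Prop}
    (hQ : ∀ s'', Reads D ord v s s'' → Follows D s s'' v R → Q s'') :
    Tri B s₀ (placeNext r) s' Q := by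
  have hne : (D.par v : ℕ) ≠ v := fun h => hv (Fin.ext h)
  have hp : ∀ s' a, Reads D ord v s s' → a ∈ [0, 1, 2, 3, 4] →
      (ofPar a).eval s' = s.real a (D.par v) := fun s' a h' ha => by
    simp only [ofPar, eval_get, WExpr.eval, h'.cur, h'.par_eq]
    exact h'.other _ hne _ ha
  refine placeProgram_spec h (fun s' h' => hp s' 3 h' (by decide))
    (fun s' h' => hp s' 4 h' (by decide)) hr (fun s' h' k3 k4 k2 => ?_) (fun s' h' k3 k4 k2 => ?_)
    fun s'' h' k3 k4 k2 k0 k1 => hQ s'' h' ⟨k3, k4, k2, k0, k1⟩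
  · rw [← hp s' 0 h' (by decide), ← hp s' 2 h' (by decide), ← k2, ← k4]
    simp only [eval_add, eval_mul, own, eval_get, WExpr.eval, h'.cur]
  · rw [← hp s' 1 h' (by decide), ← hp s' 2 h' (by decide), ← k2, ← k3]
    simp only [eval_add, eval_sub, eval_mul, own, eval_get, WExpr.eval, h'.cur]

open Classical in
/-- The circle of `v` in `s'` is placed as prescribed with respect to the circles in `s`. -/
structure PlacedAt (D : Layout (Fin n)) (s s' : State) (v : Fin n) : Prop where
  root : v = D.root → CircleIs s' v 0 (-1) (D.b v) 0 0
  heavy : D.Heavy v → CircleIs s' v (s.real 3 (D.top v)) (s.real 4 (D.top v)) (D.heavyRadius v)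
    (s.real 0 (D.top v) + (D.withCircles s).heavyDist v * s.real 3 (D.top v))
    (s.real 1 (D.top v) + (D.withCircles s).heavyDist v * s.real 4 (D.top v))
  mid : D.Light v → ¬ D.First v → ¬ D.Last v → Follows D s s' v (D.b v)
  last_wall : D.Light v → ¬ D.First v → D.Last v → D.Wall (D.sg v) → ∀ a b,
    a = (s.real 0 (D.par v) - s.real 0 (D.top v)) * s.real 4 (D.par v) -
      (s.real 1 (D.par v) - s.real 1 (D.top v)) * s.real 3 (D.par v) + s.real 2 (D.par v) →
    b = (s.real 0 (D.par v) - s.real 0 (D.top v)) * s.real 3 (D.par v) +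
      (s.real 1 (D.par v) - s.real 1 (D.top v)) * s.real 4 (D.par v) →
    Follows D s s' v ((a ^ 2 + b ^ 2 - s.real 2 (D.top v) ^ 2) / (2 * (s.real 2 (D.top v) - a)))
  last_pocket : D.Light v → ¬ D.First v → D.Last v → ¬ D.Wall (D.sg v) →
    Follows D s s' v (D.S (D.sg v))
  wall_single : D.Light v → D.First v → D.Wall v → D.Last v → StartsRun D s s' v
    ((D.withCircles s).fx (D.top v)) ((D.withCircles s).fy (D.top v))
    (√(s.real 2 (D.top v) ^ 2 + 4 * D.S v * s.real 2 (D.top v)) - s.real 2 (D.top v))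
    ((D.withCircles s).wallStart v) ((D.withCircles s).wallHeight v)
  wall : D.Light v → D.First v → D.Wall v → ¬ D.Last v → StartsRun D s s' v
    ((D.withCircles s).fx (D.top v)) ((D.withCircles s).fy (D.top v))
    (2 * D.S v * s.real 2 (D.top v) / (s.real 2 (D.top v) + (D.withCircles s).wallStart v))
    ((D.withCircles s).wallStart v -
      2 * D.S v * s.real 2 (D.top v) / (s.real 2 (D.top v) + (D.withCircles s).wallStart v))
    ((D.withCircles s).wallHeight v)
  before : D.Light v → D.First v → D.Before v → ∀ h, D.hv (D.top v) = some h → StartsRun D s s' v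
    (- s.real 4 (D.top v)) (s.real 3 (D.top v)) (D.S v)
    ((D.withCircles s).pocketDepth v h) ((D.withCircles s).pocketSide v h)
  after : D.Light v → D.First v → D.After v → ∀ h, D.hv (D.top v) = some h → StartsRun D s s' v
    (s.real 4 (D.top v)) (- s.real 3 (D.top v)) (D.S v)
    (-((D.withCircles s).pocketDepth v h + D.pocketLength v)) ((D.withCircles s).pocketSide v h)

/-- The prescription looks at the circles of `v`, `top v` and `par v` only, so it passes to any
memory with the same values there, in particular to the final one. -/
theorem PlacedAt.congr {F : State} (h : PlacedAt D s s' v)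
    (hv : ∀ a ∈ [0, 1, 2, 3, 4], s'.real a v = F.real a v)
    (ht : v ≠ D.root → ∀ a ∈ [0, 1, 2, 3, 4], s.real a (D.top v) = F.real a (D.top v))
    (hp : v ≠ D.root → ∀ a ∈ [0, 1, 2, 3, 4], s.real a (D.par v) = F.real a (D.par v))
    (hh : ∀ h, D.hv (D.top v) = some h → D.top h = D.top v) : PlacedAt D F F v := by
  simp only [List.forall_mem_cons, List.not_mem_nil, false_imp_iff, implies_true, and_true] at hv ht hp
  obtain ⟨v0, v1, v2, v3, v4⟩ := hv
  by_cases hr : v = D.root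
  · have hl : ¬ D.Light v := fun h => h.1 hr
    refine ⟨fun hr => ?_, fun h => absurd hr h.1, fun h => absurd h hl, fun h => absurd h hl,
      fun h => absurd h hl, fun h => absurd h hl, fun h => absurd h hl, fun h => absurd h hl,
      fun h => absurd h hl⟩
    simpa only [CircleIs, v0, v1, v2, v3, v4] using h.root hr
  obtain ⟨t0, t1, t2, t3, t4⟩ := ht hr
  obtain ⟨p0, p1, p2, p3, p4⟩ := hp hr
  have hs : ∀ {dx dy r x y}, StartsRun D s s' v dx dy r x y → StartsRun D F F v dx dy r x y := by
    intro dx dy r x y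
    simp only [StartsRun, CircleIs, v0, v1, v2, v3, v4, t0, t1, imp_self]
  have hf : ∀ {r}, Follows D s s' v r → Follows D F F v r := by
    intro r
    simp only [Follows, CircleIs, v0, v1, v2, v3, v4, p0, p1, p2, p3, p4, imp_self]
  have efx : (D.withCircles s).fx (D.top v) = (D.withCircles F).fx (D.top v) := by
    rw [withCircles_fx, withCircles_fx, t3, t4]
  have efy : (D.withCircles s).fy (D.top v) = (D.withCircles F).fy (D.top v) := by
    rw [withCircles_fy, withCircles_fy, t3, t4]
  have ew : (D.withCircles s).wallStart v = (D.withCircles F).wallStart v := by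
    simp only [Layout.wallStart, Layout.withCircles, t2]
  have eh : (D.withCircles s).wallHeight v = (D.withCircles F).wallHeight v := by
    simp only [Layout.wallHeight, ew]
    simp only [Layout.withCircles, t2]
  have eb : ∀ h, D.hv (D.top v) = some h →
      (D.withCircles s).pocketBase v h = (D.withCircles F).pocketBase v h := by
    intro h hv
    have : (D.withCircles s).heavyDist h = (D.withCircles F).heavyDist h := by
      change s.real 2 (D.top h) + D.heavyRadius h + D.gap h =
        F.real 2 (D.top h) + D.heavyRadius h + D.gap h
      rw [hh h hv, t2]
    rw [Layout.pocketBase, this]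
    rfl
  have ed : ∀ h, D.hv (D.top v) = some h →
      (D.withCircles s).pocketDepth v h = (D.withCircles F).pocketDepth v h := by
    intro h hv
    rw [Layout.pocketDepth, Layout.pocketDepth, eb h hv]
    simp only [Layout.withCircles, t2, Layout.heavyRadius]
  have es : ∀ h, D.hv (D.top v) = some h →
      (D.withCircles s).pocketSide v h = (D.withCircles F).pocketSide v h := by
    intro h hv
    rw [Layout.pocketSide, Layout.pocketSide, ed h hv]
    simp only [Layout.withCircles, t2]
  refine ⟨fun h => absurd h hr, fun h1 => ?_, fun h1 h2 h3 => hf (h.mid h1 h2 h3),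
    fun h1 h2 h3 h4 a b ha hb => ?_, fun h1 h2 h3 h4 => hf (h.last_pocket h1 h2 h3 h4),
    fun h1 h2 h3 h4 => ?_, fun h1 h2 h3 h4 => ?_, fun h1 h2 h3 h' h4 => ?_,
    fun h1 h2 h3 h' h4 => ?_⟩
  · have : (D.withCircles s).heavyDist v = (D.withCircles F).heavyDist v := by
      change s.real 2 (D.top v) + D.heavyRadius v + D.gap v =
        F.real 2 (D.top v) + D.heavyRadius v + D.gap v
      rw [t2]
    simpa only [CircleIs, v0, v1, v2, v3, v4, t0, t1, t2, t3, t4, this] using h.heavy h1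
  · rw [← p0, ← p1, ← p2, ← p3, ← p4, ← t0, ← t1] at ha
    rw [← p0, ← p1, ← p3, ← p4, ← t0, ← t1] at hb
    rw [← t2]
    exact hf (h.last_wall h1 h2 h3 h4 a b ha hb)
  · rw [← efx, ← efy, ← ew, ← eh, ← t2]
    exact hs (h.wall_single h1 h2 h3 h4)
  · rw [← efx, ← efy, ← ew, ← eh, ← t2]
    exact hs (h.wall h1 h2 h3 h4)
  · rw [← ed h' h4, ← es h' h4, ← t3, ← t4]
    exact hs (h.before h1 h2 h3 h' h4)
  · rw [← ed h' h4, ← es h' h4, ← t3, ← t4]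
    exact hs (h.after h1 h2 h3 h' h4)

/-- Once both memories are the final one, the prescriptions are equations between its entries.
Stored radii and directions replace the expressions that defined them. -/
theorem geometric_of_placedAt {G : SimpleGraph (Fin n)} (hD : D.Combinatorial G)
    (h : ∀ v, PlacedAt D s s v) : (D.withCircles s).Geometric := by
  have hn : ∀ v, D.Light v → ¬ D.First v → Follows D s s v (s.real 2 v) := by
    intro v h1 h2
    by_cases h3 : D.Last v
    · by_cases h4 : D.Wall (D.sg v)
      · have := (h v).last_wall h1 h2 h3 h4 _ _ rfl rfl
        rwa [← this.2.2.1] at this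
      · have := (h v).last_pocket h1 h2 h3 h4
        rwa [← this.2.2.1] at this
    · have := (h v).mid h1 h2 h3
      rwa [← this.2.2.1] at this
  have hw : ∀ v, D.Light v → D.First v → D.Wall v →
      StartsRun D s s v ((D.withCircles s).fx (D.top v)) ((D.withCircles s).fy (D.top v)) (s.real 2 v)
        (open Classical in if D.Last v then (D.withCircles s).wallStart v else
          (D.withCircles s).wallStart v - s.real 2 v) ((D.withCircles s).wallHeight v) ∧
      s.real 2 v = (open Classical in if D.Last v then
        √(s.real 2 (D.top v) ^ 2 + 4 * D.S v * s.real 2 (D.top v)) - s.real 2 (D.top v) else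
        2 * D.S v * s.real 2 (D.top v) / (s.real 2 (D.top v) + (D.withCircles s).wallStart v)) := by
    intro v h1 h2 h3
    by_cases h4 : D.Last v
    · have := (h v).wall_single h1 h2 h3 h4
      have hr := this.2.2.1
      rw [← hr] at this
      rw [if_pos h4, if_pos h4]
      exact ⟨this, hr⟩
    · have := (h v).wall h1 h2 h3 h4
      have hr := this.2.2.1
      rw [← hr] at this
      rw [if_neg h4, if_neg h4]
      exact ⟨this, hr⟩
  have hafter : ∀ v, D.Light v → D.First v → D.After v → ∃ h, D.hv (D.top v) = some h := by
    intro v h1 h2 h3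
    rcases hD.blockTree.top_cases v h1.1 with h4 | ⟨-, h4⟩
    · exact absurd h4.symm h3
    · rcases h2 with h2 | h2
      exacts [absurd h2 h3, ⟨_, h4 ▸ h2.2⟩]
  have hpocket : ∀ v, D.Light v → D.First v → ¬ D.Wall v → s.real 2 v = D.S v := by
    intro v h1 h2 h3
    by_cases h4 : D.par v = D.top v
    · have : ∃ h, D.hv (D.top v) = some h ∧ D.blk h = v := by
        by_contra h5
        exact h3 ⟨h4, fun h h6 h7 => h5 ⟨h, h6, h7⟩⟩
      obtain ⟨h', h5, h6⟩ := this
      exact ((h v).before h1 h2 ⟨h4, h', h5, h6⟩ h' h5).2.2.1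
    · obtain ⟨h', h5⟩ := hafter v h1 h2 h4
      exact ((h v).after h1 h2 h4 h' h5).2.2.1
  exact
  { root_dx := ((h _).root rfl).1
    root_dy := ((h _).root rfl).2.1
    root_r := ((h _).root rfl).2.2.1
    heavy_r := fun v hv => ((h v).heavy hv).2.2.1
    heavy_dx := fun v hv => ((h v).heavy hv).1
    heavy_dy := fun v hv => ((h v).heavy hv).2.1
    heavy_cx := fun v hv => ((h v).heavy hv).2.2.2.1
    heavy_cy := fun v hv => ((h v).heavy hv).2.2.2.2
    next_dx := fun v h1 h2 => (hn v h1 h2).1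
    next_dy := fun v h1 h2 => (hn v h1 h2).2.1
    next_cx := fun v h1 h2 => by
      refine (hn v h1 h2).2.2.2.1.trans ?_
      rw [← (hn v h1 h2).2.1]; rfl
    next_cy := fun v h1 h2 => by
      refine (hn v h1 h2).2.2.2.2.trans ?_
      rw [← (hn v h1 h2).1]; rfl
    mid_r := fun v hv => ((h v).mid hv.1 hv.2.1 hv.2.2).2.2.1
    last_wall_r := fun v h1 h2 h3 h4 => by
      refine ((h v).last_wall h1 h2 h3 h4 _ _ rfl rfl).2.2.1.trans ?_
      rw [← (hn v h1 h2).1, ← (hn v h1 h2).2.1]; rfl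
    last_pocket_r := fun v h1 h2 h3 h4 => ((h v).last_pocket h1 h2 h3 h4).2.2.1
    wall_dx := fun v h1 h2 h3 => (hw v h1 h2 h3).1.1
    wall_dy := fun v h1 h2 h3 => (hw v h1 h2 h3).1.2.1
    wall_r := fun v h1 h2 h3 => (hw v h1 h2 h3).2
    wall_cx := fun v h1 h2 h3 => by
      have := (hw v h1 h2 h3).1
      refine this.2.2.2.1.trans ?_
      rw [← this.1, ← this.2.1]; rfl
    wall_cy := fun v h1 h2 h3 => by
      have := (hw v h1 h2 h3).1
      refine this.2.2.2.2.trans ?_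
      rw [← this.1, ← this.2.1]; rfl
    pocket_r := hpocket
    before_dx := fun v h1 h2 h3 => by
      obtain ⟨h', h4, -⟩ := h3.2
      exact ((h v).before h1 h2 h3 h' h4).1
    before_dy := fun v h1 h2 h3 => by
      obtain ⟨h', h4, -⟩ := h3.2
      exact ((h v).before h1 h2 h3 h' h4).2.1
    before_cx := fun v h' h1 h2 h3 h4 => by
      have := (h v).before h1 h2 h3 h' h4
      refine this.2.2.2.1.trans ?_
      rw [← this.1, ← this.2.1]; rfl
    before_cy := fun v h' h1 h2 h3 h4 => by
      have := (h v).before h1 h2 h3 h' h4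
      refine this.2.2.2.2.trans ?_
      rw [← this.1, ← this.2.1]; rfl
    after_dx := fun v h1 h2 h3 => by
      obtain ⟨h', h4⟩ := hafter v h1 h2 h3
      exact ((h v).after h1 h2 h3 h' h4).1
    after_dy := fun v h1 h2 h3 => by
      obtain ⟨h', h4⟩ := hafter v h1 h2 h3
      exact ((h v).after h1 h2 h3 h' h4).2.1
    after_cx := fun v h' h1 h2 h3 h4 => by
      have := (h v).after h1 h2 h3 h' h4
      refine this.2.2.2.1.trans ?_
      rw [← this.1, ← this.2.1]; rfl
    after_cy := fun v h' h1 h2 h3 h4 => by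
      have := (h v).after h1 h2 h3 h' h4
      refine this.2.2.2.2.trans ?_
      rw [← this.1, ← this.2.1, neg_mul, sub_neg_eq_add]; rfl }

theorem HasSizes.wallTest_iff (h : HasSizes D ord s) {e : WExpr} (he : e.eval s = v) :
    (wallTest e).holds s ↔ D.Wall v := by
  simp only [wallTest, Test.holds, WExpr.eval, he, h.par_eq, h.top_eq, h.hv_eq, Layout.Wall,
    Fin.val_inj]
  refine and_congr_right fun _ => ?_
  cases D.hv (D.top v) with
  | none => simp [encode]
  | some x => simp [encode, h.blk_eq, Fin.val_inj]

end

end RealRAM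


/-! ### Correctness of the placement -/

namespace RealRAM

open RExpr

section

variable {n B : ℕ} {D : Layout (Fin n)} {ord : ℕ → Fin n} {s₀ s s' : State} {v h : Fin n}

namespace Reads

theorem eval_own (hR : Reads D ord v s s') (a : ℕ) : (own a).eval s' = s'.real a v := by
  simp only [own, eval_get, WExpr.eval, hR.cur]

theorem eval_ofTop (hR : Reads D ord v s s') (a : ℕ) :
    (ofTop a).eval s' = s'.real a (D.top v) := by
  simp only [ofTop, eval_get, WExpr.eval, hR.cur, hR.top_eq]

theorem eval_ofPar (hR : Reads D ord v s s') (a : ℕ) :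
    (ofPar a).eval s' = s'.real a (D.par v) := by
  simp only [ofPar, eval_get, WExpr.eval, hR.cur, hR.par_eq]

theorem eval_ofHeavy (hR : Reads D ord v s s') (hh : D.hv (D.top v) = some h) (a : ℕ) :
    (ofHeavy a).eval s' = s'.real a h := by
  simp only [ofHeavy, eval_get, WExpr.eval, hR.cur, hR.top_eq, hR.hv_eq, hh, encode,
    Option.elim_some, Nat.add_sub_cancel]

theorem real_eq (hR : Reads D ord v s s') {w : Fin n} (hw : w ≠ v) {a : ℕ}
    (ha : a ∈ [0, 1, 2, 3, 4]) : s'.real a w = s.real a w :=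
  hR.other w (fun h => hw (Fin.ext h)) a ha

theorem eval_wallStart (hR : Reads D ord v s s') (ht : D.top v ≠ v) :
    wallStart.eval s' = (D.withCircles s).wallStart v := by
  simp only [RExpr.wallStart, eval_add, eval_mul, eval_div, eval_ofNat, hR.eval_ofTop, hR.eval_own,
    hR.pre_eq, hR.S_eq, hR.real_eq ht (a := 2) (by decide)]
  rfl

theorem eval_wallHeight (hR : Reads D ord v s s') (ht : D.top v ≠ v) :
    wallHeight.eval s' = (D.withCircles s).wallHeight v := by
  simp only [RExpr.wallHeight, eval_sqrt, eval_add, eval_sub, eval_mul, eval_sq, eval_ofNat,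
    hR.eval_ofTop, hR.eval_own, hR.S_eq, hR.real_eq ht (a := 2) (by decide), hR.eval_wallStart ht]
  rfl

theorem eval_heavyRadius (hR : Reads D ord v s s') (hh : D.hv (D.top v) = some h)
    (hth : D.top h = D.top v) : heavyRadius.eval s' = D.heavyRadius h := by
  simp only [RExpr.heavyRadius, eval_add, eval_mul, eval_one, eval_ofNat, hR.eval_ofTop,
    hR.eval_ofHeavy hh, hR.L_eq, Layout.heavyRadius, hth]

theorem eval_pocketBase (hR : Reads D ord v s s') (ht : D.top v ≠ v)
    (hh : D.hv (D.top v) = some h) (hth : D.top h = D.top v) :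
    pocketBase.eval s' = (D.withCircles s).pocketBase v h := by
  simp only [RExpr.pocketBase, eval_add, eval_sub, hR.eval_ofTop, hR.eval_own,
    hR.eval_ofHeavy hh, hR.gap_eq, hR.pocketLength_eq, hR.real_eq ht (a := 2) (by decide),
    hR.eval_heavyRadius hh hth]
  rw [← hth]
  rfl

theorem eval_pocketDepth (hR : Reads D ord v s s') (ht : D.top v ≠ v)
    (hh : D.hv (D.top v) = some h) (hth : D.top h = D.top v) :
    pocketDepth.eval s' = (D.withCircles s).pocketDepth v h := by
  simp only [RExpr.pocketDepth, eval_add, eval_sub, eval_mul, eval_div, eval_sq, eval_ofNat,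
    hR.eval_ofTop, hR.eval_own, hR.S_eq, hR.real_eq ht (a := 2) (by decide),
    hR.eval_heavyRadius hh hth, hR.eval_pocketBase ht hh hth]
  rfl

theorem eval_pocketSide (hR : Reads D ord v s s') (ht : D.top v ≠ v)
    (hh : D.hv (D.top v) = some h) (hth : D.top h = D.top v) :
    pocketSide.eval s' = (D.withCircles s).pocketSide v h := by
  simp only [RExpr.pocketSide, eval_sqrt, eval_add, eval_sub, eval_sq,
    hR.eval_ofTop, hR.eval_own, hR.S_eq, hR.real_eq ht (a := 2) (by decide),
    hR.eval_pocketDepth ht hh hth]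
  rfl

/-- The indicator of heavy vertices selects the wall direction arithmetically, so no extra branch is
needed. -/
theorem eval_fx (hR : Reads D ord v s s') (ht : D.top v ≠ v) :
    ((1 - ofTop 13) * ofTop 3 - ofTop 13 * ofTop 4).eval s' = (D.withCircles s).fx (D.top v) := by
  simp only [eval_sub, eval_mul, eval_one, hR.eval_ofTop, hR.heavy_eq,
    hR.real_eq ht (a := 3) (by decide), hR.real_eq ht (a := 4) (by decide), withCircles_fx]
  split_ifs <;> ring

theorem eval_fy (hR : Reads D ord v s s') (ht : D.top v ≠ v) :
    ((1 - ofTop 13) * ofTop 4 + ofTop 13 * ofTop 3).eval s' = (D.withCircles s).fy (D.top v) := by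
  simp only [eval_sub, eval_add, eval_mul, eval_one, hR.eval_ofTop, hR.heavy_eq,
    hR.real_eq ht (a := 3) (by decide), hR.real_eq ht (a := 4) (by decide), withCircles_fy]
  split_ifs <;> ring

end Reads

/-- Each branch of the program establishes one field of `PlacedAt`, and the tests on the way to it
refute the hypotheses of the others. -/
theorem positionStep_spec {G : SimpleGraph (Fin n)} (hD : D.Combinatorial G)
    (hR : Reads D ord v s s') :
    Tri B s₀ positionStep s' fun s'' => PlacedAt D s s'' v ∧ Reads D ord v s s'' := by
  have hcur : (WExpr.var 25).eval s' = v := hR.cur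
  refine Tri.ite (fun hb => ?_) (fun hb => ?_)
  all_goals simp only [Test.holds, WExpr.eval, hR.cur, hR.val_eq_zero] at hb
  · have hl : ¬ D.Light v := fun h => h.1 hb
    refine placeProgram_spec (Dx := 0) (Dy := -1) (R := D.b v) (Cx := 0) (Cy := 0) hR
      (fun s' _ => eval_zero s') (fun s' _ => ?_) (fun s' h' => ?_) (fun s' _ _ _ _ => eval_zero s')
      (fun s' _ _ _ _ => eval_zero s') fun s'' h' k3 k4 k2 k0 k1 => ⟨⟨fun _ => ⟨k3, k4, k2, k0, k1⟩,
      fun h => absurd hb h.1, fun h => absurd h hl, fun h => absurd h hl,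
      fun h => absurd h hl, fun h => absurd h hl, fun h => absurd h hl, fun h => absurd h hl,
      fun h => absurd h hl⟩, h'⟩
    · rw [eval_sub, eval_zero, eval_one, zero_sub]
    · rw [eval_mul, eval_ofNat, h'.eval_own, h'.W_eq, Layout.b]
  have ht : D.top v ≠ v := fun h => by
    have := hD.idx_top hb
    rw [h] at this
    exact lt_irrefl _ this
  have hp : D.par v ≠ v := fun h => by
    have := hD.idx_par hb
    rw [h] at this
    exact lt_irrefl _ this
  refine Tri.ite (fun hb2 => ?_) (fun hb2 => ?_)
  all_goals rw [hR.heavyTest_iff hcur] at hb2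
  · have hl : ¬ D.Light v := fun h => h.2 hb2.2
    refine placeProgram_spec hR (fun s' h' => (h'.eval_ofTop 3).trans (h'.real_eq ht (by decide)))
      (fun s' h' => (h'.eval_ofTop 4).trans (h'.real_eq ht (by decide))) (R := D.heavyRadius v)
      (Cx := s.real 0 (D.top v) + (D.withCircles s).heavyDist v * s.real 3 (D.top v))
      (Cy := s.real 1 (D.top v) + (D.withCircles s).heavyDist v * s.real 4 (D.top v))
      (fun s' h' => ?_) (fun s' h' k3 k4 k2 => ?_) (fun s' h' k3 k4 k2 => ?_)
      fun s'' h' k3 k4 k2 k0 k1 => ⟨⟨fun h => absurd h hb, fun _ => ⟨k3, k4, k2, k0, k1⟩,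
      fun h => absurd h hl, fun h => absurd h hl, fun h => absurd h hl, fun h => absurd h hl,
      fun h => absurd h hl, fun h => absurd h hl, fun h => absurd h hl⟩, h'⟩
    · simp only [eval_mul, eval_add, eval_one, eval_ofNat, h'.eval_own, h'.eval_ofTop, h'.L_eq,
        Layout.heavyRadius]
    · simp only [eval_mul, eval_add, h'.eval_own, h'.eval_ofTop, h'.gap_eq, k2,
        h'.real_eq ht (a := 0) (by decide), h'.real_eq ht (a := 2) (by decide),
        h'.real_eq ht (a := 3) (by decide)]
      rfl
    · simp only [eval_mul, eval_add, h'.eval_own, h'.eval_ofTop, h'.gap_eq, k2,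
        h'.real_eq ht (a := 1) (by decide), h'.real_eq ht (a := 2) (by decide),
        h'.real_eq ht (a := 4) (by decide)]
      rfl
  have hl : D.Light v := (Layout.Combinatorial.light_or_heavy hb).resolve_right hb2
  have hnr : ∀ {p : Prop}, v = D.root → p := fun h => absurd h hb
  have hnh : ∀ {p : Prop}, D.Heavy v → p := fun h => absurd h hb2
  refine Tri.ite (fun hf => ?_) (fun hf => ?_)
  all_goals rw [hR.firstTest_iff hcur] at hf
  · have hnf : ∀ {p : Prop}, ¬ D.First v → p := fun h => absurd hf h
    refine Tri.ite (fun hw => ?_) (fun hw => ?_)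
    all_goals rw [hR.wallTest_iff hcur] at hw
    · have hnb : ∀ {p : Prop}, D.Before v → p := fun h => by
        obtain ⟨h', h1, h2⟩ := h.2
        exact absurd h2 (hw.2 h' h1)
      have hna : ∀ {p : Prop}, D.After v → p := fun h => absurd hw.1 h
      refine Tri.ite (fun hla => ?_) (fun hla => ?_)
      all_goals simp only [Test.holds, WExpr.eval, hR.cur, hR.last_iff] at hla
      · refine placeRun_spec hR ht (fun s' h' => h'.eval_fx ht) (fun s' h' => h'.eval_fy ht)
          (R := √(s.real 2 (D.top v) ^ 2 + 4 * D.S v * s.real 2 (D.top v)) - s.real 2 (D.top v))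
          (fun s' h' => ?_) (fun s' h' _ => h'.eval_wallStart ht)
          (fun s' h' => h'.eval_wallHeight ht) fun s'' h' hs => ⟨⟨hnr, hnh, fun _ => hnf,
          fun _ => hnf, fun _ => hnf, fun _ _ _ _ => hs, fun _ _ _ h => absurd hla h,
          fun _ _ => hnb, fun _ _ => hna⟩, h'⟩
        simp only [eval_sub, eval_sqrt, eval_add, eval_sq, eval_mul, eval_ofNat, h'.eval_own,
          h'.eval_ofTop, h'.S_eq, h'.real_eq ht (a := 2) (by decide)]
      · refine placeRun_spec hR ht (fun s' h' => h'.eval_fx ht) (fun s' h' => h'.eval_fy ht)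
          (R := 2 * D.S v * s.real 2 (D.top v) /
            (s.real 2 (D.top v) + (D.withCircles s).wallStart v))
          (fun s' h' => ?_) (fun s' h' k2 => ?_)
          (fun s' h' => h'.eval_wallHeight ht) fun s'' h' hs => ⟨⟨hnr, hnh, fun _ => hnf,
          fun _ => hnf, fun _ => hnf, fun _ _ _ h => absurd h hla, fun _ _ _ _ => hs,
          fun _ _ => hnb, fun _ _ => hna⟩, h'⟩
        · simp only [eval_add, eval_mul, eval_div, eval_ofNat, h'.eval_own,
            h'.eval_ofTop, h'.S_eq, h'.real_eq ht (a := 2) (by decide), h'.eval_wallStart ht]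
        · rw [eval_sub, h'.eval_wallStart ht, h'.eval_own, k2]
    · have hnw : ∀ {p : Prop}, D.Wall v → p := fun h => absurd h hw
      refine Tri.ite (fun hpt => ?_) (fun hpt => ?_)
      all_goals simp only [Test.holds, WExpr.eval, hR.cur, hR.par_eq, hR.top_eq, Fin.val_inj] at hpt
      · have hna : ∀ {p : Prop}, D.After v → p := fun h => absurd hpt h
        have : ∃ h, D.hv (D.top v) = some h ∧ D.blk h = v := by
          by_contra h5
          exact hw ⟨hpt, fun h h6 h7 => h5 ⟨h, h6, h7⟩⟩
        obtain ⟨h, hh, -⟩ := this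
        have hth := (hD.hv_some _ h hh).2.1
        refine placeRun_spec hR ht (Dx := - s.real 4 (D.top v)) (fun s' h' => ?_)
          (fun s' h' => (h'.eval_ofTop 3).trans (h'.real_eq ht (by decide)))
          (fun s' h' => (h'.eval_own 7).trans (h'.S_eq v))
          (fun s' h' _ => h'.eval_pocketDepth ht hh hth)
          (fun s' h' => h'.eval_pocketSide ht hh hth) fun s'' h' hs => ⟨⟨hnr, hnh, fun _ => hnf,
          fun _ => hnf, fun _ => hnf, fun _ _ => hnw, fun _ _ => hnw,
          fun _ _ _ h' hh' => ?_, fun _ _ => hna⟩, h'⟩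
        · rw [eval_sub, eval_zero, zero_sub, h'.eval_ofTop, h'.real_eq ht (by decide)]
        · obtain rfl : h = h' := Option.some.inj (hh.symm.trans hh')
          exact hs
      · have hnb : ∀ {p : Prop}, D.Before v → p := fun h => absurd h.1 hpt
        have : ∃ h, D.hv (D.top v) = some h := by
          rcases hD.blockTree.top_cases v hb with h4 | ⟨-, h4⟩
          · exact absurd h4.symm hpt
          · rcases hf with h2 | h2
            exacts [absurd h2 hpt, ⟨_, h4 ▸ h2.2⟩]
        obtain ⟨h, hh⟩ := this
        have hth := (hD.hv_some _ h hh).2.1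
        refine placeRun_spec hR ht (Dy := - s.real 3 (D.top v))
          (X := -((D.withCircles s).pocketDepth v h + D.pocketLength v))
          (fun s' h' => (h'.eval_ofTop 4).trans (h'.real_eq ht (by decide))) (fun s' h' => ?_)
          (fun s' h' => (h'.eval_own 7).trans (h'.S_eq v)) (fun s' h' _ => ?_)
          (fun s' h' => h'.eval_pocketSide ht hh hth) fun s'' h' hs => ⟨⟨hnr, hnh, fun _ => hnf,
          fun _ => hnf, fun _ => hnf, fun _ _ => hnw, fun _ _ => hnw,
          fun _ _ => hnb, fun _ _ _ h' hh' => ?_⟩, h'⟩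
        · rw [eval_sub, eval_zero, zero_sub, h'.eval_ofTop, h'.real_eq ht (by decide)]
        · rw [eval_sub, eval_zero, zero_sub, eval_add, h'.eval_pocketDepth ht hh hth, h'.eval_own,
            h'.pocketLength_eq]
        · obtain rfl : h = h' := Option.some.inj (hh.symm.trans hh')
          exact hs
  · have hnf : ∀ {p : Prop}, D.First v → p := fun h => absurd h hf
    refine Tri.ite (fun hla => ?_) (fun hla => ?_)
    all_goals simp only [Test.holds, WExpr.eval, hR.cur, hR.last_iff] at hla
    · have hsg : (WExpr.get 12 (.var 25)).eval s' = D.sg v := by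
        rw [WExpr.eval, hcur, hR.sg_eq]
      refine Tri.ite (fun hw => ?_) (fun hw => ?_)
      all_goals rw [hR.wallTest_iff hsg] at hw
      · obtain ⟨a, ha⟩ : ∃ a, a = (s.real 0 (D.par v) - s.real 0 (D.top v)) * s.real 4 (D.par v) -
            (s.real 1 (D.par v) - s.real 1 (D.top v)) * s.real 3 (D.par v) + s.real 2 (D.par v) :=
          ⟨_, rfl⟩
        obtain ⟨b, hb⟩ : ∃ b, b = (s.real 0 (D.par v) - s.real 0 (D.top v)) * s.real 3 (D.par v) +
            (s.real 1 (D.par v) - s.real 1 (D.top v)) * s.real 4 (D.par v) := ⟨_, rfl⟩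
        refine placeNext_spec hR hp (R := (a ^ 2 + b ^ 2 - s.real 2 (D.top v) ^ 2) /
          (2 * (s.real 2 (D.top v) - a))) (fun s' h' => ?_) fun s'' h' hs => ⟨⟨hnr, hnh,
          fun _ _ h => absurd hla h, fun _ _ _ _ a' b' ha' hb' => ?_, fun _ _ _ h => absurd hw h,
          fun _ => hnf, fun _ => hnf, fun _ => hnf, fun _ => hnf⟩, h'⟩
        rotate_left
        · rw [ha', hb', ← ha, ← hb]
          exact hs
        · rw [ha, hb]
          simp only [RExpr.lam, RExpr.eta, eval_div, eval_add, eval_sub, eval_mul, eval_sq,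
            eval_ofNat, h'.eval_ofPar, h'.eval_ofTop,
            h'.real_eq ht (a := 0) (by decide), h'.real_eq ht (a := 1) (by decide),
            h'.real_eq ht (a := 2) (by decide), h'.real_eq hp (a := 0) (by decide),
            h'.real_eq hp (a := 1) (by decide), h'.real_eq hp (a := 2) (by decide),
            h'.real_eq hp (a := 3) (by decide), h'.real_eq hp (a := 4) (by decide)]
      · refine placeNext_spec hR hp (R := D.S (D.sg v)) (fun s' h' => ?_) fun s'' h' hs => ⟨⟨hnr, hnh,
          fun _ _ h => absurd hla h, fun _ _ _ h => absurd h hw, fun _ _ _ _ => hs,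
          fun _ => hnf, fun _ => hnf, fun _ => hnf, fun _ => hnf⟩, h'⟩
        simp only [eval_get, WExpr.eval, h'.cur, h'.sg_eq, h'.S_eq]
    · refine placeNext_spec hR hp (R := D.b v) (fun s' h' => ?_) fun s'' h' hs => ⟨⟨hnr, hnh,
        fun _ _ _ => hs, fun _ _ h => absurd h hla, fun _ _ h => absurd h hla,
        fun _ => hnf, fun _ => hnf, fun _ => hnf, fun _ => hnf⟩, h'⟩
      rw [eval_mul, eval_ofNat, h'.eval_own, h'.W_eq, Layout.b]

/-- In the order of discovery the top and the parent are placed before the vertex, so the circles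
read in a round are the final ones. -/
theorem positionProgram_spec {G : SimpleGraph (Fin n)} (hB : 4 * (n * n) ≤ B)
    (h0 : s₀.word 0 0 = n) (hs : s.word 0 = s₀.word 0) (hD : D.Combinatorial G)
    (hT : HasSizes D ord s) {Q : State → Prop}
    (hQ : ∀ s', (D.withCircles s').Geometric → Q s') :
    Tri B s₀ positionProgram s Q := by
  have hnn : n ≤ n * n := Nat.le_mul_self n
  refine Tri.pass (N := n) [] [0, 1, 2, 3, 4] (fun k => ord k) (fun k s' s'' =>
    PlacedAt D s' s'' (ord k)) hT.ord_inj hs (fun s' h => by simp [WExpr.eval, h, h0]) (by omega)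
    (by norm_num) (by decide) (by decide) (by decide) ?_ ?_
  · intro k hk s1 hs1 hf1 hc1
    have hT1 := hT.frame hf1 (by decide) (by decide)
    have hv := (ord k).2
    refine Tri.seq (Tri.setWord (by simp only [WExpr.eval, hc1, hT1.ord_eq]; omega) ?_)
    simp only [WExpr.eval, hc1, hT1.ord_eq]
    have hR : Reads D ord (ord k) s1 (s1.putWord 25 0 (ord k)) :=
      { hT1.frame (Frame.putWord (A := [25]) (R := []) s1 (by simp)) (by decide) (by decide) with
        cur := by simp [State.putWord_word]
        other := fun i _ a _ => by rw [State.putWord_real] }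
    refine (positionStep_spec hD hR).mono fun s'' _ h => ⟨h.1, fun i hi => ?_⟩
    exact ⟨by simp, fun a ha => h.2.other i hi a ha⟩
  · intro F hF hf hst
    refine hQ F (geometric_of_placedAt hD fun v => ?_)
    obtain ⟨s', s'', -, -, h, hag, hag'⟩ := hst (D.idx v) (hT.idx_lt v)
    rw [hT.ord_idx] at h hag'
    refine h.congr hag'.2 (fun hv => ?_) (fun hv => ?_) fun x hx => (hD.hv_some _ x hx).2.1
    · have := (hag _ (hD.idx_top hv)).2
      rwa [hT.ord_idx] at this
    · have := (hag _ (hD.idx_par hv)).2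
      rwa [hT.ord_idx] at this

end

end RealRAM


/-! ## The main theorem -/

theorem IsBiconnectedSubgraph.map {V V' : Type*} {G : SimpleGraph V} {G' : SimpleGraph V'}
    (f : G ≃g G') {H : G.Subgraph} (hH : IsBiconnectedSubgraph H) :
    IsBiconnectedSubgraph (H.map f.toHom) := by
  have hconn : ∀ H : G.Subgraph, H.Connected → (H.map f.toHom).Connected := by
    intro H h
    refine ⟨SimpleGraph.Connected.map (G := H.coe) ⟨fun v => ⟨f v, v, v.2, rfl⟩, fun {a b} hab => ?_⟩ ?_ h.coe⟩
    · exact ⟨a, b, hab, rfl, rfl⟩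
    · rintro ⟨_, v, hv, rfl⟩
      exact ⟨⟨v, hv⟩, rfl⟩
  refine ⟨?_, hconn H hH.connected, ?_⟩
  · rw [SimpleGraph.Subgraph.edgeSet_map]
    exact hH.edge.image _
  · rintro _ ⟨v, hv, rfl⟩
    convert hconn _ (hH.no_cut_vertex v hv) using 1
    have hinj := f.injective
    ext a b
    · simp only [SimpleGraph.Subgraph.deleteVerts_verts, SimpleGraph.Subgraph.map_verts, Set.mem_sdiff,
        Set.mem_image, Set.mem_singleton_iff]
      constructor
      · rintro ⟨⟨x, hx, rfl⟩, h⟩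
        exact ⟨x, ⟨hx, fun h' => h (h' ▸ rfl)⟩, rfl⟩
      · rintro ⟨x, ⟨hx, h⟩, rfl⟩
        exact ⟨⟨x, hx, rfl⟩, fun h' => h (hinj h')⟩
    · simp only [SimpleGraph.Subgraph.deleteVerts_adj, SimpleGraph.Subgraph.map_adj, Relation.Map,
        SimpleGraph.Subgraph.map_verts, Set.mem_image, Set.mem_singleton_iff]
      constructor
      · rintro ⟨-, h1, -, h2, x, y, h3, rfl, rfl⟩
        exact ⟨x, y, ⟨H.edge_vert h3, fun h' => h1 (h' ▸ rfl), H.edge_vert h3.symm,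
          fun h' => h2 (h' ▸ rfl), h3⟩, rfl, rfl⟩
      · rintro ⟨x, y, ⟨h1, h2, h3, h4, h5⟩, rfl, rfl⟩
        exact ⟨⟨x, h1, rfl⟩, fun h' => h2 (hinj h'), ⟨y, h3, rfl⟩, fun h' => h4 (hinj h'),
          x, y, h5, rfl, rfl⟩

/-- A block is pulled back to a block, recognized there as an edge or a cycle, and pushed forward
again. -/
theorem IsCactus.of_iso {V V' : Type*} {G : SimpleGraph V} {G' : SimpleGraph V'} (f : G ≃g G')
    (hG : IsCactus G) : IsCactus G' := by
  have hmap : ∀ H : G'.Subgraph, (H.map f.symm.toHom).map f.toHom = H := fun H => by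
    rw [← SimpleGraph.Subgraph.map_comp]
    convert H.map_id
    ext x
    exact f.apply_symm_apply x
  have hmap' : ∀ H : G.Subgraph, (H.map f.toHom).map f.symm.toHom = H := fun H => by
    rw [← SimpleGraph.Subgraph.map_comp]
    convert H.map_id
    ext x
    exact f.symm_apply_apply x
  refine ⟨f.connected_iff.1 hG.connected, fun H hH => ?_⟩
  have hB : IsBiconnectedComponent (H.map f.symm.toHom) := by
    refine ⟨hH.1.map f.symm, fun K hK hle => ?_⟩
    have h1 : H ≤ K.map f.toHom := by
      rw [← hmap H]
      exact SimpleGraph.Subgraph.map_mono hle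
    rw [← hmap' K]
    exact SimpleGraph.Subgraph.map_mono (hH.2 (hK.map f) h1)
  rw [← hmap H]
  rcases hG.blocks _ hB with ⟨u, v, h, e⟩ | ⟨v, p, hp, e⟩
  · rw [e, SimpleGraph.map_subgraphOfAdj]
    exact Or.inl ⟨_, _, _, rfl⟩
  · rw [e, ← SimpleGraph.Walk.toSubgraph_map]
    exact Or.inr ⟨_, _, (SimpleGraph.Walk.isCycle_map_iff_of_injective f.injective).2 hp, rfl⟩

theorem RealRAM.exists_isEdgeList {n : ℕ} (G : SimpleGraph (Fin n)) :
    ∃ E : List (Fin n × Fin n), IsEdgeList G E := by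
  classical
  have h : ((G.edgeFinset.toList.map Quot.out).map fun e : Fin n × Fin n => s(e.1, e.2)) =
      G.edgeFinset.toList := by
    rw [List.map_map]
    refine List.map_id'' (fun e => ?_) _
    exact Quot.out_eq e
  refine ⟨G.edgeFinset.toList.map Quot.out, ?_, fun u v => ?_⟩
  · rw [h]; exact Finset.nodup_toList _
  · rw [h]; simp

namespace RealRAM

/-- The program that draws a cactus. -/
def cactusProgram : Program :=
  .seq adjacencyProgram <| .seq searchProgram <| .seq ancestorProgram <| .seq backProgram <|
  .seq topProgram <| .seq weightProgram <| .seq sizeProgram positionProgram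

theorem cactusProgram_spec {n B : ℕ} {G : SimpleGraph (Fin n)} {E : List (Fin n × Fin n)}
    (hn : 0 < n) (hG : IsCactus G) (hE : IsEdgeList G E) (hB : 4 * (n * n) ≤ B) :
    Tri B (input n E) cactusProgram (input n E) fun s =>
      IsCircleContactRep G (outCenter n s) (outRadius n s) ∧
        DiameterRatioLE (outRadius n s) ((100000 : ℕ) * (n : ℝ) ^ 18) := by
  have h0 : (input n E).word 0 0 = n := by simp [input]
  refine Tri.seq (adjacencyProgram_spec hE hB fun s1 hs1 hf1 hA => ?_)
  have hzero : ∀ a k, 3 < a → a ≠ 20 → s1.word a k = 0 := by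
    intro a k ha ha'
    rw [hf1.word a (by simp; omega)]
    simp only [input]
    rw [if_neg (by omega), if_neg (by omega), if_neg (by omega)]
  refine Tri.seq (searchProgram_spec hn hG.connected hB h0 hs1 hA
    (fun k => hzero 4 k (by norm_num) (by norm_num)) (fun k => hzero 5 k (by norm_num) (by norm_num))
    (fun k => hzero 6 k (by norm_num) (by norm_num))
    (hzero 23 0 (by norm_num) (by norm_num)) ?_)
  rintro s2 hs2 hf2 ⟨root, par, idx, ord, hT⟩
  replace hA : HasAdj G s2 := fun u v => by rw [hf2.word 3 (by decide)]; exact hA u v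
  refine Tri.seq (ancestorProgram_spec hB h0 hs2 hT fun s3 hs3 hf3 hAn => ?_)
  replace hA : HasAdj G s3 := fun u v => by rw [hf3.word 3 (by decide)]; exact hA u v
  replace hT := hT.frame (hf3.word 4 (by decide)) (hf3.word 5 (by decide)) (hf3.word 6 (by decide))
  refine Tri.seq (backProgram_spec hB h0 hs3 hA hT hAn fun s4 hs4 hf4 hBk => ?_)
  replace hT := hT.frame (hf4.word 4 (by decide)) (hf4.word 5 (by decide)) (hf4.word 6 (by decide))
  replace hAn : HasAnc root par s4 := fun u v => by rw [hf4.word 8 (by decide)]; exact hAn u v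
  refine Tri.seq (topProgram_spec hG hB h0 hs4 hT hAn hBk ?_)
  rintro s5 hs5 hf5 ⟨top, hb, htop⟩
  replace hT := hT.frame (hf5.word 4 (by decide)) (hf5.word 5 (by decide)) (hf5.word 6 (by decide))
  refine Tri.seq (weightProgram_spec hB h0 hs5 hT hb htop ?_)
  rintro s6 hs6 hf6 ⟨D, rfl, rfl, rfl, rfl, hD, hW⟩
  refine Tri.seq (sizeProgram_spec hB h0 hs6 hD hW hb ?_)
  rintro s7 hs7 ⟨D', hC, hD'⟩
  refine positionProgram_spec hB h0 hs7 hC hD' fun s8 hg => ?_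
  -- The combinatorial laws do not involve the circles.
  have hC' : (D'.withCircles s8).Combinatorial G := ⟨hC.1, hC.2, hC.3, hC.4, hC.5, hC.6, hC.7, hC.8,
    hC.9, hC.10, hC.11, hC.12⟩
  have := hC'.diameterRatioLE hg
  rw [Fintype.card_fin] at this
  exact ⟨hC'.isCircleContactRep hg, this⟩

/-- Loops are nested at most twice and run at most `2 * n` times, apart from the single loop over
the at most `n ^ 2` edges. The time is thus an explicit quadratic expression. -/
theorem cactusProgram_time {n : ℕ} {G : SimpleGraph (Fin n)} {E : List (Fin n × Fin n)}
    (hn : 0 < n) (hE : IsEdgeList G E) :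
    cactusProgram.time (input n E) ≤ 400 * n ^ 2 := by
  have h0 : (input n E).word 0 0 = n := by simp [input]
  have h1 : (input n E).word 0 1 = E.length := by simp [input]
  have h2 := hE.length_le
  simp only [cactusProgram, adjacencyProgram, searchProgram, ancestorProgram, backProgram,
    topProgram, weightProgram, sizeProgram, runProgram, flagProgram, sumProgram, positionProgram,
    positionStep, placeRun, placeNext, placeProgram, Program.scan, Program.scanReal, Program.forTo,
    Program.time, Test.limit, WExpr.eval, h0, h1]
  have h3 : n ≤ n ^ 2 := Nat.le_self_pow (by norm_num) n
  rw [← sq] at h2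
  ring_nf
  omega

end RealRAM

theorem mainTheorem7 :
    ∃ c d : ℕ,
      (∀ (V : Type*) [Fintype V] (G : SimpleGraph V), IsCactus G →
        ∃ (center : V → EuclideanSpace ℝ (Fin 2)) (radius : V → ℝ),
          IsCircleContactRep G center radius ∧
          DiameterRatioLE radius (c * (Fintype.card V : ℝ) ^ d)) ∧
      ∃ (P : RealRAM.Program) (K : ℕ),
        ∀ (n : ℕ) (G : SimpleGraph (Fin n)) (E : List (Fin n × Fin n)),
          IsCactus G → RealRAM.IsEdgeList G E →
          ∃ (t : ℕ) (s : RealRAM.State),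
            RealRAM.Exec (K * n ^ K) P (RealRAM.input n E) t s ∧
            t ≤ K * n ^ 2 ∧
            IsCircleContactRep G (RealRAM.outCenter n s) (RealRAM.outRadius n s) ∧
            DiameterRatioLE (RealRAM.outRadius n s) (c * (n : ℝ) ^ d) := by
  have main : ∀ (n : ℕ) (G : SimpleGraph (Fin n)) (E : List (Fin n × Fin n)),
      IsCactus G → RealRAM.IsEdgeList G E →
      ∃ (t : ℕ) (s : RealRAM.State),
        RealRAM.Exec (400 * n ^ 400) RealRAM.cactusProgram (RealRAM.input n E) t s ∧
        t ≤ 400 * n ^ 2 ∧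
        IsCircleContactRep G (RealRAM.outCenter n s) (RealRAM.outRadius n s) ∧
        DiameterRatioLE (RealRAM.outRadius n s) ((100000 : ℕ) * (n : ℝ) ^ 18) := by
    intro n G E hG hE
    obtain ⟨v⟩ := hG.connected.nonempty
    have hn : 0 < n := v.pos
    -- The program needs words up to `4 * n ^ 2` only; the same constant `K` has to serve as factor
    -- and exponent here and as the factor in the time bound.
    have hB : ∀ K, 4 ≤ K → 4 * (n * n) ≤ K * n ^ K := fun K hK => by
      rw [← sq]
      exact Nat.mul_le_mul hK (Nat.pow_le_pow_right hn (by omega))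
    obtain ⟨t, s, h1, h2, h3⟩ := RealRAM.cactusProgram_spec hn hG hE (hB 400 (by norm_num))
    exact ⟨t, s, h1, h2.trans (RealRAM.cactusProgram_time hn hE), h3⟩
  refine ⟨100000, 18, fun V _ G hG => ?_, RealRAM.cactusProgram, 400, main⟩
  -- The output on a numbered copy of the graph is carried back along the numbering.
  have e := Fintype.equivFin V
  have f : G.comap e.symm ≃g G := SimpleGraph.Iso.comap e.symm G
  obtain ⟨E, hE⟩ := RealRAM.exists_isEdgeList (G.comap e.symm)
  obtain ⟨-, s, -, -, h3, h4⟩ := main _ _ E (hG.of_iso f.symm) hE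
  refine ⟨fun v => RealRAM.outCenter _ s (e v), fun v => RealRAM.outRadius _ s (e v),
    ⟨fun v => h3.radius_pos _, fun u v huv => h3.interior_disjoint _ _ (e.injective.ne huv),
      fun u v huv => ?_⟩, fun u v => h4 _ _⟩
  rw [← h3.adj_iff_tangent _ _ (e.injective.ne huv)]
  simp
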